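/- Let $F$ be a field and let $A$ be a central simple $F$-algebra of degree $\deg A=\sqrt{\dim_F A}$ and index $\operatorname{ind}A$ (the degree of the division algebra $E$ with $A\cong M_m(E)$). For integers $1\le n_1<\dots<n_k\le \deg A$ with $k\ge 1$, the Severi–Brauer flag variety $V_{n_1,\dots,n_k}(A)$ is the $F$-scheme representing the functor which sends a commutative $F$-algebra $R$ to the set of flags $I_1\subset\dots\subset I_k$ of right ideals of $A_R=R\otimes_F A$ such that each $I_i$ is an $R$-module direct summand of $A_R$ of rank $n_i\deg A$. For a scheme $X$ over a field $K$, two points of $X(K)$ are *elementarily linked* if both lie in the image of the $K$-points under a rational map $\mathbb P^1_K\dashrightarrow X$ over $K$. R-equivalence is the equivalence relation generated by this, and $X$ is *R-trivial* if $X(K)/R$ has exactly one element. A morphism $f:X\to Y$ of $F$-schemes *has R-trivial fibers* if for every field extension $L/F$ and every $y\in Y(L)$ the scheme-theoretic fiber $X_y=X\times_Y\operatorname{Spec}L$ is an R-trivial $L$-scheme. *Stable R-isomorphism* is the equivalence relation on projective varieties (integral closed subschemes of some $\mathbb P^N_F$) over $F$ generated by relating $X$ and $Y$ whenever there is an $F$-morphism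 $X\to Y$ with R-trivial fibers. **Theorem.** Let $A$ be a central simple $F$-algebra, let $1\le n_1<\dots<n_k\le\deg A$ with $k\ge1$, let $D$ be any central simple $F$-algebra Brauer equivalent to $A$, and let $d=\gcd(n_1,\dots,n_k,\operatorname{ind}A)$. Then $V_{n_1,\dots,n_k}(A)$ and $V_d(D)$ exist as projective varieties over $F$, and $V_{n_1,\dots,n_k}(A)$ is stably R-isomorphic to $V_d(D)$. -/

import Mathlib

open CategoryTheory CategoryTheory.Limits AlgebraicGeometry TensorProduct

universe u

namespace SBFlag

noncomputable section

/-! ### Central simple algebras -/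

/-- The degree `√(dim_F A)` of a central simple algebra, whose dimension is a square. -/
def degree (F A : Type u) [Field F] [Ring A] [Algebra F A] : ℕ :=
  Nat.sqrt (Module.finrank F A)

/-- The index of a central simple algebra: the degree of a division algebra `E` such that
`A ≅ M_m(E)`. By Wedderburn's theorem the set below has exactly one element. -/
def index (F A : Type u) [Field F] [Ring A] [Algebra F A] : ℕ :=
  sInf {i | ∃ (E : Type u) (_ : DivisionRing E) (_ : Algebra F E) (m : ℕ),
    Nonempty (A ≃ₐ[F] Matrix (Fin m) (Fin m) E) ∧ i = degree F E}

/-! ### Schemes over a field, points, projective space -/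

/-- `Spec R` as a scheme over `F`, for an `F`-algebra `R`. -/
def specOver (F R : Type u) [Field F] [CommRing R] [Algebra F R] : Over (Spec (.of F)) :=
  Over.mk (Spec.map (CommRingCat.ofHom (algebraMap F R)))

/-- The morphism `Spec S ⟶ Spec R` over `F` induced by a homomorphism `R → S` of `F`-algebras. -/
def specOverMap {F R S : Type u} [Field F] [CommRing R] [Algebra F R] [CommRing S] [Algebra F S]
    (f : R →ₐ[F] S) : specOver F S ⟶ specOver F R :=
  Over.homMk (Spec.map (CommRingCat.ofHom f.toRingHom)) (by
    change Spec.map _ ≫ Spec.map _ = Spec.map _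
    rw [← Spec.map_comp, ← CommRingCat.ofHom_comp]
    congr 2
    exact f.comp_algebraMap)

/-- The set `X(L)` of `L`-points of an `F`-scheme `X`, for an `F`-algebra `L`. -/
abbrev Points {F : Type u} [Field F] (X : Over (Spec (.of F))) (L : Type u) [CommRing L]
    [Algebra F L] : Type u :=
  specOver F L ⟶ X

attribute [local instance] MvPolynomial.gradedAlgebra in
/-- Projective space `ℙ^N` over `K`, as `Proj K[x_0, …, x_N]` with its structure morphism. -/
def projectiveSpace (K : Type u) [Field K] (N : ℕ) : Over (Spec (.of K)) :=
  Over.mk (Proj.toSpecZero (MvPolynomial.homogeneousSubmodule (Fin (N + 1)) K) ≫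
    Spec.map (CommRingCat.ofHom
      (algebraMap K (MvPolynomial.homogeneousSubmodule (Fin (N + 1)) K 0))))

/-- A projective variety over `F`: an integral closed subscheme of some `ℙ^N` over `F`. -/
structure ProjectiveVariety (F : Type u) [Field F] where
  /-- The underlying `F`-scheme. -/
  scheme : Over (Spec (.of F))
  isIntegral : IsIntegral scheme.left
  exists_closedImmersion :
    ∃ (N : ℕ) (i : scheme ⟶ projectiveSpace F N), IsClosedImmersion i.left

/-! ### R-equivalence -/

/-- Two `K`-points of a `K`-scheme `X` are elementarily linked if both lie in the image of the
`K`-points under a rational map `φ : ℙ¹ ⤏ X` over `K`. (That `q₁` and `q₂` are `K`-points of `ℙ¹`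
follows from the equations.) -/
def ElementarilyLinked {K : Type u} [Field K] (X : Over (Spec (.of K))) (p₁ p₂ : Points X K) :
    Prop :=
  ∃ φ : (projectiveSpace K 1).left.PartialMap X.left,
    φ.hom ≫ X.hom = φ.domain.ι ≫ (projectiveSpace K 1).hom ∧
    (∃ q₁ : Spec (.of K) ⟶ φ.domain, q₁ ≫ φ.hom = p₁.left) ∧
    (∃ q₂ : Spec (.of K) ⟶ φ.domain, q₂ ≫ φ.hom = p₂.left)

/-- R-equivalence on `X(K)`: the equivalence relation generated by elementary linkage. -/
def rSetoid {K : Type u} [Field K] (X : Over (Spec (.of K))) : Setoid (Points X K) :=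
  Relation.EqvGen.setoid (ElementarilyLinked X)

/-- `X` is R-trivial if `X(K)/R` has cardinality `1`. -/
def RTrivial {K : Type u} [Field K] (X : Over (Spec (.of K))) : Prop :=
  Nat.card (Quotient (rSetoid X)) = 1

/-- `f : X ⟶ Y` has R-trivial fibers if for every field extension `L/F` and every `y ∈ Y(L)` the
scheme-theoretic fiber `X ×_Y Spec L` is an R-trivial `L`-scheme. -/
def HasRTrivialFibers {F : Type u} [Field F] {X Y : Over (Spec (.of F))} (f : X ⟶ Y) : Prop :=
  ∀ (L : Type u) [Field L] [Algebra F L] (y : Points Y L),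
    RTrivial (K := L) (Over.mk (pullback.snd f.left (y.left : Spec (.of L) ⟶ Y.left)))

/-- Stable R-isomorphism: the equivalence relation on projective varieties over `F` generated by
`X ~ Y` whenever there is a morphism `X ⟶ Y` over `F` with R-trivial fibers. -/
def StablyRIsomorphic {F : Type u} [Field F] (X Y : ProjectiveVariety F) : Prop :=
  Relation.EqvGen (fun X Y : ProjectiveVariety F =>
    ∃ f : X.scheme ⟶ Y.scheme, HasRTrivialFibers f) X Y

/-! ### Severi–Brauer flag varieties -/

/-- Flags `I_1 ⊆ ⋯ ⊆ I_k` of right ideals of `A_R = R ⊗ A` which are (locally) direct summands as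
`R`-modules, the `i`-th of them of rank `n_i · deg A` over `R`. -/
structure RightIdealFlag {F : Type u} (A : Type u) [Field F] [Ring A] [Algebra F A] {k : ℕ}
    (n : Fin k → ℕ) (R : Type u) [CommRing R] [Algebra F R] where
  /-- The ideals of the flag. -/
  ideal : Fin k → Submodule R (R ⊗[F] A)
  mul_mem : ∀ i, ∀ x ∈ ideal i, ∀ y : R ⊗[F] A, x * y ∈ ideal i
  projective_quotient : ∀ i, Module.Projective R ((R ⊗[F] A) ⧸ ideal i)
  rank_eq : ∀ i (p : PrimeSpectrum R), Module.rankAtStalk (ideal i) p = n i * degree F A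
  monotone : Monotone ideal

/-- The `F`-scheme `X` represents the functor sending a commutative `F`-algebra `R` to the set of
flags of right ideals of `A_R` of type `n`: there are bijections between `X(R)` and that set, which
are natural in `R`, where a flag is transported along `f : R → S` by extension of scalars, that is,
`I` goes to the `S`-submodule of `A_S` generated by the image of `I`. -/
def IsSeveriBrauerFlagVariety {F : Type u} (A : Type u) [Field F] [Ring A] [Algebra F A] {k : ℕ}
    (n : Fin k → ℕ) (X : Over (Spec (.of F))) : Prop :=
  ∃ e : ∀ (R : Type u) [CommRing R] [Algebra F R], Points X R ≃ RightIdealFlag (F := F) A n R,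
    ∀ (R S : Type u) [CommRing R] [Algebra F R] [CommRing S] [Algebra F S] (f : R →ₐ[F] S)
      (x : Points X R) (i : Fin k),
      (e S (specOverMap f ≫ x)).ideal i =
        Submodule.span S (Algebra.TensorProduct.map f (AlgHom.id F A) '' (e R x).ideal i)

end

end SBFlag

/-! Let `L` be a field extension of `F`. Over `L`, a right ideal of `A_L` of rank `n_i · deg A` is a
module over a simple algebra, so it is a power of the simple right module. Hence a flag of type `n`
exists exactly when the dimension of that simple module, `ind(A_L) · deg A`, divides every `n_i ·
deg A`. Since `ind(A_L)` divides `ind A` and depends only on the Brauer class, this amounts to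
`ind(A_L) ∣ d`, which is also the condition for `V_d(D)` to have an `L`-point. The proof works with
the dimension `rightDim` instead of `ind(A_L)`; the arithmetic is `rightDim_dvd_iff`.

Let `Z` represent pairs of a flag in `A` and a flag in `D`, so that `Z = V_n(A) × V_d(D)`. The fiber
of `Z → V_n(A)` over an `L`-point is `V_d(D)_L`, which has a point by the above. It is R-trivial:
two flags over `L` differ by a unit `g` of `D_L` (`exists_translate_eq_of_field`), and the line `1 +
t(g - 1)`, where invertible, moves one to the other (`exists_unit_path`). By symmetry both
projections of `Z` have R-trivial fibers (`PairRepresentation.exists_hasRTrivialFibers`), which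
links the two varieties.

Most of the file constructs these schemes. A flag of right ideals is a family of direct summands of
a free module, stable under certain constant matrices. The family is packed into its direct sum, a
summand of a larger free module, and this is recorded by Plücker coordinates; the resulting
conditions are homogeneous equations (`exists_representation`, `isLocallyRowSpan_iff`,
`exists_representation_family`).

For integrality, let `K` be an algebraic closure of `F`. Over a local `K`-algebra the algebras split
and flags of one type are conjugate. So each point is a specialization of one point over a domain,
namely a fixed flag translated by a generic unit (`PairRepresentation.exists_dominating_point`).
This forces `Z` to be integral (`isIntegral_of_factorization`). A single flag variety is the case of
pairs whose second flag is empty. -/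

namespace SBFlag

noncomputable section

/-! ### Points of `Proj` given by ring homomorphisms -/

section ProjPoint

open HomogeneousLocalization

variable {σ A : Type u} [CommRing A] [SetLike σ A] [AddSubgroupClass σ A] (𝒜 : ℕ → σ)
  [GradedRing 𝒜]

/-- Evaluation of homogeneous fractions of degree zero under a ring homomorphism inverting the
denominator. -/
def awayEval {R : Type u} [CommRing R] (φ : A →+* R) (s : A) (hs : IsUnit (φ s)) :
    Away 𝒜 s →+* R :=
  (IsLocalization.Away.lift (S := Localization.Away s) s hs).comp
    (algebraMap (Away 𝒜 s) (Localization.Away s))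

variable {𝒜}

lemma awayEval_mk {R : Type u} [CommRing R] (φ : A →+* R) {s : A} (hs : IsUnit (φ s)) {m : ℕ}
    (hm : s ∈ 𝒜 m) (n : ℕ) (a : A) (ha : a ∈ 𝒜 (n • m)) :
    awayEval 𝒜 φ s hs (Away.mk 𝒜 hm n a ha) * φ s ^ n = φ a := by
  rw [awayEval, RingHom.comp_apply, HomogeneousLocalization.algebraMap_apply, Away.val_mk,
    Localization.mk_eq_mk', ← map_pow,
    ← IsLocalization.Away.lift_eq (S := Localization.Away s) s hs (s ^ n),
    ← IsLocalization.Away.lift_eq (S := Localization.Away s) s hs a, ← map_mul]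
  exact congrArg _ (IsLocalization.mk'_spec (M := Submonoid.powers s)
    (S := Localization (Submonoid.powers s)) a ⟨s ^ n, n, rfl⟩)

lemma awayEval_comp {R S : Type u} [CommRing R] [CommRing S] (ψ : R →+* S) (φ : A →+* R) {s : A}
    (hs : IsUnit (φ s)) (hs' : IsUnit ((ψ.comp φ) s)) :
    awayEval 𝒜 (ψ.comp φ) s hs' = ψ.comp (awayEval 𝒜 φ s hs) := by
  rw [awayEval, awayEval, ← RingHom.comp_assoc]
  congr 1
  apply IsLocalization.ringHom_ext (Submonoid.powers s)
  ext x
  simp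

lemma awayEval_awayMap {R : Type u} [CommRing R] (φ : A →+* R) {s t : A} {n : ℕ}
    (hn : t ∈ 𝒜 n) (hs : IsUnit (φ s)) (hst : IsUnit (φ (s * t))) :
    (awayEval 𝒜 φ (s * t) hst).comp (awayMap 𝒜 hn rfl) = awayEval 𝒜 φ s hs := by
  ext x
  rw [awayEval, awayEval, RingHom.comp_apply, RingHom.comp_apply, RingHom.comp_apply,
    HomogeneousLocalization.algebraMap_apply, HomogeneousLocalization.algebraMap_apply,
    val_awayMap, ← RingHom.comp_apply]
  congr 1
  apply IsLocalization.ringHom_ext (Submonoid.powers s)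
  ext x
  simp [Localization.awayLift]

lemma awayEval_map {τ B : Type u} [CommRing B] [SetLike τ B] [AddSubgroupClass τ B] {ℬ : ℕ → τ}
    [GradedRing ℬ] (f : 𝒜 →+*ᵍ ℬ) {R : Type u} [CommRing R] (φ : A →+* R) (ψ : B →+* R)
    (h : ∀ a, ψ (f a) = φ a) {s : A} (hs : IsUnit (φ s)) (hs' : IsUnit (ψ (f s))) {m : ℕ}
    (hm : s ∈ 𝒜 m) :
    (awayEval ℬ ψ (f s) hs').comp (Away.map f s) = awayEval 𝒜 φ s hs := by
  ext x
  obtain ⟨n, a, ha, rfl⟩ := Away.mk_surjective 𝒜 hm x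
  apply (hs.pow n).mul_right_cancel
  rw [awayEval_mk, RingHom.comp_apply, Away.map_mk, ← h, ← h, awayEval_mk]

variable (𝒜) in
/-- The point of `Proj` given by a ring homomorphism inverting a homogeneous element `s`. -/
def projPoint {R : Type u} [CommRing R] (φ : A →+* R) {s : A} {m : ℕ} (hm : s ∈ 𝒜 m) (h0 : 0 < m)
    (hs : IsUnit (φ s)) : Spec (.of R) ⟶ Proj 𝒜 :=
  Spec.map (CommRingCat.ofHom (awayEval 𝒜 φ s hs)) ≫ Proj.awayι 𝒜 s hm h0

/-- The chart `D₊(st)` is contained in `D₊(s)`, and the inclusion is `Spec` of `awayMap`. -/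
lemma projPoint_mul {R : Type u} [CommRing R] (φ : A →+* R) {s t : A} {m n : ℕ} (hm : s ∈ 𝒜 m)
    (h0 : 0 < m) (hn : t ∈ 𝒜 n) (h0' : 0 < m + n) (hs : IsUnit (φ s)) (hst : IsUnit (φ (s * t))) :
    projPoint 𝒜 φ hm h0 hs = projPoint 𝒜 φ (SetLike.mul_mem_graded hm hn) h0' hst := by
  rw [projPoint, projPoint, ← awayEval_awayMap φ hn hs hst, CommRingCat.ofHom_comp,
    Spec.map_comp, Category.assoc, Proj.SpecMap_awayMap_awayι]

/-- Serves to identify the denominators `s * t` and `t * s`, whose degrees `m + n` and `n + m` are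
not syntactically equal. -/
lemma projPoint_congr {R : Type u} [CommRing R] (φ : A →+* R) {s t : A} {m n : ℕ} (e : s = t)
    (hm : s ∈ 𝒜 m) (h0 : 0 < m) (hn : t ∈ 𝒜 n) (h0' : 0 < n) (hmn : m = n)
    (hs : IsUnit (φ s)) (ht : IsUnit (φ t)) :
    projPoint 𝒜 φ hm h0 hs = projPoint 𝒜 φ hn h0' ht := by
  subst e hmn
  rfl

/-- Both points factor through the overlap `D₊(st)`, where they coincide. -/
lemma projPoint_eq {R : Type u} [CommRing R] (φ : A →+* R) {s t : A} {m n : ℕ} (hm : s ∈ 𝒜 m)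
    (h0 : 0 < m) (hn : t ∈ 𝒜 n) (h0' : 0 < n) (hs : IsUnit (φ s)) (ht : IsUnit (φ t)) :
    projPoint 𝒜 φ hm h0 hs = projPoint 𝒜 φ hn h0' ht := by
  have hst : IsUnit (φ (s * t)) := by rw [map_mul]; exact hs.mul ht
  have hts : IsUnit (φ (t * s)) := by rw [map_mul]; exact ht.mul hs
  rw [projPoint_mul φ hm h0 hn (by omega) hs hst, projPoint_mul φ hn h0' hm (by omega) ht hts]
  exact projPoint_congr φ (mul_comm s t) _ _ _ _ (add_comm m n) _ _

lemma SpecMap_projPoint {R S : Type u} [CommRing R] [CommRing S] (ψ : R →+* S) (φ : A →+* R)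
    {s : A} {m : ℕ} (hm : s ∈ 𝒜 m) (h0 : 0 < m) (hs : IsUnit (φ s))
    (hs' : IsUnit ((ψ.comp φ) s)) :
    Spec.map (CommRingCat.ofHom ψ) ≫ projPoint 𝒜 φ hm h0 hs =
      projPoint 𝒜 (ψ.comp φ) hm h0 hs' := by
  rw [projPoint, projPoint, awayEval_comp ψ φ hs hs', CommRingCat.ofHom_comp, Spec.map_comp,
    Category.assoc]

lemma projPoint_preimage {R : Type u} [CommRing R] (φ : A →+* R) {s : A} {m : ℕ} (hm : s ∈ 𝒜 m)
    (h0 : 0 < m) (hs : IsUnit (φ s)) :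
    (projPoint 𝒜 φ hm h0 hs) ⁻¹ᵁ (Proj.basicOpen 𝒜 s) = ⊤ := by
  rw [projPoint, Scheme.Hom.comp_preimage, ← Proj.opensRange_awayι 𝒜 s hm h0]
  simp

/-- By its second description the point lies in `D₊(t)`. Inside the chart of `s` this open set is
the locus where `t ^ m / s ^ n` is invertible. -/
lemma isUnit_of_projPoint_eq {R : Type u} [CommRing R] (φ ψ : A →+* R) {s t : A} {m n : ℕ}
    (hm : s ∈ 𝒜 m) (h0 : 0 < m) (hn : t ∈ 𝒜 n) (h0' : 0 < n) (hs : IsUnit (φ s))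
    (ht : IsUnit (ψ t)) (h : projPoint 𝒜 φ hm h0 hs = projPoint 𝒜 ψ hn h0' ht) :
    IsUnit (φ t) := by
  have key : (projPoint 𝒜 φ hm h0 hs) ⁻¹ᵁ (Proj.basicOpen 𝒜 t) = ⊤ := by
    rw [h, projPoint_preimage]
  rw [projPoint, Scheme.Hom.comp_preimage, Proj.awayι_preimage_basicOpen 𝒜 hm h0 hn h0'] at key
  have h1 : IsUnit (awayEval 𝒜 φ s hs (Away.isLocalizationElem hm hn)) := by
    rw [← Ideal.span_singleton_eq_top, ← PrimeSpectrum.iSup_basicOpen_eq_top_iff']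
    simp only [Set.mem_singleton_iff, iSup_iSup_eq_left]
    exact key
  have h2 : awayEval 𝒜 φ s hs (Away.isLocalizationElem hm hn) * φ s ^ n = φ t ^ m := by
    rw [Away.isLocalizationElem, ← map_pow φ t]
    exact awayEval_mk φ hs hm _ _ _
  have h3 : IsUnit (φ t ^ m) := h2 ▸ h1.mul (hs.pow n)
  exact (isUnit_pow_iff h0.ne').1 h3

lemma awayEval_eq_of_projPoint_eq {R : Type u} [CommRing R] (φ ψ : A →+* R) {t : A} {n : ℕ}
    (hn : t ∈ 𝒜 n) (h0' : 0 < n) (hs : IsUnit (φ t))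
    (ht : IsUnit (ψ t)) (h : projPoint 𝒜 φ hn h0' hs = projPoint 𝒜 ψ hn h0' ht) :
    awayEval 𝒜 φ t hs = awayEval 𝒜 ψ t ht := by
  rw [projPoint, projPoint, cancel_mono] at h
  have := Spec.map_injective h
  exact congrArg CommRingCat.Hom.hom this

lemma exists_projPoint {R : Type u} [CommRing R] (x : Spec (.of R) ⟶ Proj 𝒜) {t : A} {n : ℕ}
    (hn : t ∈ 𝒜 n) (h0 : 0 < n) (h : x ⁻¹ᵁ (Proj.basicOpen 𝒜 t) = ⊤) :
    ∃ h : Away 𝒜 t →+* R, x = Spec.map (CommRingCat.ofHom h) ≫ Proj.awayι 𝒜 t hn h0 := by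
  have hr : Set.range x ⊆ Set.range (Proj.awayι 𝒜 t hn h0) := by
    rw [← Scheme.Hom.coe_opensRange (Proj.awayι 𝒜 t hn h0), Proj.opensRange_awayι]
    rintro _ ⟨y, rfl⟩
    have : y ∈ x ⁻¹ᵁ (Proj.basicOpen 𝒜 t) := h ▸ trivial
    exact this
  refine ⟨(Spec.preimage (IsOpenImmersion.lift (Proj.awayι 𝒜 t hn h0) x hr)).hom, ?_⟩
  rw [CommRingCat.ofHom_hom, Spec.map_preimage, IsOpenImmersion.lift_fac]

end ProjPoint

/-! ### Homogeneous coordinates on projective space -/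

section ProjectiveSpace

open MvPolynomial HomogeneousLocalization

attribute [local instance] MvPolynomial.gradedAlgebra

variable {F : Type u} [Field F] {N : ℕ}

lemma X_mem_homogeneousSubmodule (i : Fin (N + 1)) :
    X i ∈ homogeneousSubmodule (Fin (N + 1)) F 1 :=
  isHomogeneous_X F i

lemma X_mem_homogeneousSubmodule' (i : Fin (N + 1)) :
    X i ∈ homogeneousSubmodule (Fin (N + 1)) F (1 • 1) :=
  isHomogeneous_X F i

lemma C_mem_homogeneousSubmodule (a : F) :
    C a ∈ homogeneousSubmodule (Fin (N + 1)) F (0 • 1) := by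
  rw [zero_smul]
  exact isHomogeneous_C _ a

lemma fromZeroRingHom_algebraMap (i : Fin (N + 1)) (a : F) :
    fromZeroRingHom (homogeneousSubmodule (Fin (N + 1)) F) (Submonoid.powers (X i))
      (algebraMap F _ a) = Away.mk (homogeneousSubmodule (Fin (N + 1)) F)
        (X_mem_homogeneousSubmodule i) 0 (C a) (C_mem_homogeneousSubmodule a) := by
  rw [HomogeneousLocalization.ext_iff_val, Away.val_mk]
  simp [fromZeroRingHom]
  rfl

variable (F) in
/-- Evaluation of polynomials at the coordinate vector `w`. -/
abbrev evalHom {R : Type u} [CommRing R] [Algebra F R] (w : Fin (N + 1) → R) :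
    MvPolynomial (Fin (N + 1)) F →+* R :=
  (aeval (R := F) w : MvPolynomial (Fin (N + 1)) F →ₐ[F] R)

lemma isUnit_evalHom_X {R : Type u} [CommRing R] [Algebra F R] {w : Fin (N + 1) → R}
    {i : Fin (N + 1)} (h : IsUnit (w i)) : IsUnit (evalHom F w (X i)) := by
  simpa using h

/-- The `R`-point of projective space with homogeneous coordinates `w`, one of which is a unit. -/
def coordPoint {R : Type u} [CommRing R] [Algebra F R] (w : Fin (N + 1) → R) (i : Fin (N + 1))
    (h : IsUnit (w i)) : Points (projectiveSpace F N) R :=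
  Over.homMk (projPoint (homogeneousSubmodule (Fin (N + 1)) F) (evalHom F w)
    (X_mem_homogeneousSubmodule i) one_pos (isUnit_evalHom_X h)) (by
    change projPoint (homogeneousSubmodule (Fin (N + 1)) F) (evalHom F w)
      (X_mem_homogeneousSubmodule i) one_pos (isUnit_evalHom_X h) ≫
        Proj.toSpecZero (homogeneousSubmodule (Fin (N + 1)) F) ≫ Spec.map _ = Spec.map _
    unfold projPoint
    rw [Category.assoc, Proj.awayι_toSpecZero_assoc, ← Spec.map_comp, ← Spec.map_comp]
    congr 1
    ext x
    have := awayEval_mk (𝒜 := homogeneousSubmodule (Fin (N + 1)) F) (evalHom F w)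
      (isUnit_evalHom_X h) (X_mem_homogeneousSubmodule i) 0 (C x) (C_mem_homogeneousSubmodule x)
    simp only [pow_zero, mul_one] at this
    change awayEval (homogeneousSubmodule (Fin (N + 1)) F) (evalHom F w) (X i) (isUnit_evalHom_X h)
      (fromZeroRingHom (homogeneousSubmodule (Fin (N + 1)) F) (Submonoid.powers (X i))
        (algebraMap F _ x)) = algebraMap F R x
    rw [fromZeroRingHom_algebraMap, this]
    simp)

lemma coordPoint_left {R : Type u} [CommRing R] [Algebra F R] (w : Fin (N + 1) → R)
    (i : Fin (N + 1)) (h : IsUnit (w i)) :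
    (coordPoint (F := F) w i h).left = projPoint (homogeneousSubmodule (Fin (N + 1)) F) (evalHom F w)
    (X_mem_homogeneousSubmodule i) one_pos (isUnit_evalHom_X h) := rfl

lemma coordPoint_index {R : Type u} [CommRing R] [Algebra F R] (w : Fin (N + 1) → R)
    (i j : Fin (N + 1)) (hi : IsUnit (w i)) (hj : IsUnit (w j)) :
    coordPoint (F := F) w i hi = coordPoint w j hj := by
  ext1
  exact projPoint_eq _ _ _ _ _ _ _

lemma specOverMap_coordPoint {R S : Type u} [CommRing R] [Algebra F R] [CommRing S] [Algebra F S]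
    (f : R →ₐ[F] S) (w : Fin (N + 1) → R) (i : Fin (N + 1)) (h : IsUnit (w i))
    (h' : IsUnit ((f ∘ w) i)) :
    specOverMap f ≫ coordPoint (F := F) w i h = coordPoint (f ∘ w) i h' := by
  ext1
  have e : evalHom F (f ∘ w) = (f : R →+* S).comp (evalHom F w) := by
    refine ringHom_ext (fun a => ?_) (fun j => ?_) <;> simp
  rw [Over.comp_left, coordPoint_left, coordPoint_left]
  simp only [e]
  exact SpecMap_projPoint _ _ _ _ _ _

lemma aeval_smul_of_mem {R : Type u} [CommRing R] [Algebra F R] (w : Fin (N + 1) → R) (a : R)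
    {n : ℕ} {P : MvPolynomial (Fin (N + 1)) F} (hP : P.IsHomogeneous n) :
    aeval (a • w) P = a ^ n * aeval w P := by
  rw [aeval_def, aeval_def, eval₂_eq', eval₂_eq', Finset.mul_sum]
  refine Finset.sum_congr rfl fun d hd => ?_
  have h1 : ∑ i, d i = n := by
    have := hP (mem_support_iff.1 hd)
    rw [← this, Finsupp.weight_apply, Finsupp.sum_fintype] <;> simp
  simp only [Pi.smul_apply, smul_eq_mul, mul_pow, Finset.prod_mul_distrib, Finset.prod_pow_eq_pow_sum, h1]
  ring

/-- Numerator and denominator of a fraction of degree zero are multiplied by the same power of `u`.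
-/
lemma awayEval_aeval_smul {R : Type u} [CommRing R] [Algebra F R] (w : Fin (N + 1) → R)
    (i : Fin (N + 1)) (u : Rˣ) (h : IsUnit ((evalHom F w) (X i)))
    (h' : IsUnit ((evalHom F ((u : R) • w)) (X i))) :
    awayEval (homogeneousSubmodule (Fin (N + 1)) F) (evalHom F ((u : R) • w)) _ h' =
      awayEval (homogeneousSubmodule (Fin (N + 1)) F) (evalHom F w) _ h := by
  ext x
  obtain ⟨n, a, ha, rfl⟩ := Away.mk_surjective (homogeneousSubmodule (Fin (N + 1)) F) (X_mem_homogeneousSubmodule i) x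
  have h1 := awayEval_mk _ h (X_mem_homogeneousSubmodule i) n a ha
  have h2 := awayEval_mk _ h' (X_mem_homogeneousSubmodule i) n a ha
  apply (h'.pow n).mul_right_cancel
  rw [h2]
  simp only [RingHom.coe_coe, aeval_X] at h1 ⊢
  rw [aeval_smul_of_mem w _ (by simpa using ha), ← h1, Pi.smul_apply, smul_eq_mul, mul_pow]
  ring

lemma coordPoint_smul {R : Type u} [CommRing R] [Algebra F R] (w : Fin (N + 1) → R)
    (i : Fin (N + 1)) (u : Rˣ) (h : IsUnit (w i)) (h' : IsUnit (((u : R) • w) i)) :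
    coordPoint (F := F) ((u : R) • w) i h' = coordPoint w i h := by
  ext1
  rw [coordPoint_left, coordPoint_left]
  unfold projPoint
  rw [awayEval_aeval_smul w i u (isUnit_evalHom_X h)]

lemma exists_smul_of_coordPoint_eq {R : Type u} [CommRing R] [Algebra F R] {w w' : Fin (N + 1) → R}
    {i j : Fin (N + 1)} {hi : IsUnit (w i)} {hj : IsUnit (w' j)}
    (h : coordPoint (F := F) w i hi = coordPoint w' j hj) :
    ∃ u : Rˣ, w' = (u : R) • w := by
  have hij : IsUnit (w j) := by
    have := isUnit_of_projPoint_eq _ _ _ _ _ _ _ _ (congrArg Over.Hom.left h)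
    simpa using this
  rw [coordPoint_index w i j hi hij] at h
  have := awayEval_eq_of_projPoint_eq _ _ _ _ _ _ (congrArg Over.Hom.left h)
  -- In the chart of `j` the point determines the ratios `w k / w j = w' k / w' j`, so the factor
  -- must be `w' j / w j`.
  refine ⟨hj.unit * hij.unit⁻¹, ?_⟩
  ext k
  have h1 := awayEval_mk (𝒜 := homogeneousSubmodule (Fin (N + 1)) F) (evalHom F w)
    (isUnit_evalHom_X hij) (X_mem_homogeneousSubmodule j) 1 (X k)
      (X_mem_homogeneousSubmodule' k)
  have h2 := awayEval_mk (𝒜 := homogeneousSubmodule (Fin (N + 1)) F) (evalHom F w')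
    (isUnit_evalHom_X hj) (X_mem_homogeneousSubmodule j) 1 (X k)
      (X_mem_homogeneousSubmodule' k)
  rw [← this] at h2
  simp only [RingHom.coe_coe, aeval_X, pow_one] at h1 h2
  rw [Pi.smul_apply, smul_eq_mul, ← h2, ← h1, Units.val_mul, IsUnit.unit_spec]
  have hu : ((hij.unit⁻¹ : Rˣ) : R) * w j = 1 := hij.val_inv_mul
  linear_combination (-(w' j * awayEval (homogeneousSubmodule (Fin (N + 1)) F) (evalHom F w) (X j)
    (isUnit_evalHom_X hij) (Away.mk (homogeneousSubmodule (Fin (N + 1)) F)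
      (X_mem_homogeneousSubmodule j) 1 (X k) (X_mem_homogeneousSubmodule' k)))) * hu

lemma irrelevant_le_span_X :
    (HomogeneousIdeal.irrelevant (homogeneousSubmodule (Fin (N + 1)) F)).toIdeal ≤
      Ideal.span (Set.range (X : _ → MvPolynomial (Fin (N + 1)) F)) := by
  rw [HomogeneousIdeal.toIdeal_irrelevant_le]
  intro n hn p hp
  change p ∈ Ideal.span (Set.range (X : _ → MvPolynomial (Fin (N + 1)) F))
  rw [← Set.image_univ, mem_ideal_span_X_image]
  intro m hm
  by_contra hc
  push Not at hc
  have : m = 0 := by ext i; simpa using hc i (Set.mem_univ i)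
  subst this
  have h1 : Finsupp.weight 1 0 = n := hp (mem_support_iff.1 hm)
  simp at h1
  omega

lemma iSup_basicOpen_X : ⨆ i, Proj.basicOpen (homogeneousSubmodule (Fin (N + 1)) F) (X i) = ⊤ :=
  Proj.iSup_basicOpen_eq_top _ _ irrelevant_le_span_X

lemma coordPoint_preimage {R : Type u} [CommRing R] [Algebra F R] (w : Fin (N + 1) → R)
    (i : Fin (N + 1)) (h : IsUnit (w i)) : (coordPoint (F := F) w i h).left ⁻¹ᵁ
      (Proj.basicOpen (homogeneousSubmodule (Fin (N + 1)) F) (X i)) = ⊤ :=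
  projPoint_preimage _ _ _ _

lemma exists_coordPoint {R : Type u} [CommRing R] [Algebra F R]
    (x : Points (projectiveSpace F N) R) (i : Fin (N + 1))
    (h : x.left ⁻¹ᵁ (Proj.basicOpen (homogeneousSubmodule (Fin (N + 1)) F) (X i)) = ⊤) :
    ∃ (w : Fin (N + 1) → R) (hw : w i = 1), x = coordPoint w i (hw ▸ isUnit_one) := by
  obtain ⟨g, hg⟩ := exists_projPoint x.left (t := X i) (X_mem_homogeneousSubmodule i) one_pos h
  have hF (a : F) : g (fromZeroRingHom _ _ (algebraMap F _ a)) = algebraMap F R a := by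
    have h1 := Over.w x
    rw [hg] at h1
    change (_ ≫ Proj.awayι (homogeneousSubmodule (Fin (N + 1)) F) (X i)
      (X_mem_homogeneousSubmodule i) one_pos) ≫
        Proj.toSpecZero (homogeneousSubmodule (Fin (N + 1)) F) ≫ Spec.map _ = Spec.map _ at h1
    rw [Category.assoc, Proj.awayι_toSpecZero_assoc, ← Spec.map_comp, ← Spec.map_comp] at h1
    have h2 := congrArg CommRingCat.Hom.hom (Spec.map_injective h1)
    exact DFunLike.congr_fun h2 a
  let w : Fin (N + 1) → R := fun j => g (Away.mk (homogeneousSubmodule (Fin (N + 1)) F)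
    (X_mem_homogeneousSubmodule i) 1 (X j) (X_mem_homogeneousSubmodule' j))
  have hw : w i = 1 := by
    have : Away.mk (homogeneousSubmodule (Fin (N + 1)) F)
      (X_mem_homogeneousSubmodule i) 1 (X i) (X_mem_homogeneousSubmodule' i) = 1 := by
      rw [HomogeneousLocalization.ext_iff_val, Away.val_mk, val_one, ← Localization.mk_one, Localization.mk_eq_mk_iff,
        Localization.r_iff_exists]
      exact ⟨1, by simp⟩
    simp only [w, this, map_one]
  refine ⟨w, hw, ?_⟩
  ext1
  rw [hg]
  rw [coordPoint_left]
  unfold projPoint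
  congr 3
  have hunit : IsUnit ((evalHom F w) (X i)) := isUnit_evalHom_X (hw ▸ isUnit_one)
  let q : MvPolynomial (Fin (N + 1)) F →+* Localization.Away (X i : MvPolynomial (Fin (N + 1)) F) :=
    algebraMap _ _
  -- Dehomogenization, sending `X j` to `X j / X i`. By `hθ` a fraction `a / X i ^ n` equals `θ a`,
  -- so a homomorphism out of the chart is determined by its values on scalars and on the `X j / X
  -- i`.
  let θ : MvPolynomial (Fin (N + 1)) F →+* Away (homogeneousSubmodule (Fin (N + 1)) F) (X i) :=
    eval₂Hom ((fromZeroRingHom _ _).comp (algebraMap F _)) (fun j => Away.mk (homogeneousSubmodule (Fin (N + 1)) F)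
    (X_mem_homogeneousSubmodule i) 1 (X j) (X_mem_homogeneousSubmodule' j))
  have hθ (n : ℕ) (a : MvPolynomial (Fin (N + 1)) F) (ha : a ∈ homogeneousSubmodule (Fin (N + 1)) F (n • 1)) :
      Away.mk (homogeneousSubmodule (Fin (N + 1)) F) (X_mem_homogeneousSubmodule i) n a ha = θ a := by
    have e1 : (algebraMap _ (Localization.Away (X i : MvPolynomial (Fin (N + 1)) F))).comp θ =
        (RingHomClass.toRingHom (aeval (R := F) ((IsLocalization.Away.invSelf (X i : MvPolynomial (Fin (N + 1)) F) :
          Localization.Away (X i : MvPolynomial (Fin (N + 1)) F)) • (q ∘ X)) : MvPolynomial (Fin (N + 1)) F →ₐ[F] _)) := by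
      refine ringHom_ext (fun a => ?_) (fun j => ?_)
      · simp only [θ, RingHom.comp_apply, coe_eval₂Hom, eval₂_C]
        rw [HomogeneousLocalization.algebraMap_apply]
        simp [fromZeroRingHom]
        rfl
      · simp only [θ, RingHom.comp_apply, coe_eval₂Hom, eval₂_X,
          HomogeneousLocalization.algebraMap_apply, Away.val_mk, q]
        rw [Localization.mk_eq_mk', IsLocalization.Away.invSelf, IsLocalization.mk'_eq_mul_mk'_one, mul_comm]
        simp
    have e2 := DFunLike.congr_fun e1 a
    rw [HomogeneousLocalization.ext_iff_val, ← HomogeneousLocalization.algebraMap_apply (y := θ a)]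
    rw [RingHom.comp_apply] at e2
    rw [e2, RingHom.coe_coe]
    rw [aeval_smul_of_mem _ _ (by simpa using ha), Away.val_mk]
    have e3 : aeval (R := F) (q ∘ X) a = q a := by
      have : aeval (R := F) (q ∘ X) = (IsScalarTower.toAlgHom F (MvPolynomial (Fin (N + 1)) F) (Localization.Away (X i : MvPolynomial (Fin (N + 1)) F))) := by
        ext; simp [q]
      rw [this]; rfl
    rw [e3, Localization.mk_eq_mk', IsLocalization.mk'_eq_mul_mk'_one, mul_comm]
    congr 1
    rw [IsLocalization.Away.invSelf, ← IsLocalization.mk'_pow]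
    simp
  ext y
  obtain ⟨n, a, ha, rfl⟩ := Away.mk_surjective (homogeneousSubmodule (Fin (N + 1)) F) (X_mem_homogeneousSubmodule i) y
  have h1 := awayEval_mk _ hunit (X_mem_homogeneousSubmodule i) n a ha
  have h2 : (evalHom F w) (X i) = 1 := by simp [hw]
  rw [h2, one_pow, mul_one] at h1
  refine Eq.trans ?_ h1.symm
  rw [hθ]
  have : g.comp θ = (evalHom F w) := by
    refine ringHom_ext (fun a => ?_) (fun j => ?_)
    · simp [θ, ← hF]
    · simp [θ, w]
  exact DFunLike.congr_fun this a

end ProjectiveSpace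

/-! ### Closed subschemes of projective space cut out by homogeneous equations -/

section ClosedSubscheme

open MvPolynomial HomogeneousLocalization

attribute [local instance] MvPolynomial.gradedAlgebra

variable {F : Type u} [Field F] {N : ℕ}

/-- The grading on a quotient of a polynomial ring by a homogeneous ideal. -/
def quotGrading (J : Ideal (MvPolynomial (Fin (N + 1)) F)) (i : ℕ) :
    Submodule F (MvPolynomial (Fin (N + 1)) F ⧸ J) :=
  (homogeneousSubmodule (Fin (N + 1)) F i).map (Ideal.Quotient.mkₐ F J).toLinearMap

lemma mk_mem_quotGrading (J : Ideal (MvPolynomial (Fin (N + 1)) F)) {i : ℕ}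
    {p : MvPolynomial (Fin (N + 1)) F} (hp : p ∈ homogeneousSubmodule (Fin (N + 1)) F i) :
    Ideal.Quotient.mk J p ∈ quotGrading J i :=
  ⟨p, hp, rfl⟩

instance (J : Ideal (MvPolynomial (Fin (N + 1)) F)) : SetLike.GradedMonoid (quotGrading J) where
  one_mem := ⟨1, SetLike.GradedOne.one_mem, by simp⟩
  mul_mem := by
    rintro i j _ _ ⟨p, hp, rfl⟩ ⟨q, hq, rfl⟩
    exact ⟨p * q, SetLike.GradedMul.mul_mem hp hq, by simp⟩

/-- The quotient map in a fixed degree. -/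
def quotGradingMk (J : Ideal (MvPolynomial (Fin (N + 1)) F)) (i : ℕ) :
    homogeneousSubmodule (Fin (N + 1)) F i →ₗ[F] quotGrading J i :=
  (Ideal.Quotient.mkₐ F J).toLinearMap.restrict fun _ hp => ⟨_, hp, rfl⟩

/-- The homomorphism splitting a polynomial into the classes of its homogeneous components. -/
def quotDecompose (J : Ideal (MvPolynomial (Fin (N + 1)) F)) :
    MvPolynomial (Fin (N + 1)) F →ₐ[F] DirectSum ℕ fun i => quotGrading J i :=
  (DirectSum.toAlgebra F (fun i => homogeneousSubmodule (Fin (N + 1)) F i)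
    (fun i => (DirectSum.lof F ℕ (fun i => quotGrading J i) i) ∘ₗ quotGradingMk J i)
    (by
      rw [DirectSum.one_def]
      rfl)
    (by
      intro i j a b
      simp only [LinearMap.comp_apply, DirectSum.lof_eq_of]
      rw [DirectSum.of_mul_of]
      rfl)).comp
    (DirectSum.decomposeAlgEquiv (homogeneousSubmodule (Fin (N + 1)) F)).toAlgHom

lemma quotDecompose_of_mem (J : Ideal (MvPolynomial (Fin (N + 1)) F)) {i : ℕ}
    {p : MvPolynomial (Fin (N + 1)) F} (hp : p ∈ homogeneousSubmodule (Fin (N + 1)) F i) :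
    quotDecompose J p = DirectSum.of (fun i => quotGrading J i) i ⟨_, mk_mem_quotGrading J hp⟩ := by
  unfold quotDecompose
  rw [AlgHom.comp_apply]
  have h : (DirectSum.decomposeAlgEquiv (homogeneousSubmodule (Fin (N + 1)) F)).toAlgHom p =
    DirectSum.of (fun i => homogeneousSubmodule (Fin (N + 1)) F i) i ⟨p, hp⟩ :=
      DirectSum.decompose_of_mem _ hp
  rw [h]
  exact DirectSum.toAddMonoid_of _ _ _

/-- Each generator is homogeneous, so it has a single component, and that component is zero in the
quotient. This lets the decomposition descend to the quotient ring. -/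
lemma quotDecompose_eq_zero {S : Set (MvPolynomial (Fin (N + 1)) F)}
    (hS : ∀ p ∈ S, ∃ n, p ∈ homogeneousSubmodule (Fin (N + 1)) F n) :
    ∀ p ∈ Ideal.span S, quotDecompose (Ideal.span S) p = 0 := by
  intro p hp
  have : Ideal.span S ≤ RingHom.ker (quotDecompose (Ideal.span S)) := by
    rw [Ideal.span_le]
    intro q hq
    obtain ⟨n, hn⟩ := hS q hq
    rw [SetLike.mem_coe, RingHom.mem_ker, quotDecompose_of_mem _ hn]
    have : Ideal.Quotient.mk (Ideal.span S) q = 0 :=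
      Ideal.Quotient.eq_zero_iff_mem.2 (Ideal.subset_span hq)
    rw [show (⟨_, mk_mem_quotGrading (Ideal.span S) hn⟩ : quotGrading (Ideal.span S) n) = 0 from
      Subtype.ext this, map_zero]
  exact this hp

/-- The quotient of the polynomial ring by homogeneous elements is graded. -/
abbrev quotGradedAlgebra {S : Set (MvPolynomial (Fin (N + 1)) F)}
    (hS : ∀ p ∈ S, ∃ n, p ∈ homogeneousSubmodule (Fin (N + 1)) F n) :
    GradedAlgebra (quotGrading (Ideal.span S)) :=
  GradedAlgebra.ofAlgHom _
    (Ideal.Quotient.liftₐ (Ideal.span S) (quotDecompose (Ideal.span S)) (quotDecompose_eq_zero hS))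
    (by
      refine Ideal.Quotient.algHom_ext _ ?_
      ext j
      change DirectSum.coeAlgHom _ (quotDecompose (Ideal.span S) (X j)) = _
      rw [quotDecompose_of_mem (Ideal.span S) (X_mem_homogeneousSubmodule (F := F) j),
        DirectSum.coeAlgHom_of]
      rfl)
    (by
      rintro i ⟨_, p, hp, rfl⟩
      exact quotDecompose_of_mem (Ideal.span S) hp)

/-- Take `Proj` of the quotient by the ideal of the equations. The map to projective space is a
closed immersion because it is `Spec` of a surjection on every standard chart, and a point with
coordinates `w` lifts exactly when evaluation at `w` kills the ideal. -/
lemma exists_closedSubscheme (S : Set (MvPolynomial (Fin (N + 1)) F))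
    (hS : ∀ p ∈ S, ∃ n, p ∈ homogeneousSubmodule (Fin (N + 1)) F n) :
    ∃ (Z : Over (Spec (.of F))) (ι : Z ⟶ projectiveSpace F N), IsClosedImmersion ι.left ∧
      ∀ (R : Type u) [CommRing R] [Algebra F R] (w : Fin (N + 1) → R) (i : Fin (N + 1))
        (h : IsUnit (w i)),
        (∃ z : Points Z R, z ≫ ι = coordPoint w i h) ↔ ∀ p ∈ S, aeval w p = 0 := by
  let _ := quotGradedAlgebra hS
  let J := Ideal.span S
  let f : homogeneousSubmodule (Fin (N + 1)) F →+*ᵍ quotGrading J :=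
    { Ideal.Quotient.mk J with
      map_mem := fun hp => mk_mem_quotGrading J hp }
  have hfX (i : Fin (N + 1)) : f (X i) ∈ quotGrading J 1 :=
    mk_mem_quotGrading J (X_mem_homogeneousSubmodule i)
  -- The quotient map is onto in each degree; this makes `Proj.map` defined on all of `Proj`.
  have hf : HomogeneousIdeal.irrelevant (quotGrading J) ≤
      (HomogeneousIdeal.irrelevant (homogeneousSubmodule (Fin (N + 1)) F)).map f := by
    rw [HomogeneousIdeal.irrelevant_le]
    rintro i hi _ ⟨p, hp, rfl⟩
    refine Ideal.mem_map_of_mem _ ?_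
    exact HomogeneousIdeal.mem_irrelevant_of_mem _ hi hp
  let m := Proj.map f hf
  have hcover : ⨆ i, Proj.basicOpen (homogeneousSubmodule (Fin (N + 1)) F) (X i) = ⊤ :=
    iSup_basicOpen_X
  have hpre (i : Fin (N + 1)) :
      m ⁻¹ᵁ (Proj.basicOpen (homogeneousSubmodule (Fin (N + 1)) F) (X i)) =
        Proj.basicOpen (quotGrading J) (f (X i)) := rfl
  have hmap (i : Fin (N + 1)) : Proj.awayι (quotGrading J) (f (X i)) (hfX i) one_pos ≫ m =
      Spec.map (CommRingCat.ofHom (Away.map f (X i))) ≫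
        Proj.awayι (homogeneousSubmodule (Fin (N + 1)) F) (X i) (X_mem_homogeneousSubmodule i)
          one_pos := Proj.awayι_comp_map f hf one_pos _ _
  have hp (i : Fin (N + 1)) : IsPullback (Proj.awayι (quotGrading J) (f (X i)) (hfX i) one_pos)
      (Spec.map (CommRingCat.ofHom (Away.map f (X i)))) m
      (Proj.awayι (homogeneousSubmodule (Fin (N + 1)) F) (X i) (X_mem_homogeneousSubmodule i)
        one_pos) := by
    refine (IsOpenImmersion.isPullback _ _ _ _ (hmap i) ?_).flip
    rw [Proj.opensRange_awayι, Proj.opensRange_awayι]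
    exact hpre i
  have hs (i : Fin (N + 1)) :
      IsClosedImmersion (Spec.map (CommRingCat.ofHom (Away.map f (X i)))) := by
    refine IsClosedImmersion.spec_of_surjective _ fun y => ?_
    obtain ⟨n, a, ha, rfl⟩ := Away.mk_surjective (quotGrading J) (hfX i) y
    obtain ⟨p, hp, rfl⟩ := ha
    refine ⟨Away.mk (homogeneousSubmodule (Fin (N + 1)) F) (X_mem_homogeneousSubmodule i) n p hp, ?_⟩
    exact Away.map_mk f (X i) (X_mem_homogeneousSubmodule i) n p hp
  have hclosed : IsClosedImmersion m := by
    refine IsZariskiLocalAtTarget.of_openCover (P := @IsClosedImmersion)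
      (Proj.affineOpenCoverOfIrrelevantLESpan (homogeneousSubmodule (Fin (N + 1)) F)
      (fun i : Fin (N + 1) => X i) X_mem_homogeneousSubmodule (fun _ => one_pos)
      irrelevant_le_span_X).openCover fun (i : Fin (N + 1)) => ?_
    have := (hp i).isoPullback_inv_snd
    have := hs i
    change IsClosedImmersion (pullback.snd m (Proj.awayι _ (X i)
      (X_mem_homogeneousSubmodule i) one_pos))
    rw [← (hp i).isoPullback_inv_snd]
    infer_instance
  let Z : Over (Spec (.of F)) := Over.mk (m ≫ (projectiveSpace F N).hom)
  let ι : Z ⟶ projectiveSpace F N := Over.homMk m rfl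
  refine ⟨Z, ι, hclosed, fun R _ _ w i h => ⟨?_, ?_⟩⟩
  · rintro ⟨z, hz⟩ p hp
    have hz' : z.left ≫ m = (coordPoint w i h).left := congrArg Over.Hom.left hz
    have h1 : z.left ⁻¹ᵁ (Proj.basicOpen (quotGrading J) (f (X i))) = ⊤ :=
      (congrArg (· ⁻¹ᵁ (Proj.basicOpen (homogeneousSubmodule (Fin (N + 1)) F) (X i))) hz').trans
        (coordPoint_preimage w i h)
    obtain ⟨g, hg⟩ := exists_projPoint z.left (hfX i) one_pos h1
    replace hz' : (Spec.map (CommRingCat.ofHom g) ≫ Proj.awayι (quotGrading J) (f (X i)) (hfX i)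
      one_pos) ≫ m = projPoint (homogeneousSubmodule (Fin (N + 1)) F) (evalHom F w)
        (X_mem_homogeneousSubmodule i) one_pos (isUnit_evalHom_X h) :=
      (congrArg (· ≫ m) hg.symm).trans hz'
    rw [Category.assoc, hmap, ← Category.assoc, ← Spec.map_comp, projPoint, cancel_mono] at hz'
    have h2 := congrArg CommRingCat.Hom.hom (Spec.map_injective hz')
    obtain ⟨n, hn⟩ := hS p hp
    have hn' : p ∈ homogeneousSubmodule (Fin (N + 1)) F (n • 1) := by simpa using hn
    have h3 := awayEval_mk (evalHom F w) (isUnit_evalHom_X h) (X_mem_homogeneousSubmodule i) n p hn'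
    have h4 : f p = 0 := Ideal.Quotient.eq_zero_iff_mem.2 (Ideal.subset_span hp)
    -- The value of `p` at `w` is the value of `p / X i ^ n` times `w i ^ n`, and this fraction
    -- already vanishes on the closed subscheme.
    have h5 : Away.map f (X i) (Away.mk (homogeneousSubmodule (Fin (N + 1)) F) (X_mem_homogeneousSubmodule i) n p hn') = 0 := by
      rw [Away.map_mk, HomogeneousLocalization.ext_iff_val, Away.val_mk, h4, Localization.mk_zero,
        val_zero]
    have h6 := DFunLike.congr_fun h2 (Away.mk (homogeneousSubmodule (Fin (N + 1)) F) (X_mem_homogeneousSubmodule i) n p hn')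
    have h7 : g (Away.map f (X i) (Away.mk (homogeneousSubmodule (Fin (N + 1)) F) (X_mem_homogeneousSubmodule i) n p hn')) =
      awayEval (homogeneousSubmodule (Fin (N + 1)) F) (evalHom F w) (X i) (isUnit_evalHom_X h)
        (Away.mk (homogeneousSubmodule (Fin (N + 1)) F) (X_mem_homogeneousSubmodule i) n p hn') := h6
    rw [← h7, h5, map_zero, zero_mul] at h3
    exact h3.symm
  · intro hw
    have hker : ∀ a ∈ J, evalHom F w a = 0 := by
      intro a ha
      have : J ≤ RingHom.ker (evalHom F w) := Ideal.span_le.2 fun p hp => hw p hp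
      exact this ha
    let ψ : MvPolynomial (Fin (N + 1)) F ⧸ J →+* R := Ideal.Quotient.lift J (evalHom F w) hker
    have hψ (a) : ψ (f a) = evalHom F w a := Ideal.Quotient.lift_mk _ _ _
    have hu : IsUnit (ψ (f (X i))) := by rw [hψ]; exact isUnit_evalHom_X h
    have key : projPoint (quotGrading J) ψ (hfX i) one_pos hu ≫ m =
        projPoint (homogeneousSubmodule (Fin (N + 1)) F) (evalHom F w)
        (X_mem_homogeneousSubmodule i) one_pos (isUnit_evalHom_X h) := by
      rw [projPoint, Category.assoc, hmap, ← Category.assoc, ← Spec.map_comp,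
        projPoint, ← awayEval_map f (evalHom F w) ψ hψ (isUnit_evalHom_X h) hu
          (X_mem_homogeneousSubmodule i)]
      rfl
    refine ⟨Over.homMk (projPoint (quotGrading J) ψ (hfX i) one_pos hu) ?_, ?_⟩
    · change _ ≫ m ≫ (projectiveSpace F N).hom = _
      exact (Category.assoc _ _ _).symm.trans
        ((congrArg (· ≫ (projectiveSpace F N).hom) key).trans (Over.w (coordPoint w i h)))
    · ext1
      exact key

end ClosedSubscheme

/-! ### Row spans of matrices, minors and Plücker equations -/

section RowSpan

open Matrix

set_option linter.unusedSectionVars false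

variable {κ ρ : Type} [Fintype κ] [DecidableEq κ] [Fintype ρ] [DecidableEq ρ]
variable {R S : Type u} [CommRing R] [CommRing S]

/-- The span of the rows of a matrix. -/
def rowSpan (M : Matrix ρ κ R) : Submodule R (κ → R) :=
  LinearMap.range M.vecMulLinear

/-- The maximal minors of a matrix. -/
def minors (M : Matrix ρ κ R) (s : ρ → κ) : R := (M.submatrix id s).det

/-- The extension of scalars of a submodule of `κ → R`. -/
def mapSpan (f : R →+* S) (I : Submodule R (κ → R)) : Submodule S (κ → S) :=
  Submodule.span S ((fun v => f ∘ v) '' (I : Set (κ → R)))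

lemma mem_mapSpan (f : R →+* S) {I : Submodule R (κ → R)} {v : κ → R} (hv : v ∈ I) :
    f ∘ v ∈ mapSpan f I :=
  Submodule.subset_span ⟨v, hv, rfl⟩

lemma mapSpan_le {f : R →+* S} {I : Submodule R (κ → R)} {J : Submodule S (κ → S)} :
    mapSpan f I ≤ J ↔ ∀ v ∈ I, f ∘ v ∈ J := by
  rw [mapSpan, Submodule.span_le, Set.image_subset_iff]
  rfl

lemma mapSpan_mapSpan {T : Type u} [CommRing T] (f : R →+* S) (g : S →+* T)
    (I : Submodule R (κ → R)) : mapSpan g (mapSpan f I) = mapSpan (g.comp f) I := by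
  refine le_antisymm (mapSpan_le.2 fun v hv => ?_) (mapSpan_le.2 fun v hv => ?_)
  · induction hv using Submodule.span_induction with
    | mem x h =>
      obtain ⟨v, hv, rfl⟩ := h
      exact mem_mapSpan (g.comp f) hv
    | zero =>
      rw [show g ∘ (0 : κ → S) = 0 by ext; simp]
      exact zero_mem _
    | add x y _ _ hx hy =>
      rw [show g ∘ (x + y) = g ∘ x + g ∘ y by ext; simp]
      exact add_mem hx hy
    | smul a x _ hx =>
      rw [show g ∘ (a • x) = g a • (g ∘ x) by ext; simp]
      exact Submodule.smul_mem _ _ hx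
  · exact mem_mapSpan g (mem_mapSpan f hv)

lemma map_vecMul (f : R →+* S) (M : Matrix ρ κ R) (c : ρ → R) :
    f ∘ (c ᵥ* M) = (f ∘ c) ᵥ* M.map f := by
  ext j
  simp [Matrix.vecMul, dotProduct]

lemma row_mem_rowSpan (M : Matrix ρ κ R) (a : ρ) : M a ∈ rowSpan M :=
  ⟨Pi.single a 1, by simp [Matrix.row]⟩

lemma rowSpan_le {M : Matrix ρ κ R} {I : Submodule R (κ → R)} :
    rowSpan M ≤ I ↔ ∀ a, M a ∈ I := by
  refine ⟨fun h a => h (row_mem_rowSpan M a), ?_⟩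
  rintro h _ ⟨c, rfl⟩
  rw [Matrix.vecMulLinear_apply, Matrix.vecMul_eq_sum]
  exact Submodule.sum_mem _ fun a _ => Submodule.smul_mem _ _ (h a)

lemma mapSpan_rowSpan (f : R →+* S) (M : Matrix ρ κ R) :
    mapSpan f (rowSpan M) = rowSpan (M.map f) := by
  refine le_antisymm (mapSpan_le.2 ?_) (rowSpan_le.2 fun a => ?_)
  · rintro _ ⟨c, rfl⟩
    exact ⟨f ∘ c, (map_vecMul f M c).symm⟩
  · exact mem_mapSpan f (row_mem_rowSpan M a)

lemma rowSpan_le_rowSpan {ρ' : Type} [Fintype ρ'] [DecidableEq ρ'] {M : Matrix ρ κ R} {M' : Matrix ρ' κ R} :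
    rowSpan M' ≤ rowSpan M ↔ ∃ C : Matrix ρ' ρ R, M' = C * M := by
  rw [rowSpan_le]
  constructor
  · intro h
    choose C hC using h
    exact ⟨Matrix.of C, by ext a j; exact (congrFun (hC a) j).symm⟩
  · rintro ⟨C, rfl⟩ a
    exact ⟨C a, rfl⟩

/-- The identity block reads off the coefficients of a linear combination of the rows. -/
lemma mem_rowSpan_of_submatrix_eq_one {M : Matrix ρ κ R} {s : ρ → κ} (h : M.submatrix id s = 1)
    {v : κ → R} : v ∈ rowSpan M ↔ (v ∘ s) ᵥ* M = v := by
  refine ⟨?_, fun h => ⟨_, h⟩⟩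
  rintro ⟨c, rfl⟩
  have : (M.vecMulLinear c) ∘ s = c ᵥ* (M.submatrix id s) := rfl
  rw [this, h, vecMul_one, vecMulLinear_apply]

lemma minors_mul (C : Matrix ρ ρ R) (M : Matrix ρ κ R) (s : ρ → κ) :
    minors (C * M) s = C.det * minors M s := by
  rw [minors, minors, ← det_mul]
  rfl

lemma minors_map (f : R →+* S) (M : Matrix ρ κ R) : minors (M.map f) = f ∘ minors M := by
  ext s
  rw [minors, submatrix_map, Function.comp_apply, minors, RingHom.map_det]
  rfl

lemma minors_of_submatrix_eq_one {M : Matrix ρ κ R} {s : ρ → κ} (h : M.submatrix id s = 1) :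
    minors M s = 1 := by
  rw [minors, h, det_one]

lemma map_submatrix_eq_one (f : R →+* S) {M : Matrix ρ κ R} {s : ρ → κ}
    (h : M.submatrix id s = 1) : (M.map f).submatrix id s = 1 := by
  rw [submatrix_map, h, Matrix.map_one f f.map_zero f.map_one]

/-- If `M' = C * M`, the minors are multiplied by `C.det`, which is a unit because the minor of `M'`
at `s'` is `1`. -/
lemma exists_minors_eq_smul {M M' : Matrix ρ κ R} {s' : ρ → κ}
    (h' : M'.submatrix id s' = 1) (hM : rowSpan M = rowSpan M') :
    ∃ u : Rˣ, minors M' = (u : R) • minors M := by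
  obtain ⟨C, hC⟩ := rowSpan_le_rowSpan.1 hM.ge
  have h1 : minors M' = C.det • minors M := by
    ext t
    rw [hC, minors_mul]
    rfl
  have h2 := congrFun h1 s'
  rw [minors_of_submatrix_eq_one h', Pi.smul_apply, smul_eq_mul] at h2
  exact ⟨Units.mkOfMulEqOne _ _ h2.symm, h1⟩

/-- The matrix whose entries are the coordinates obtained from `s` by changing one column. -/
def updateMatrix (w : (ρ → κ) → R) (s : ρ → κ) : Matrix ρ κ R :=
  Matrix.of fun a j => w (Function.update s a j)

/-- Cramer's rule: changing one column of the block `s` computes an entry of the adjugate of the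
block times `M`. -/
lemma updateMatrix_minors (M : Matrix ρ κ R) (s : ρ → κ) :
    updateMatrix (minors M) s = (M.submatrix id s).adjugate * M := by
  ext a j
  have h1 : M.submatrix id (Function.update s a j) =
      (M.submatrix id s).updateCol a (fun b => M b j) := by
    ext b c
    by_cases h : c = a
    · subst h; simp
    · simp [h]
  have h2 : ((M.submatrix id s).adjugate * M) a j =
      ((M.submatrix id s).adjugate *ᵥ fun b => M b j) a := rfl
  rw [h2, ← cramer_eq_adjugate_mulVec, cramer_apply, ← h1]
  rfl

lemma updateMatrix_minors_of_submatrix_eq_one {M : Matrix ρ κ R} {s : ρ → κ}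
    (h : M.submatrix id s = 1) : updateMatrix (minors M) s = M := by
  rw [updateMatrix_minors, h, adjugate_one, Matrix.one_mul]

lemma rowSpan_unit_mul {C : Matrix ρ ρ R} (hC : IsUnit C) (M : Matrix ρ κ R) :
    rowSpan (C * M) = rowSpan M := by
  obtain ⟨u, rfl⟩ := hC
  refine le_antisymm (rowSpan_le_rowSpan.2 ⟨_, rfl⟩) (rowSpan_le_rowSpan.2 ⟨(↑u⁻¹ : Matrix ρ ρ R), ?_⟩)
  rw [← Matrix.mul_assoc, Units.inv_mul, Matrix.one_mul]

/-- By Cramer's rule the adjugate of the block `s` of `M'` times `M'` depends only on the minors, so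
it equals `u • M`. Multiplying by that block, whose determinant is `u`, writes `M'` as an invertible
matrix times `M`. -/
lemma rowSpan_eq_of_minors_eq_smul {M M' : Matrix ρ κ R} {s : ρ → κ}
    (h : M.submatrix id s = 1) (u : Rˣ)
    (hM : minors M' = (u : R) • minors M) : rowSpan M = rowSpan M' := by
  have h1 : (M'.submatrix id s).det = u := by
    have := congrFun hM s
    rwa [Pi.smul_apply, minors_of_submatrix_eq_one h, smul_eq_mul, mul_one] at this
  have h2 : IsUnit (M'.submatrix id s) := by
    rw [Matrix.isUnit_iff_isUnit_det, h1]
    exact u.isUnit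
  have h3 : (M'.submatrix id s) * (M'.submatrix id s).adjugate = (u : R) • 1 := by
    rw [mul_adjugate, h1]
  have h4 : (M'.submatrix id s).adjugate * M' = (u : R) • M := by
    rw [← updateMatrix_minors, hM]
    conv_rhs => rw [← updateMatrix_minors_of_submatrix_eq_one h]
    rfl
  have h5 : M' = M'.submatrix id s * M := by
    have := congrArg (M'.submatrix id s * ·) h4
    simp only [← Matrix.mul_assoc, h3, Matrix.mul_smul, Matrix.smul_mul, Matrix.one_mul] at this
    have := congrArg (fun x => (↑u⁻¹ : R) • x) this
    simpa [smul_smul] using this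
  rw [h5, rowSpan_unit_mul h2]

variable {F : Type u} [Field F]

/-- The matrices for which the row span is stable under `𝒯` and the minors in `bad` vanish. -/
structure IsAdmissible [Algebra F R] (𝒯 : Set (Matrix κ κ F)) (bad : Set (ρ → κ))
    (M : Matrix ρ κ R) : Prop where
  stable : ∀ T ∈ 𝒯, ∃ C : Matrix ρ ρ R, M * T.map (algebraMap F R) = C * M
  vanish : ∀ s ∈ bad, minors M s = 0

lemma IsAdmissible.map [Algebra F R] [Algebra F S] {𝒯 : Set (Matrix κ κ F)} {bad : Set (ρ → κ)}
    {M : Matrix ρ κ R} (h : IsAdmissible 𝒯 bad M) (f : R →ₐ[F] S) :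
    IsAdmissible 𝒯 bad (M.map (f : R →+* S)) where
  stable T hT := by
    obtain ⟨C, hC⟩ := h.stable T hT
    refine ⟨C.map (f : R →+* S), ?_⟩
    rw [← Matrix.map_mul, ← hC, Matrix.map_mul, Matrix.map_map]
    congr 2
    ext
    simp
  vanish s hs := by
    rw [minors_map, Function.comp_apply, h.vanish s hs, map_zero]

/-- The Plücker equations, the equations of stability under `𝒯` and the vanishing of the
coordinates in `bad`, for a family of coordinates `w`. -/
structure SatisfiesEquations [Algebra F R] (𝒯 : Set (Matrix κ κ F)) (bad : Set (ρ → κ))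
    (w : (ρ → κ) → R) : Prop where
  -- If `w` consists of the minors of `M` and `r = card ρ`, then `updateMatrix w s` is an adjugate
  -- times `M`, with minors `w s ^ (r - 1) * w t`. The extra factor `w s` avoids the exponent `r -
  -- 1`, which is meaningless for `r = 0`.
  pluecker : ∀ s t, w s ^ Fintype.card ρ * w t = w s * minors (updateMatrix w s) t
  -- Where `w s = 1` the block `s` of the matrix is the identity, so the only candidate for `C` is
  -- the block `s` of the product with `T`. The factor `w s` makes the equation homogeneous.
  stable : ∀ s, ∀ T ∈ 𝒯, w s • (updateMatrix w s * T.map (algebraMap F R)) =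
    (updateMatrix w s * T.map (algebraMap F R)).submatrix id s * updateMatrix w s
  vanish : ∀ s ∈ bad, w s = 0

lemma IsAdmissible.satisfiesEquations [Algebra F R] {𝒯 : Set (Matrix κ κ F)} {bad : Set (ρ → κ)}
    {M : Matrix ρ κ R} (h : IsAdmissible 𝒯 bad M) : SatisfiesEquations (F := F) 𝒯 bad (minors M) where
  pluecker s t := by
    rw [updateMatrix_minors, minors_mul, ← mul_assoc]
    congr 1
    rw [minors, ← det_mul, mul_adjugate, det_smul, det_one, mul_one]
  stable s T hT := by
    obtain ⟨C, hC⟩ := h.stable T hT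
    rw [updateMatrix_minors, Matrix.mul_assoc, hC]
    have : ((M.submatrix id s).adjugate * (C * M)).submatrix id s =
      (M.submatrix id s).adjugate * C * M.submatrix id s := by
        rw [← Matrix.mul_assoc]; rfl
    rw [this, Matrix.mul_assoc (_ * C), ← Matrix.mul_assoc (M.submatrix id s), mul_adjugate,
      Matrix.smul_mul, Matrix.one_mul, Matrix.mul_smul, Matrix.mul_assoc]
    rfl
  vanish := h.vanish

/-- The matrix is `updateMatrix w s`: where `w s = 1` the Plücker equations say that its minors are
`w`, and the other equations become admissibility. -/
lemma SatisfiesEquations.exists_matrix [Algebra F R] {𝒯 : Set (Matrix κ κ F)} {bad : Set (ρ → κ)}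
    {w : (ρ → κ) → R} (h : SatisfiesEquations (F := F) 𝒯 bad w) {s : ρ → κ} (hs : w s = 1) :
    ∃ M : Matrix ρ κ R, M.submatrix id s = 1 ∧ minors M = w ∧ IsAdmissible 𝒯 bad M := by
  have h1 : minors (updateMatrix w s) = w := by
    ext t
    have := h.pluecker s t
    rw [hs, one_pow, one_mul, one_mul] at this
    exact this.symm
  refine ⟨updateMatrix w s, ?_, h1, fun T hT =>
    ⟨(updateMatrix w s * T.map (algebraMap F R)).submatrix id s, ?_⟩, fun t ht => ?_⟩
  · ext a b
    by_cases hab : a = b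
    · subst hab
      simp [updateMatrix, hs]
    · rw [Matrix.one_apply_ne hab]
      change w (Function.update s a (s b)) = 0
      rw [← h1]
      -- An off-diagonal entry is the coordinate of a choice in which the column `s b` occurs twice,
      -- hence a minor with two equal columns.
      refine det_zero_of_column_eq hab fun c => ?_
      simp [Ne.symm hab]
  · simpa [hs] using h.stable s T hT
  · rw [h1, h.vanish t ht]

end RowSpan

/-! ### Gluing points over an open cover of an affine scheme -/

section Gluing

variable {F : Type u} [Field F]

lemma specOverMap_comp {R S T : Type u} [CommRing R] [Algebra F R] [CommRing S] [Algebra F S]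
    [CommRing T] [Algebra F T] (f : R →ₐ[F] S) (g : S →ₐ[F] T) :
    specOverMap (g.comp f) = specOverMap g ≫ specOverMap f := by
  ext1
  change Spec.map _ = Spec.map _ ≫ Spec.map _
  rw [← Spec.map_comp]
  rfl

lemma specOverMap_id {R : Type u} [CommRing R] [Algebra F R] :
    specOverMap (AlgHom.id F R) = 𝟙 (specOver F R) := by
  ext1
  exact Spec.map_id _

variable (F) in
/-- The localization map at one element, as a homomorphism of `F`-algebras. -/
abbrev awayHom {R : Type u} [CommRing R] [Algebra F R] (f : R) : R →ₐ[F] Localization.Away f :=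
  IsScalarTower.toAlgHom F R (Localization.Away f)

variable {X : Over (Spec (.of F))} {R : Type u} [CommRing R] [Algebra F R]

lemma points_ext {ι : Type*} (f : ι → R) (hf : Ideal.span (Set.range f) = ⊤) {x y : Points X R}
    (h : ∀ a, specOverMap (awayHom F (f a)) ≫ x = specOverMap (awayHom F (f a)) ≫ y) : x = y := by
  ext1
  refine Scheme.Cover.hom_ext (Scheme.affineOpenCoverOfSpanRangeEqTop (R := .of R) f hf).openCover
    _ _ fun a => ?_
  exact congrArg Over.Hom.left (h a)

/-- The overlap of two basic opens is `Spec` of the tensor product of the localizations. Requiring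
agreement over every common algebra `T` includes this case and is easier to verify. -/
lemma exists_glue {ι : Type*} (f : ι → R) (hf : Ideal.span (Set.range f) = ⊤)
    (x : ∀ a, Points X (Localization.Away (f a)))
    (hx : ∀ (a b : ι) (T : Type u) [CommRing T] [Algebra F T]
      (g : Localization.Away (f a) →ₐ[F] T) (h : Localization.Away (f b) →ₐ[F] T),
      g.comp (awayHom F (f a)) = h.comp (awayHom F (f b)) →
        specOverMap g ≫ x a = specOverMap h ≫ x b) :
    ∃ y : Points X R, ∀ a, specOverMap (awayHom F (f a)) ≫ y = x a := by
  let 𝒰 := (Scheme.affineOpenCoverOfSpanRangeEqTop (R := .of R) f hf).openCover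
  let x' : ∀ a, 𝒰.X a ⟶ X.left := fun a => (x a).left
  have hx' : ∀ a b, pullback.fst (𝒰.f a) (𝒰.f b) ≫ x' a = pullback.snd _ _ ≫ x' b := by
    intro a b
    let Ra := Localization.Away (f a)
    let Rb := Localization.Away (f b)
    let T := Ra ⊗[R] Rb
    have h1 := hx a b T ((Algebra.TensorProduct.includeLeft : Ra →ₐ[R] T).restrictScalars F)
      ((Algebra.TensorProduct.includeRight : Rb →ₐ[R] T).restrictScalars F) (by
        ext r
        change algebraMap R Ra r ⊗ₜ[R] (1 : Rb) = (1 : Ra) ⊗ₜ[R] algebraMap R Rb r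
        rw [Algebra.algebraMap_eq_smul_one, Algebra.algebraMap_eq_smul_one,
          TensorProduct.smul_tmul])
    have h2 := congrArg Over.Hom.left h1
    have h3 := pullbackSpecIso_inv_fst R Ra Rb
    have h4 := pullbackSpecIso_inv_snd R Ra Rb
    refine (cancel_epi (pullbackSpecIso R Ra Rb).inv).1 ?_
    refine ((Category.assoc _ _ _).symm.trans (congrArg (· ≫ x' a) h3)).trans (Eq.trans h2 ?_)
    exact ((Category.assoc _ _ _).symm.trans (congrArg (· ≫ x' b) h4)).symm
  have key : ∀ a, 𝒰.f a ≫ Scheme.Cover.glueMorphisms 𝒰 x' hx' = x' a := fun a =>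
    Scheme.Cover.ι_glueMorphisms 𝒰 x' hx' a
  refine ⟨Over.homMk (Scheme.Cover.glueMorphisms 𝒰 x' hx') ?_, fun a => ?_⟩
  · refine Scheme.Cover.hom_ext 𝒰 _ _ fun a => ?_
    refine ((Category.assoc _ _ _).symm.trans (congrArg (· ≫ X.hom) (key a))).trans ?_
    refine (Over.w (x a)).trans ?_
    exact (Over.w (specOverMap (awayHom F (f a)))).symm
  · ext1
    exact key a

end Gluing

/-! ### Submodules of free modules under localization -/

section Localization

set_option linter.unusedSectionVars false

variable {F : Type u} [Field F] {R S : Type u} [CommRing R] [Algebra F R] [CommRing S] [Algebra F S]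

lemma exists_away_lift (φ : R →ₐ[F] S) {f : R} (hf : IsUnit (φ f)) :
    ∃ g : Localization.Away f →ₐ[F] S, g.comp (awayHom F f) = φ := by
  have h : ∀ y : Submonoid.powers f, IsUnit (φ y) := by
    rintro ⟨_, n, rfl⟩
    simpa using hf.pow n
  refine ⟨IsLocalization.liftAlgHom h, ?_⟩
  ext x
  exact IsLocalization.lift_eq (M := Submonoid.powers f) (g := (φ : R →+* S)) h x

lemma exists_away_lift' (φ : R →ₐ[F] S) (f : R) :
    ∃ g : Localization.Away f →ₐ[F] Localization.Away (φ f),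
      g.comp (awayHom F f) = (awayHom F (φ f)).comp φ :=
  exists_away_lift ((awayHom F (φ f)).comp φ) (IsLocalization.Away.algebraMap_isUnit (φ f))

variable {κ : Type} [Fintype κ] [DecidableEq κ]

lemma exists_pow_smul_mem_of_mem_mapSpan {f : R} {J : Submodule R (κ → R)} {v : κ → R}
    (h : algebraMap R (Localization.Away f) ∘ v ∈
      mapSpan (algebraMap R (Localization.Away f)) J) : ∃ n : ℕ, f ^ n • v ∈ J := by
  have key : ∀ w ∈ mapSpan (algebraMap R (Localization.Away f)) J, ∃ n : ℕ, ∃ v ∈ J,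
      (algebraMap R (Localization.Away f) f) ^ n • w = algebraMap R (Localization.Away f) ∘ v := by
    intro w hw
    induction hw using Submodule.span_induction with
    | mem x h =>
      obtain ⟨v, hv, rfl⟩ := h
      exact ⟨0, v, hv, by simp⟩
    | zero => exact ⟨0, 0, zero_mem _, by ext; simp⟩
    | add x y _ _ hx hy =>
      obtain ⟨n, v, hv, h1⟩ := hx
      obtain ⟨m, w, hw, h2⟩ := hy
      refine ⟨n + m, f ^ m • v + f ^ n • w, add_mem (J.smul_mem _ hv) (J.smul_mem _ hw), ?_⟩
      ext j
      have h1 := congrFun h1 j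
      have h2 := congrFun h2 j
      simp only [Pi.smul_apply, smul_eq_mul, Function.comp_apply, Pi.add_apply, map_add, map_mul,
        map_pow] at h1 h2 ⊢
      rw [← h1, ← h2]
      ring
    | smul a x _ hx =>
      obtain ⟨n, v, hv, h1⟩ := hx
      obtain ⟨m, b, hb⟩ := IsLocalization.Away.surj f a
      refine ⟨n + m, b • v, J.smul_mem _ hv, ?_⟩
      ext j
      have h1 := congrFun h1 j
      simp only [Pi.smul_apply, smul_eq_mul, Function.comp_apply, map_mul] at h1 hb ⊢
      rw [← h1, ← hb]
      ring
  obtain ⟨n, w, hw, h1⟩ := key _ h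
  -- Equality after localizing lifts only up to a further power of `f`, chosen for each coordinate;
  -- the sum of the exponents serves all of them.
  have h2 (j : κ) : ∃ m : ℕ, f ^ m * (f ^ n * v j) = f ^ m * w j := by
    have := congrFun h1 j
    simp only [Pi.smul_apply, smul_eq_mul, Function.comp_apply] at this
    rw [← map_pow, ← map_mul, IsLocalization.eq_iff_exists (Submonoid.powers f)] at this
    obtain ⟨⟨_, m, rfl⟩, h⟩ := this
    exact ⟨m, h⟩
  choose m hm using h2
  refine ⟨(∑ j, m j) + n, ?_⟩
  have : f ^ ((∑ j, m j) + n) • v = f ^ (∑ j, m j) • w := by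
    ext j
    have hj : m j ≤ ∑ j, m j := Finset.single_le_sum (fun _ _ => Nat.zero_le _) (Finset.mem_univ j)
    obtain ⟨k, hk⟩ := Nat.exists_eq_add_of_le hj
    simp only [Pi.smul_apply, smul_eq_mul, hk]
    linear_combination f ^ k * hm j
  rw [this]
  exact J.smul_mem _ hw

/-- For `v ∈ I` the ideal of all `r` with `r • v ∈ J` contains a power of each `f a`, so no maximal
ideal contains it. -/
lemma le_of_local {ι : Type*} (f : ι → R) (hf : Ideal.span (Set.range f) = ⊤)
    {I J : Submodule R (κ → R)} (h : ∀ a, mapSpan (algebraMap R (Localization.Away (f a))) I ≤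
      mapSpan (algebraMap R (Localization.Away (f a))) J) : I ≤ J := by
  intro v hv
  let K : Ideal R := J.comap (LinearMap.toSpanSingleton R _ v)
  have hK : K = ⊤ := by
    by_contra hc
    obtain ⟨m, hm, hKm⟩ := Ideal.exists_le_maximal K hc
    have : Ideal.span (Set.range f) ≤ m := by
      rw [Ideal.span_le]
      rintro _ ⟨a, rfl⟩
      obtain ⟨n, hn⟩ := exists_pow_smul_mem_of_mem_mapSpan (h a (mem_mapSpan _ hv))
      exact hm.isPrime.mem_of_pow_mem n (hKm hn)
    exact hm.ne_top (top_le_iff.1 (hf.ge.trans this))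
  have : (1 : R) ∈ K := hK ▸ Submodule.mem_top
  simpa [K] using this

lemma eq_of_local {ι : Type*} (f : ι → R) (hf : Ideal.span (Set.range f) = ⊤)
    {I J : Submodule R (κ → R)} (h : ∀ a, mapSpan (algebraMap R (Localization.Away (f a))) I =
      mapSpan (algebraMap R (Localization.Away (f a))) J) : I = J :=
  le_antisymm (le_of_local f hf fun a => (h a).le) (le_of_local f hf fun a => (h a).ge)

/-- Turns a choice of denominator at every prime into a cover by basic opens. -/
lemma span_range_eq_top_of_forall_prime {f : PrimeSpectrum R → R}
    (hf : ∀ p, f p ∉ p.asIdeal) : Ideal.span (Set.range f) = ⊤ := by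
  by_contra hc
  obtain ⟨m, hm, h⟩ := Ideal.exists_le_maximal _ hc
  exact hf ⟨m, hm.isPrime⟩ (h (Ideal.subset_span ⟨_, rfl⟩))

end Localization

/-! ### The equations as homogeneous polynomials -/

section Equations

set_option linter.unusedSectionVars false

open MvPolynomial Matrix

variable {κ ρ : Type} [Fintype κ] [DecidableEq κ] [Fintype ρ] [DecidableEq ρ]
variable {F : Type u} [Field F]

lemma isHomogeneous_minors {σ : Type} {M : Matrix ρ κ (MvPolynomial σ F)} {n : ℕ}
    (hM : ∀ a j, (M a j).IsHomogeneous n) (s : ρ → κ) :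
    (minors M s).IsHomogeneous (Fintype.card ρ * n) := by
  rw [minors, det_apply]
  refine IsHomogeneous.sum _ _ _ fun σ _ => ?_
  rw [Units.smul_def]
  have h1 : (∏ i, (M.submatrix id s) (σ i) i).IsHomogeneous (∑ i : ρ, n) :=
    IsHomogeneous.prod _ _ _ fun i _ => hM _ _
  rw [Finset.sum_const, Finset.card_univ, smul_eq_mul] at h1
  exact (homogeneousSubmodule _ F _).smul_of_tower_mem _ h1

/-- The difference of the two sides of the equations expressing stability under `T`. -/
def stabilityDefect {R : Type u} [CommRing R] [Algebra F R] (w : (ρ → κ) → R) (s : ρ → κ)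
    (T : Matrix κ κ F) : Matrix ρ κ R :=
  w s • (updateMatrix w s * T.map (algebraMap F R)) -
    (updateMatrix w s * T.map (algebraMap F R)).submatrix id s * updateMatrix w s

lemma map_stabilityDefect {R S : Type u} [CommRing R] [Algebra F R] [CommRing S] [Algebra F S]
    (φ : R →ₐ[F] S) (w : (ρ → κ) → R) (s : ρ → κ) (T : Matrix κ κ F) (a : ρ) (j : κ) :
    φ (stabilityDefect w s T a j) = stabilityDefect (φ ∘ w) s T a j := by
  simp [stabilityDefect, updateMatrix, Matrix.mul_apply]

/-- The homogeneous equations cutting out the row spans of admissible matrices. -/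
def equations {N : ℕ} (e : (ρ → κ) ≃ Fin (N + 1)) (𝒯 : Set (Matrix κ κ F)) (bad : Set (ρ → κ)) :
    Set (MvPolynomial (Fin (N + 1)) F) :=
  let w : (ρ → κ) → MvPolynomial (Fin (N + 1)) F := fun s => X (e s)
  {p | (∃ s t, p = w s ^ Fintype.card ρ * w t - w s * minors (updateMatrix w s) t) ∨
    (∃ s, ∃ T ∈ 𝒯, ∃ a j, p = stabilityDefect w s T a j) ∨
    (∃ s ∈ bad, p = w s)}

lemma exists_mem_homogeneousSubmodule_of_mem_equations {N : ℕ} (e : (ρ → κ) ≃ Fin (N + 1))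
    (𝒯 : Set (Matrix κ κ F)) (bad : Set (ρ → κ)) {p : MvPolynomial (Fin (N + 1)) F}
    (hp : p ∈ equations e 𝒯 bad) : ∃ n, p ∈ homogeneousSubmodule (Fin (N + 1)) F n := by
  have hX (s : ρ → κ) : (X (e s) : MvPolynomial (Fin (N + 1)) F).IsHomogeneous 1 :=
    isHomogeneous_X F _
  rcases hp with ⟨s, t, rfl⟩ | ⟨s, T, -, a, j, rfl⟩ | ⟨s, -, rfl⟩
  · refine ⟨Fintype.card ρ + 1, IsHomogeneous.sub ?_ ?_⟩
    · simpa using ((hX s).pow (Fintype.card ρ)).mul (hX t)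
    · refine (show 1 + Fintype.card ρ = Fintype.card ρ + 1 from add_comm _ _) ▸ (hX s).mul ?_
      have := isHomogeneous_minors (F := F)
        (M := updateMatrix (fun s : ρ → κ => (X (e s) : MvPolynomial (Fin (N + 1)) F)) s) (n := 1)
        (fun a j => hX _) t
      rwa [mul_one] at this
  · have h1 (a j) : ((updateMatrix (fun s : ρ → κ => (X (e s) : MvPolynomial (Fin (N + 1)) F)) s *
        T.map (algebraMap F (MvPolynomial (Fin (N + 1)) F)) :
          Matrix ρ κ (MvPolynomial (Fin (N + 1)) F)) a j).IsHomogeneous 1 := by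
      rw [Matrix.mul_apply]
      refine IsHomogeneous.sum _ _ _ fun i _ => ?_
      exact (hX (Function.update s a i)).mul (isHomogeneous_C (Fin (N + 1)) (T i j))
    refine ⟨1 + 1, IsHomogeneous.sub ?_ ?_⟩
    · exact (hX s).mul (h1 a j)
    · rw [Matrix.mul_apply]
      refine IsHomogeneous.sum _ _ _ fun i _ => (h1 _ _).mul (hX _)
  · exact ⟨1, hX s⟩

lemma aeval_equations {N : ℕ} (e : (ρ → κ) ≃ Fin (N + 1)) (𝒯 : Set (Matrix κ κ F))
    (bad : Set (ρ → κ)) {R : Type u} [CommRing R] [Algebra F R] (w : (ρ → κ) → R) :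
    (∀ p ∈ equations e 𝒯 bad, aeval (w ∘ e.symm) p = 0) ↔ SatisfiesEquations (F := F) 𝒯 bad w := by
  let φ : MvPolynomial (Fin (N + 1)) F →ₐ[F] R := aeval (w ∘ e.symm)
  let W : (ρ → κ) → MvPolynomial (Fin (N + 1)) F := fun s => X (e s)
  have hW : φ ∘ W = w := by
    ext s
    simp [φ, W]
  have hW' (s) : φ (W s) = w s := congrFun hW s
  have hU (s) : (updateMatrix W s).map (φ : MvPolynomial (Fin (N + 1)) F →+* R) =
      updateMatrix w s := by
    ext a j
    exact hW' _
  have hm (s t) : φ (minors (updateMatrix W s) t) = minors (updateMatrix w s) t := by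
    rw [← hU, minors_map]; rfl
  have hE (s) (T : Matrix κ κ F) (a j) : φ (stabilityDefect W s T a j) = stabilityDefect w s T a j := by
    rw [map_stabilityDefect, hW]
  have hp (s t) : φ (W s ^ Fintype.card ρ * W t - W s * minors (updateMatrix W s) t) =
      w s ^ Fintype.card ρ * w t - w s * minors (updateMatrix w s) t := by
    rw [map_sub, map_mul, map_mul, map_pow, hW', hW', hm]
  constructor
  · intro h
    refine ⟨fun s t => ?_, fun s T hT' => ?_, fun s hs => ?_⟩
    · rw [← sub_eq_zero, ← hp]
      exact h _ (Or.inl ⟨s, t, rfl⟩)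
    · rw [← sub_eq_zero]
      ext a j
      exact (hE s T a j).symm.trans (h _ (Or.inr (Or.inl ⟨s, T, hT', a, j, rfl⟩)))
    · rw [← hW']
      exact h _ (Or.inr (Or.inr ⟨s, hs, rfl⟩))
  · rintro h p (⟨s, t, rfl⟩ | ⟨s, T, hT', a, j, rfl⟩ | ⟨s, hs, rfl⟩)
    · exact (hp s t).trans (sub_eq_zero.2 (h.pluecker s t))
    · refine (hE s T a j).trans ?_
      rw [stabilityDefect, h.stable s T hT', sub_self]
      rfl
    · exact (hW' s).trans (h.vanish s hs)

end Equations

/-! ### The Plücker model: points versus locally admissible submodules -/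

section RowSpanFunctor

open Matrix MvPolynomial

set_option linter.unusedSectionVars false

attribute [local instance] MvPolynomial.gradedAlgebra

variable {κ ρ : Type} [Fintype κ] [DecidableEq κ] [Fintype ρ] [DecidableEq ρ]
variable {F : Type u} [Field F]

/-- Submodules which are locally row spans of admissible matrices containing an identity
submatrix. -/
def IsLocallyAdmissible (𝒯 : Set (Matrix κ κ F)) (bad : Set (ρ → κ)) {R : Type u} [CommRing R]
    [Algebra F R] (I : Submodule R (κ → R)) : Prop :=
  ∀ p : PrimeSpectrum R, ∃ f ∉ p.asIdeal, ∃ (M : Matrix ρ κ (Localization.Away f)) (s : ρ → κ),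
    M.submatrix id s = 1 ∧ IsAdmissible 𝒯 bad M ∧
      mapSpan (algebraMap R (Localization.Away f)) I = rowSpan M

variable {N : ℕ} (e : (ρ → κ) ≃ Fin (N + 1))
variable {R S : Type u} [CommRing R] [Algebra F R] [CommRing S] [Algebra F S]

lemma isUnit_minors_comp_symm {M : Matrix ρ κ R} {s : ρ → κ} (h : M.submatrix id s = 1) :
    IsUnit ((minors M ∘ e.symm) (e s)) := by
  rw [Function.comp_apply, e.symm_apply_apply, minors_of_submatrix_eq_one h]
  exact isUnit_one

/-- The point of projective space given by the minors of a matrix. -/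
def minorsPoint (M : Matrix ρ κ R) (s : ρ → κ) (h : M.submatrix id s = 1) :
    Points (projectiveSpace F N) R :=
  coordPoint (minors M ∘ e.symm) (e s) (isUnit_minors_comp_symm e h)

lemma specOverMap_minorsPoint (φ : R →ₐ[F] S) (M : Matrix ρ κ R) (s : ρ → κ)
    (h : M.submatrix id s = 1) :
    specOverMap φ ≫ minorsPoint e M s h =
      minorsPoint e (M.map (φ : R →+* S)) s (map_submatrix_eq_one _ h) := by
  have h1 : (φ : R → S) ∘ (minors M ∘ e.symm) = minors (M.map (φ : R →+* S)) ∘ e.symm := by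
    rw [minors_map]; rfl
  have h2 := isUnit_minors_comp_symm e (map_submatrix_eq_one (φ : R →+* S) h)
  refine (specOverMap_coordPoint φ _ _ (isUnit_minors_comp_symm e h) (h1 ▸ h2)).trans ?_
  unfold minorsPoint
  congr 1

/-- Injectivity of the Plücker map: each side says that the minors agree up to a unit. -/
lemma minorsPoint_eq_iff {M M' : Matrix ρ κ R} {s s' : ρ → κ} (h : M.submatrix id s = 1)
    (h' : M'.submatrix id s' = 1) :
    minorsPoint (F := F) e M s h = minorsPoint e M' s' h' ↔ rowSpan M = rowSpan M' := by
  constructor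
  · intro H
    obtain ⟨u, hu⟩ := exists_smul_of_coordPoint_eq H
    refine rowSpan_eq_of_minors_eq_smul h u ?_
    ext t
    simpa using congrFun hu (e t)
  · intro H
    obtain ⟨u, hu⟩ := exists_minors_eq_smul h' H
    have h1 : minors M' ∘ e.symm = (u : R) • (minors M ∘ e.symm) := by
      rw [hu]; rfl
    have h2 : IsUnit (((u : R) • (minors M ∘ e.symm)) (e s)) := by
      rw [Pi.smul_apply, smul_eq_mul]
      exact u.isUnit.mul (isUnit_minors_comp_symm e h)
    refine (coordPoint_smul _ _ u (isUnit_minors_comp_symm e h) h2).symm.trans ?_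
    unfold minorsPoint
    simp only [h1]
    exact coordPoint_index _ _ _ _ _

/-- `Z` is cut out in projective space by the equations for row spans of admissible matrices. -/
structure IsPlueckerModel (𝒯 : Set (Matrix κ κ F)) (bad : Set (ρ → κ)) {Z : Over (Spec (.of F))}
    (ι : Z ⟶ projectiveSpace F N) : Prop where
  isClosedImmersion : IsClosedImmersion ι.left
  exists_iff : ∀ (R : Type u) [CommRing R] [Algebra F R] (w : Fin (N + 1) → R) (i : Fin (N + 1))
    (h : IsUnit (w i)), (∃ z : Points Z R, z ≫ ι = coordPoint w i h) ↔
      SatisfiesEquations (F := F) 𝒯 bad (w ∘ e)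

lemma exists_isPlueckerModel (𝒯 : Set (Matrix κ κ F)) (bad : Set (ρ → κ)) :
    ∃ (Z : Over (Spec (.of F))) (ι : Z ⟶ projectiveSpace F N), IsPlueckerModel e 𝒯 bad ι := by
  obtain ⟨Z, ι, h1, h2⟩ := exists_closedSubscheme (equations e 𝒯 bad)
    (fun p hp => exists_mem_homogeneousSubmodule_of_mem_equations e 𝒯 bad hp)
  refine ⟨Z, ι, h1, fun R _ _ w i h => ?_⟩
  rw [h2, ← aeval_equations e]
  have : w = (w ∘ e) ∘ e.symm := by ext; simp
  rw [← this]

variable {e} {𝒯 : Set (Matrix κ κ F)} {bad : Set (ρ → κ)} {Z : Over (Spec (.of F))}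
  {ι : Z ⟶ projectiveSpace F N}

lemma IsPlueckerModel.eq_of_comp_eq (hZ : IsPlueckerModel e 𝒯 bad ι) {x y : Points Z R}
    (h : x ≫ ι = y ≫ ι) : x = y := by
  have := hZ.isClosedImmersion
  ext1
  rw [← cancel_mono ι.left]
  exact congrArg Over.Hom.left h

lemma IsPlueckerModel.exists_point (hZ : IsPlueckerModel e 𝒯 bad ι) {M : Matrix ρ κ R} {s : ρ → κ}
    (h : M.submatrix id s = 1) (hM : IsAdmissible 𝒯 bad M) :
    ∃ z : Points Z R, z ≫ ι = minorsPoint e M s h := by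
  refine (hZ.exists_iff R _ _ _).2 ?_
  have : (minors M ∘ e.symm) ∘ e = minors M := by ext; simp
  rw [this]
  exact hM.satisfiesEquations

lemma IsPlueckerModel.exists_matrix (hZ : IsPlueckerModel e 𝒯 bad ι) (x : Points Z R) (s : ρ → κ)
    (hx : (x ≫ ι).left ⁻¹ᵁ
      (Proj.basicOpen (homogeneousSubmodule (Fin (N + 1)) F) (X (e s))) = ⊤) :
    ∃ (M : Matrix ρ κ R) (h : M.submatrix id s = 1), IsAdmissible 𝒯 bad M ∧
      x ≫ ι = minorsPoint e M s h := by
  obtain ⟨w, hw, hx⟩ := exists_coordPoint (x ≫ ι) (e s) hx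
  have h1 := (hZ.exists_iff R w (e s) (hw ▸ isUnit_one)).1 ⟨x, hx⟩
  obtain ⟨M, h2, h3, h4⟩ := h1.exists_matrix (s := s) hw
  refine ⟨M, h2, h4, hx.trans ?_⟩
  have : w = minors M ∘ e.symm := by rw [h3]; ext; simp
  unfold minorsPoint
  congr 1

lemma IsPlueckerModel.exists_local_matrix (hZ : IsPlueckerModel e 𝒯 bad ι) (x : Points Z R)
    (p : PrimeSpectrum R) : ∃ f ∉ p.asIdeal, ∃ (M : Matrix ρ κ (Localization.Away f)) (s : ρ → κ)
      (h : M.submatrix id s = 1), IsAdmissible 𝒯 bad M ∧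
        (specOverMap (awayHom F f) ≫ x) ≫ ι = minorsPoint e M s h := by
  let y : Spec (.of R) ⟶ Proj (homogeneousSubmodule (Fin (N + 1)) F) := (x ≫ ι).left
  have h1 : y.base p ∈ (⊤ : (Proj (homogeneousSubmodule (Fin (N + 1)) F)).Opens) := trivial
  rw [← iSup_basicOpen_X, TopologicalSpace.Opens.mem_iSup] at h1
  obtain ⟨i, hi⟩ := h1
  obtain ⟨s, rfl⟩ := e.surjective i
  let U := y ⁻¹ᵁ (Proj.basicOpen (homogeneousSubmodule (Fin (N + 1)) F) (X (e s)))
  have hpU : p ∈ U := hi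
  -- Some homogeneous coordinate is nonzero at `p`; shrink to a basic open on which it is
  -- invertible, so that it can be normalized to `1`.
  obtain ⟨_, ⟨f, rfl⟩, hf, hfU⟩ :=
    PrimeSpectrum.isTopologicalBasis_basic_opens.exists_subset_of_mem_open hpU U.isOpen
  refine ⟨f, hf, ?_⟩
  obtain ⟨M, h, hM, hx⟩ := hZ.exists_matrix (specOverMap (awayHom F f) ≫ x) s (by
    have e1 : ((specOverMap (awayHom F f) ≫ x) ≫ ι).left =
      Spec.map (CommRingCat.ofHom (algebraMap R (Localization.Away f))) ≫ y :=
        congrArg Over.Hom.left (Category.assoc _ _ _)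
    have e2 : (Spec.map (CommRingCat.ofHom (algebraMap R (Localization.Away f))) ≫ y) ⁻¹ᵁ
      (Proj.basicOpen (homogeneousSubmodule (Fin (N + 1)) F) (X (e s))) = ⊤ := by
      rw [Scheme.Hom.comp_preimage, ← top_le_iff]
      intro q _
      apply hfU
      have := PrimeSpectrum.localization_away_comap_range (Localization.Away f) f
      exact this.le ⟨q, rfl⟩
    exact (congrArg (· ⁻¹ᵁ (Proj.basicOpen (homogeneousSubmodule (Fin (N + 1)) F) (X (e s))))
      e1).trans e2)
  exact ⟨M, s, h, hM, hx⟩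

/-- The point `x` and the submodule `I` are locally given by the same matrices. -/
def IsPlueckerPointOf (𝒯 : Set (Matrix κ κ F)) (bad : Set (ρ → κ)) (e : (ρ → κ) ≃ Fin (N + 1))
    (ι : Z ⟶ projectiveSpace F N) (x : Points Z R) (I : Submodule R (κ → R)) : Prop :=
  ∀ p : PrimeSpectrum R, ∃ f ∉ p.asIdeal, ∃ (M : Matrix ρ κ (Localization.Away f)) (s : ρ → κ)
      (h : M.submatrix id s = 1), IsAdmissible 𝒯 bad M ∧
        mapSpan (algebraMap R (Localization.Away f)) I = rowSpan M ∧
        (specOverMap (awayHom F f) ≫ x) ≫ ι = minorsPoint e M s h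

lemma IsPlueckerPointOf.isLocallyAdmissible {x : Points Z R} {I : Submodule R (κ → R)}
    (h : IsPlueckerPointOf 𝒯 bad e ι x I) : IsLocallyAdmissible 𝒯 bad I := fun p =>
  let ⟨f, hf, M, s, hs, hM, hI, _⟩ := h p
  ⟨f, hf, M, s, hs, hM, hI⟩

lemma IsPlueckerPointOf.map {x : Points Z R} {I : Submodule R (κ → R)}
    (h : IsPlueckerPointOf 𝒯 bad e ι x I) (φ : R →ₐ[F] S) :
    IsPlueckerPointOf 𝒯 bad e ι (specOverMap φ ≫ x) (mapSpan (φ : R →+* S) I) := by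
  intro p
  obtain ⟨f, hf, M, s, hs, hM, hI, hx⟩ := h (p.comap (φ : R →+* S))
  obtain ⟨g, hg⟩ := exists_away_lift' φ f
  have hg' : (algebraMap S (Localization.Away (φ f))).comp (φ : R →+* S) =
      (g : Localization.Away f →+* _).comp (algebraMap R (Localization.Away f)) := by
    ext x
    exact (DFunLike.congr_fun hg x).symm
  refine ⟨φ f, hf, M.map (g : Localization.Away f →+* _), s, map_submatrix_eq_one _ hs,
    hM.map g, ?_, ?_⟩
  · rw [mapSpan_mapSpan, hg', ← mapSpan_mapSpan, hI, mapSpan_rowSpan]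
  · rw [← specOverMap_minorsPoint e g M s hs, ← hx, ← Category.assoc, ← specOverMap_comp, ← hg,
      specOverMap_comp]
    simp only [Category.assoc]

lemma IsPlueckerPointOf.mapSpan_eq_of_eq {x : Points Z R} {I : Submodule R (κ → R)}
    (h : IsPlueckerPointOf 𝒯 bad e ι x I) {M : Matrix ρ κ R} {s : ρ → κ}
    (hs : M.submatrix id s = 1) (hx : x ≫ ι = minorsPoint e M s hs) : I = rowSpan M := by
  choose f hf M' s' hs' hM' hI' hx' using h
  refine eq_of_local f (span_range_eq_top_of_forall_prime hf) fun p => ?_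
  rw [hI', mapSpan_rowSpan]
  refine (minorsPoint_eq_iff (F := F) e (hs' p) (map_submatrix_eq_one _ hs)).1 ?_
  rw [← hx', Category.assoc, hx]
  exact specOverMap_minorsPoint e (awayHom F (f p)) M s hs

/-- With `IsPlueckerPointOf.point_unique` and the two existence statements, this makes
`IsPlueckerPointOf` the graph of a bijection. Uniqueness is checked on a cover over which both
objects are given by one matrix. -/
lemma IsPlueckerPointOf.submodule_unique {x : Points Z R} {I J : Submodule R (κ → R)}
    (hI : IsPlueckerPointOf 𝒯 bad e ι x I) (hJ : IsPlueckerPointOf 𝒯 bad e ι x J) : I = J := by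
  choose f hf M s hs hM hI' hx using hI
  refine eq_of_local f (span_range_eq_top_of_forall_prime hf) fun p => ?_
  rw [hI']
  exact ((hJ.map (awayHom F (f p))).mapSpan_eq_of_eq (hs p) (hx p)).symm

lemma IsPlueckerPointOf.comp_eq_of_eq {x : Points Z R} {I : Submodule R (κ → R)}
    (h : IsPlueckerPointOf 𝒯 bad e ι x I) {M : Matrix ρ κ R} {s : ρ → κ}
    (hs : M.submatrix id s = 1) (hI : I = rowSpan M) : x ≫ ι = minorsPoint e M s hs := by
  choose f hf M' s' hs' hM' hI' hx' using h
  refine points_ext f (span_range_eq_top_of_forall_prime hf) fun p => ?_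
  rw [← Category.assoc, hx', specOverMap_minorsPoint, minorsPoint_eq_iff]
  rw [← hI', hI, mapSpan_rowSpan]
  rfl

lemma IsPlueckerPointOf.point_unique (hZ : IsPlueckerModel e 𝒯 bad ι) {x y : Points Z R}
    {I : Submodule R (κ → R)} (hx : IsPlueckerPointOf 𝒯 bad e ι x I)
    (hy : IsPlueckerPointOf 𝒯 bad e ι y I) : x = y := by
  choose f hf M s hs hM hI' hx using hx
  refine points_ext f (span_range_eq_top_of_forall_prime hf) fun p => ?_
  refine hZ.eq_of_comp_eq ?_
  rw [hx]
  exact ((hy.map (awayHom F (f p))).comp_eq_of_eq (hs p) (hI' p)).symm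

/-- The local points agree on overlaps because the row spans there are all extensions of the one
submodule `I`. -/
lemma IsPlueckerModel.exists_point_of_isLocallyAdmissible (hZ : IsPlueckerModel e 𝒯 bad ι)
    {I : Submodule R (κ → R)} (hI : IsLocallyAdmissible 𝒯 bad I) :
    ∃ x : Points Z R, IsPlueckerPointOf 𝒯 bad e ι x I := by
  choose f hf M s hs hM hI' using hI
  choose x hx using fun p => hZ.exists_point (hs p) (hM p)
  obtain ⟨y, hy⟩ := exists_glue f (span_range_eq_top_of_forall_prime hf) x (by
    intro p q T _ _ g h hgh
    refine hZ.eq_of_comp_eq ?_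
    rw [Category.assoc, Category.assoc, hx, hx, specOverMap_minorsPoint, specOverMap_minorsPoint,
      minorsPoint_eq_iff, ← mapSpan_rowSpan, ← mapSpan_rowSpan, ← hI', ← hI', mapSpan_mapSpan,
      mapSpan_mapSpan]
    congr 1
    ext r
    exact DFunLike.congr_fun hgh r)
  refine ⟨y, fun p => ⟨f p, hf p, M p, s p, hs p, hM p, hI' p, ?_⟩⟩
  rw [hy, hx]

end RowSpanFunctor

/-! ### Gluing row spans, and the representability theorem -/

section RowSpanFunctor

open Matrix

set_option linter.unusedSectionVars false

variable {κ ρ : Type} [Fintype κ] [DecidableEq κ] [Fintype ρ] [DecidableEq ρ]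
variable {F : Type u} [Field F] {R : Type u} [CommRing R] [Algebra F R]

lemma exists_pow_smul_eq_comp (f : R) (v : κ → Localization.Away f) :
    ∃ (n : ℕ) (w : κ → R), algebraMap R (Localization.Away f) f ^ n • v =
      algebraMap R (Localization.Away f) ∘ w := by
  choose n w hw using fun j => IsLocalization.Away.surj f (v j)
  refine ⟨∑ j, n j, fun j => f ^ (∑ j, n j - n j) * w j, ?_⟩
  ext j
  have hj : n j ≤ ∑ j, n j := Finset.single_le_sum (fun _ _ => Nat.zero_le _) (Finset.mem_univ j)
  simp only [Pi.smul_apply, smul_eq_mul, Function.comp_apply, map_mul, map_pow, ← hw]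
  conv_lhs => rw [← Nat.sub_add_cancel hj, pow_add]
  ring

/-- The submodule consists of the vectors lying in every given row span after localization. A row of
`M a` belongs to it after multiplication by a power of `f a`; one exponent works for all indices
because there are finitely many. -/
lemma mapSpan_glue {ι : Type*} [Finite ι] (f : ι → R)
    (M : ∀ a, Matrix ρ κ (Localization.Away (f a)))
    (hM : ∀ (a b : ι) (T : Type u) [CommRing T] [Algebra F T]
      (g : Localization.Away (f a) →ₐ[F] T) (h : Localization.Away (f b) →ₐ[F] T),
      g.comp (awayHom F (f a)) = h.comp (awayHom F (f b)) →
        rowSpan ((M a).map (g : _ →+* T)) = rowSpan ((M b).map (h : _ →+* T))) :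
    ∃ I : Submodule R (κ → R),
      ∀ a, mapSpan (algebraMap R (Localization.Away (f a))) I = rowSpan (M a) := by
  let I : Submodule R (κ → R) :=
    { carrier := {v | ∀ a, algebraMap R (Localization.Away (f a)) ∘ v ∈ rowSpan (M a)}
      add_mem' := fun {v w} hv hw a => by
        rw [show algebraMap R (Localization.Away (f a)) ∘ (v + w) =
          algebraMap R (Localization.Away (f a)) ∘ v +
            algebraMap R (Localization.Away (f a)) ∘ w by ext; simp]
        exact add_mem (hv a) (hw a)
      zero_mem' := fun a => by
        rw [show algebraMap R (Localization.Away (f a)) ∘ (0 : κ → R) = 0 by ext; simp]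
        exact zero_mem _
      smul_mem' := fun r v hv a => by
        rw [show algebraMap R (Localization.Away (f a)) ∘ (r • v) =
          algebraMap R (Localization.Away (f a)) r •
            (algebraMap R (Localization.Away (f a)) ∘ v) by ext; simp]
        exact Submodule.smul_mem _ _ (hv a) }
  refine ⟨I, fun a => le_antisymm (mapSpan_le.2 fun v hv => hv a) (rowSpan_le.2 fun i => ?_)⟩
  obtain ⟨n₀, v, hv⟩ := exists_pow_smul_eq_comp (f a) (M a i)
  -- Where both `f a` and `f b` are invertible the two row spans coincide, so `v` lies in that of `M
  -- b` up to a power of `f a`.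
  have key (b : ι) : ∃ n : ℕ, algebraMap R (Localization.Away (f b)) (f a) ^ n •
      (algebraMap R (Localization.Away (f b)) ∘ v) ∈ rowSpan (M b) := by
    refine exists_pow_smul_mem_of_mem_mapSpan ?_
    let T := Localization.Away (algebraMap R (Localization.Away (f b)) (f a))
    let h : Localization.Away (f b) →ₐ[F] T := awayHom F (algebraMap R (Localization.Away (f b)) (f a))
    obtain ⟨g, hg⟩ := exists_away_lift (h.comp (awayHom F (f b)))
      (IsLocalization.Away.algebraMap_isUnit (algebraMap R (Localization.Away (f b)) (f a)))
    have h1 : rowSpan ((M a).map (g : Localization.Away (f a) →+* T)) =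
      rowSpan ((M b).map (h : Localization.Away (f b) →+* T)) := hM a b T g h hg
    have h2 : mapSpan (h : Localization.Away (f b) →+* T) (rowSpan (M b)) =
        mapSpan (g : Localization.Away (f a) →+* T) (rowSpan (M a)) := by
      rw [mapSpan_rowSpan, mapSpan_rowSpan, h1]
    have h3 : (g : Localization.Away (f a) →+* T) ∘ algebraMap R (Localization.Away (f a)) ∘ v ∈
        mapSpan (g : Localization.Away (f a) →+* T) (rowSpan (M a)) := by
      refine mem_mapSpan _ ?_
      rw [← hv]
      exact Submodule.smul_mem _ _ (row_mem_rowSpan _ _)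
    rw [← h2] at h3
    have h4 : (h : Localization.Away (f b) →+* T) ∘ algebraMap R (Localization.Away (f b)) ∘ v =
        (g : Localization.Away (f a) →+* T) ∘ algebraMap R (Localization.Away (f a)) ∘ v :=
      funext fun j => (DFunLike.congr_fun hg (v j)).symm
    rw [← h4] at h3
    exact h3
  choose n hn using key
  have := Fintype.ofFinite ι
  have hmem : f a ^ (∑ b, n b) • v ∈ I := by
    intro b
    have hb : n b ≤ ∑ b, n b :=
      Finset.single_le_sum (fun _ _ => Nat.zero_le _) (Finset.mem_univ b)
    have : algebraMap R (Localization.Away (f b)) ∘ (f a ^ (∑ b, n b) • v) =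
      algebraMap R (Localization.Away (f b)) (f a) ^ (∑ b, n b - n b) •
        (algebraMap R (Localization.Away (f b)) (f a) ^ n b •
          (algebraMap R (Localization.Away (f b)) ∘ v)) := by
      ext j
      simp only [Function.comp_apply, Pi.smul_apply, smul_eq_mul, map_mul, map_pow]
      rw [← mul_assoc, ← pow_add, Nat.sub_add_cancel hb]
    rw [this]
    exact Submodule.smul_mem _ _ (hn b)
  have hu : IsUnit (algebraMap R (Localization.Away (f a)) (f a) ^ (∑ b, n b + n₀)) :=
    (IsLocalization.Away.algebraMap_isUnit (f a)).pow _
  have h4 : algebraMap R (Localization.Away (f a)) (f a) ^ (∑ b, n b + n₀) • M a i ∈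
      mapSpan (algebraMap R (Localization.Away (f a))) I := by
    have : algebraMap R (Localization.Away (f a)) (f a) ^ (∑ b, n b + n₀) • M a i =
        algebraMap R (Localization.Away (f a)) ∘ (f a ^ (∑ b, n b) • v) := by
      rw [pow_add, mul_smul, hv]
      ext j
      simp
    rw [this]
    exact mem_mapSpan _ hmem
  have h5 := Submodule.smul_mem _ (↑hu.unit⁻¹ : Localization.Away (f a)) h4
  rwa [smul_smul, hu.val_inv_mul, one_smul] at h5

variable {N : ℕ} {e : (ρ → κ) ≃ Fin (N + 1)} {𝒯 : Set (Matrix κ κ F)} {bad : Set (ρ → κ)}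
  {Z : Over (Spec (.of F))} {ι : Z ⟶ projectiveSpace F N}

lemma IsPlueckerModel.exists_submodule (hZ : IsPlueckerModel e 𝒯 bad ι) (x : Points Z R) :
    ∃ I : Submodule R (κ → R), IsPlueckerPointOf 𝒯 bad e ι x I := by
  choose f hf M s hs hM hx using hZ.exists_local_matrix x
  -- The spectrum is quasi-compact; a finite subcover is required for gluing submodules.
  obtain ⟨t, ht, ht'⟩ := (Ideal.span_eq_top_iff_finite _).1 (span_range_eq_top_of_forall_prime hf)
  choose q hq using fun a : t => ht a.2
  have hspan : Ideal.span (Set.range fun a => f (q a)) = ⊤ := by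
    rw [← ht']
    congr 1
    ext r
    constructor
    · rintro ⟨a, rfl⟩
      simp [hq]
    · intro hr
      exact ⟨⟨r, hr⟩, hq ⟨r, hr⟩⟩
  obtain ⟨I, hI⟩ := mapSpan_glue (F := F) (fun a => f (q a)) (fun a => M (q a)) (by
      intro a b T _ _ g h hgh
      rw [← minorsPoint_eq_iff (F := F) e (map_submatrix_eq_one _ (hs (q a)))
        (map_submatrix_eq_one _ (hs (q b))), ← specOverMap_minorsPoint e g _ _ (hs (q a)),
        ← specOverMap_minorsPoint e h _ _ (hs (q b)),
        ← hx, ← hx, ← Category.assoc, ← Category.assoc, ← Category.assoc, ← Category.assoc,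
        ← specOverMap_comp, ← specOverMap_comp, hgh])
  refine ⟨I, fun p => ?_⟩
  have : ∃ a, f (q a) ∉ p.asIdeal := by
    by_contra! hc
    refine p.2.ne_top (top_le_iff.1 (hspan.ge.trans (Ideal.span_le.2 ?_)))
    rintro _ ⟨a, rfl⟩
    exact hc a
  obtain ⟨a, ha⟩ := this
  exact ⟨f (q a), ha, M (q a), s (q a), hs _, hM _, hI a, hx _⟩

/-- The functor of locally admissible submodules is represented by a closed subscheme of a
projective space. -/
theorem exists_representation [Nonempty (ρ → κ)] (𝒯 : Set (Matrix κ κ F)) (bad : Set (ρ → κ)) :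
    ∃ (Z : Over (Spec (.of F))) (N : ℕ) (ι : Z ⟶ projectiveSpace F N), IsClosedImmersion ι.left ∧
      ∃ E : ∀ (R : Type u) [CommRing R] [Algebra F R],
        Points Z R ≃ {I : Submodule R (κ → R) // IsLocallyAdmissible (F := F) 𝒯 bad I},
      ∀ (R S : Type u) [CommRing R] [Algebra F R] [CommRing S] [Algebra F S] (f : R →ₐ[F] S)
        (x : Points Z R), (E S (specOverMap f ≫ x)).1 = mapSpan (f : R →+* S) (E R x).1 := by
  obtain ⟨N, hN⟩ : ∃ N, Fintype.card (ρ → κ) = N + 1 :=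
    Nat.exists_eq_succ_of_ne_zero Fintype.card_ne_zero
  let e : (ρ → κ) ≃ Fin (N + 1) := Fintype.equivFinOfCardEq hN
  obtain ⟨Z, ι, hZ⟩ := exists_isPlueckerModel e 𝒯 bad
  have hx (R : Type u) [CommRing R] [Algebra F R] (x : Points Z R) := hZ.exists_submodule x
  let G (R : Type u) [CommRing R] [Algebra F R] (x : Points Z R) :
    {I : Submodule R (κ → R) // IsLocallyAdmissible (F := F) 𝒯 bad I} :=
      ⟨(hx R x).choose, (hx R x).choose_spec.isLocallyAdmissible⟩
  have hG (R : Type u) [CommRing R] [Algebra F R] (x : Points Z R) :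
    IsPlueckerPointOf 𝒯 bad e ι x (G R x).1 := (hx R x).choose_spec
  have hbij (R : Type u) [CommRing R] [Algebra F R] : Function.Bijective (G R) := by
    constructor
    · intro x y hxy
      exact (hG R x).point_unique hZ (hxy ▸ hG R y)
    · intro I
      obtain ⟨x, hx⟩ := hZ.exists_point_of_isLocallyAdmissible I.2
      exact ⟨x, Subtype.ext ((hG R x).submodule_unique hx)⟩
  refine ⟨Z, N, ι, hZ.isClosedImmersion, fun R _ _ => Equiv.ofBijective _ (hbij R), ?_⟩
  intro R S _ _ _ _ f x
  exact (hG S _).submodule_unique ((hG R x).map f)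

end RowSpanFunctor

/-! ### Local row spans are the direct summands of constant rank -/

section LocalRowSpan

open Matrix

set_option linter.unusedSectionVars false

variable {κ ρ : Type} [Fintype κ] [DecidableEq κ] [Fintype ρ] [DecidableEq ρ]
variable {R : Type u} [CommRing R]

variable (ρ) in
/-- Submodules which are locally row spans of matrices containing an identity submatrix. -/
def IsLocallyRowSpan (I : Submodule R (κ → R)) : Prop :=
  ∀ p : PrimeSpectrum R, ∃ f ∉ p.asIdeal, ∃ (M : Matrix ρ κ (Localization.Away f)) (s : ρ → κ),
    M.submatrix id s = 1 ∧ mapSpan (algebraMap R (Localization.Away f)) I = rowSpan M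

/-- The localization map on `κ → R`. -/
abbrev piLocalization (κ : Type) (f : R) : (κ → R) →ₗ[R] (κ → Localization.Away f) :=
  (Algebra.linearMap R (Localization.Away f)).compLeft κ

instance (f : R) : IsLocalizedModule (Submonoid.powers f) (piLocalization κ f) :=
  inferInstanceAs (IsLocalizedModule (Submonoid.powers f) (LinearMap.pi fun j : κ =>
    (Algebra.linearMap R (Localization.Away f)) ∘ₗ LinearMap.proj j))

lemma localized'_piLocalization (f : R) (I : Submodule R (κ → R)) :
    I.localized' (Localization.Away f) (Submonoid.powers f) (piLocalization κ f) =
      mapSpan (algebraMap R (Localization.Away f)) I :=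
  Submodule.localized'_eq_span _ _ _ _

lemma vecMulLinear_injective_of_submatrix_eq_one {M : Matrix ρ κ R} {s : ρ → κ}
    (h : M.submatrix id s = 1) : Function.Injective M.vecMulLinear := by
  refine Function.LeftInverse.injective (g := fun v => v ∘ s) fun c => ?_
  change c ᵥ* (M.submatrix id s) = c
  rw [h, vecMul_one]

/-- A row span of a matrix containing an identity submatrix is free on the rows. -/
def rowSpanEquiv {M : Matrix ρ κ R} {s : ρ → κ} (h : M.submatrix id s = 1) :
    (ρ → R) ≃ₗ[R] rowSpan M :=
  LinearEquiv.ofInjective M.vecMulLinear (vecMulLinear_injective_of_submatrix_eq_one h)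

/-- The map `v ↦ v - (v ∘ s) ᵥ* M` kills the row span and changes `v` only by an element of it, so
it splits the quotient map. -/
lemma projective_quotient_rowSpan {M : Matrix ρ κ R} {s : ρ → κ} (h : M.submatrix id s = 1) :
    Module.Projective R ((κ → R) ⧸ rowSpan M) := by
  let φ : (κ → R) →ₗ[R] (κ → R) :=
    LinearMap.id - M.vecMulLinear ∘ₗ LinearMap.funLeft R R s
  have hφ : rowSpan M ≤ LinearMap.ker φ := by
    intro v hv
    rw [mem_rowSpan_of_submatrix_eq_one h] at hv
    rw [LinearMap.mem_ker, LinearMap.sub_apply, sub_eq_zero]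
    exact hv.symm
  refine Module.Projective.of_split ((rowSpan M).liftQ φ hφ) (rowSpan M).mkQ ?_
  ext v
  simp only [LinearMap.comp_apply, Submodule.mkQ_apply, Submodule.liftQ_apply, LinearMap.id_apply]
  rw [Submodule.Quotient.eq]
  have : φ (Pi.single v 1) - Pi.single v 1 = -(M.vecMulLinear (LinearMap.funLeft R R s (Pi.single v 1))) := by
    simp [φ]
  simp only [LinearMap.coe_single]
  rw [this]
  exact neg_mem ⟨_, rfl⟩

lemma IsLocallyRowSpan.span_eq_top {I : Submodule R (κ → R)} (h : IsLocallyRowSpan ρ I) :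
    Ideal.span {f : R | ∃ (M : Matrix ρ κ (Localization.Away f)) (s : ρ → κ),
      M.submatrix id s = 1 ∧ mapSpan (algebraMap R (Localization.Away f)) I = rowSpan M} = ⊤ := by
  by_contra hc
  obtain ⟨m, hm, hle⟩ := Ideal.exists_le_maximal _ hc
  obtain ⟨f, hf, h⟩ := h ⟨m, hm.isPrime⟩
  exact hf (hle (Ideal.subset_span h))

/-- Finite presentation and flatness can be checked on a cover, and together they give projectivity.
-/
lemma IsLocallyRowSpan.projective_quotient {I : Submodule R (κ → R)} (h : IsLocallyRowSpan ρ I) :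
    Module.Projective R ((κ → R) ⧸ I) := by
  let t := {f : R | ∃ (M : Matrix ρ κ (Localization.Away f)) (s : ρ → κ),
      M.submatrix id s = 1 ∧ mapSpan (algebraMap R (Localization.Away f)) I = rowSpan M}
  have hp (f : t) : Module.Projective (Localization.Away f.1) ((κ → Localization.Away f.1) ⧸
      I.localized' (Localization.Away f.1) (Submonoid.powers f.1) (piLocalization κ f.1)) := by
    obtain ⟨f, M, s, hs, hI⟩ := f
    have : I.localized' (Localization.Away f) (Submonoid.powers f) (piLocalization κ f) =
      rowSpan M := (localized'_piLocalization f I).trans hI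
    change Module.Projective _ (_ ⧸ I.localized' (Localization.Away f) (Submonoid.powers f)
      (piLocalization κ f))
    rw [this]
    exact projective_quotient_rowSpan hs
  have hfin : Module.FinitePresentation R ((κ → R) ⧸ I) :=
    Module.FinitePresentation.of_localizationSpan' t h.span_eq_top
      (Rₚ := fun f => Localization.Away f.1)
      (fun f => I.toLocalizedQuotient' (Localization.Away f.1) (Submonoid.powers f.1)
        (piLocalization κ f.1)) fun f => by
          have := hp f
          exact Module.finitePresentation_of_projective _ _
  have hflat : Module.Flat R ((κ → R) ⧸ I) := by
    refine Module.flat_of_isLocalized_span (S := R) _ t h.span_eq_top _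
      (fun f => I.toLocalizedQuotient' (Localization.Away f.1) (Submonoid.powers f.1)
        (piLocalization κ f.1)) fun f => ?_
    have := hp f
    have : Module.Flat R (Localization.Away f.1) := IsLocalization.flat _ (Submonoid.powers f.1)
    exact Module.Flat.trans R (Localization.Away f.1) _
  exact Module.Flat.projective_of_finitePresentation

lemma exists_isCompl_of_projective_quotient {M : Type*} [AddCommGroup M] [Module R M]
    (I : Submodule R M) [Module.Projective R (M ⧸ I)] :
    ∃ π : M →ₗ[R] I, ∀ v : I, π v = v := by
  obtain ⟨g, hg⟩ := Module.projective_lifting_property I.mkQ LinearMap.id I.mkQ_surjective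
  have h (v : M) : (LinearMap.id - g ∘ₗ I.mkQ : M →ₗ[R] M) v ∈ I := by
    rw [← Submodule.Quotient.mk_eq_zero, LinearMap.sub_apply, Submodule.Quotient.mk_sub,
      sub_eq_zero]
    exact (DFunLike.congr_fun hg (I.mkQ v)).symm
  refine ⟨(LinearMap.id - g ∘ₗ I.mkQ : M →ₗ[R] M).codRestrict I h, fun v => ?_⟩
  ext
  simp [(Submodule.Quotient.mk_eq_zero I).2 v.2]

lemma projective_of_projective_quotient {M : Type*} [AddCommGroup M] [Module R M]
    [Module.Projective R M] (I : Submodule R M) [Module.Projective R (M ⧸ I)] :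
    Module.Projective R I := by
  obtain ⟨π, hπ⟩ := exists_isCompl_of_projective_quotient I
  exact Module.Projective.of_split I.subtype π (LinearMap.ext hπ)

lemma finite_of_projective_quotient {M : Type*} [AddCommGroup M] [Module R M]
    [Module.Finite R M] (I : Submodule R M) [Module.Projective R (M ⧸ I)] :
    Module.Finite R I := by
  obtain ⟨π, hπ⟩ := exists_isCompl_of_projective_quotient I
  exact Module.Finite.of_surjective π fun v => ⟨v, hπ v⟩

lemma exists_isPrime_comap_away {f : R} (p : PrimeSpectrum R) (hf : f ∉ p.asIdeal) :
    ∃ q : PrimeSpectrum (Localization.Away f), q.comap (algebraMap R (Localization.Away f)) = p := by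
  have := PrimeSpectrum.localization_away_comap_range (Localization.Away f) f
  exact this.ge hf

lemma IsLocallyRowSpan.rankAtStalk_eq {I : Submodule R (κ → R)} (h : IsLocallyRowSpan ρ I)
    (p : PrimeSpectrum R) : Module.rankAtStalk (R := R) I p = Fintype.card ρ := by
  have := h.projective_quotient
  have := projective_of_projective_quotient I
  have := finite_of_projective_quotient I
  obtain ⟨f, hf, M, s, hs, hI⟩ := h p
  obtain ⟨q, hq⟩ := exists_isPrime_comap_away p hf
  have h1 := Module.rankAtStalk_isBaseChange (IsLocalizedModule.isBaseChange (Submonoid.powers f)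
    (Localization.Away f) (I.toLocalized' (Localization.Away f) (Submonoid.powers f)
      (piLocalization κ f))) q
  rw [hq] at h1
  rw [← h1]
  have : Nontrivial (Localization.Away f) := PrimeSpectrum.nontrivial q
  let e := (rowSpanEquiv hs).trans
    (LinearEquiv.ofEq _ _ (hI.symm.trans (localized'_piLocalization f I).symm))
  rw [← Module.rankAtStalk_eq_of_equiv e, Module.rankAtStalk_eq_finrank_of_free]
  simp

/-- A determinant of a product is a linear combination of maximal minors. -/
lemma exists_isUnit_of_mul_eq_one {M : Matrix ρ κ R} {B : Matrix κ ρ R} (h : M * B = 1)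
    (P : Ideal R) [P.IsPrime] : ∃ s, minors M s ∉ P := by
  by_contra! hc
  -- Cauchy–Binet, expanded multilinearly over all functions `s`; those that are not injective
  -- contribute zero.
  have h1 : (M * B).det = ∑ s : ρ → κ, (∏ a, B (s a) a) * minors M s := by
    have h2 : (M * B)ᵀ = fun a => ∑ j, B j a • Mᵀ j := by
      ext a b
      simp [Matrix.mul_apply, mul_comm]
    rw [← det_transpose, h2]
    have := (detRowAlternating (R := R) (n := ρ)).toMultilinearMap.map_sum
      (fun a j => B j a • Mᵀ j)
    refine this.trans (Finset.sum_congr rfl fun s _ => ?_)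
    refine ((detRowAlternating (R := R) (n := ρ)).toMultilinearMap.map_smul_univ
      (fun a => B (s a) a) (fun a => Mᵀ (s a))).trans ?_
    rw [smul_eq_mul, minors, ← det_transpose]
    rfl
  rw [h, det_one] at h1
  exact (Ideal.ne_top_iff_one P).1 ‹P.IsPrime›.ne_top
    (h1 ▸ Ideal.sum_mem _ fun s _ => P.mul_mem_left _ (hc s))

/-- Near `p` the module is free, and a basis gives the rows of `M`. A projection onto it gives a
right inverse of `M`, so some maximal minor is nonzero at `p`; inverting that minor normalizes its
block to the identity. -/
lemma isLocallyRowSpan_of_rankAtStalk {I : Submodule R (κ → R)}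
    (hI : Module.Projective R ((κ → R) ⧸ I))
    (hr : ∀ p, Module.rankAtStalk (R := R) I p = Fintype.card ρ) : IsLocallyRowSpan ρ I := by
  intro p
  have := projective_of_projective_quotient I
  have := finite_of_projective_quotient I
  obtain ⟨a, ha, hfree⟩ := Module.Free.away_of_finite_of_flat_of_rankAtStalk_constant I p.asIdeal
    (fun m hm => (hr _).trans (hr _).symm)
  obtain ⟨q, hq⟩ := exists_isPrime_comap_away p ha
  have : Nontrivial (Localization.Away a) := PrimeSpectrum.nontrivial q
  let J := I.localized' (Localization.Away a) (Submonoid.powers a) (piLocalization κ a)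
  have hJ : J = mapSpan (algebraMap R (Localization.Away a)) I := localized'_piLocalization a I
  let e : LocalizedModule.Away a I ≃ₗ[Localization.Away a] J :=
    (IsLocalizedModule.linearEquiv (Submonoid.powers a)
      (LocalizedModule.mkLinearMap (Submonoid.powers a) I)
      (I.toLocalized' (Localization.Away a) (Submonoid.powers a)
        (piLocalization κ a))).extendScalarsOfIsLocalization (Submonoid.powers a) _
  have : Module.Free (Localization.Away a) J := Module.Free.of_equiv e
  have : Module.Finite (Localization.Away a) J := Module.Finite.equiv e
  have h1 := Module.rankAtStalk_isBaseChange (IsLocalizedModule.isBaseChange (Submonoid.powers a)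
    (Localization.Away a) (I.toLocalized' (Localization.Away a) (Submonoid.powers a)
      (piLocalization κ a))) q
  have h2 : Module.finrank (Localization.Away a) J = Fintype.card ρ := by
    rw [← hr p, ← hq, ← h1, Module.rankAtStalk_eq_finrank_of_free]
    rfl
  let b : Module.Basis ρ (Localization.Away a) J :=
    (Module.finBasis (Localization.Away a) J).reindex
      (Fintype.equivOfCardEq (by rw [Fintype.card_fin, h2]))
  have hproj : Module.Projective (Localization.Away a) ((κ → Localization.Away a) ⧸ J) :=
    Module.projective_of_isLocalizedModule (Submonoid.powers a)
      (I.toLocalizedQuotient' (Localization.Away a) (Submonoid.powers a) (piLocalization κ a))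
  obtain ⟨π, hπ⟩ := exists_isCompl_of_projective_quotient J
  let M : Matrix ρ κ (Localization.Away a) := Matrix.of fun i => (b i : κ → Localization.Away a)
  let B : Matrix κ ρ (Localization.Away a) := Matrix.of fun j i => b.repr (π (Pi.single j 1)) i
  have hB (v : κ → Localization.Away a) (i : ρ) : b.repr (π v) i = ∑ j, v j * B j i := by
    conv_lhs => rw [pi_eq_sum_univ' v]
    simp [B, map_sum]
  have hMB : M * B = 1 := by
    ext i k
    rw [Matrix.mul_apply]
    refine (hB (b i) k).symm.trans ?_
    rw [hπ, b.repr_self, Finsupp.single_apply, Matrix.one_apply]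
  have hM : rowSpan M = J := by
    refine le_antisymm (rowSpan_le.2 fun i => (b i).2) fun v hv => ?_
    refine ⟨fun i => b.repr ⟨v, hv⟩ i, ?_⟩
    have := congrArg Subtype.val (b.sum_repr ⟨v, hv⟩)
    rw [Submodule.coe_sum] at this
    rw [vecMulLinear_apply, Matrix.vecMul_eq_sum]
    exact this
  obtain ⟨s, hs⟩ := exists_isUnit_of_mul_eq_one hMB q.asIdeal
  -- The minor is `g / a ^ n`, so it becomes a unit once `a * g` is inverted.
  obtain ⟨n, g, hg⟩ := IsLocalization.Away.surj a (minors M s)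
  have hgp : g ∉ p.asIdeal := by
    rw [← hq]
    intro hc
    change algebraMap R _ g ∈ q.asIdeal at hc
    rw [← hg] at hc
    exact hs ((q.2.mul_mem_iff_mem_or_mem.1 hc).resolve_right fun h =>
      q.2.ne_top (Ideal.eq_top_of_isUnit_mem _ h
        ((IsLocalization.Away.algebraMap_isUnit a).pow n)))
  have hag : a * g ∉ p.asIdeal := fun hc => (p.2.mul_mem_iff_mem_or_mem.1 hc).elim ha hgp
  have hu := IsLocalization.Away.algebraMap_isUnit (S := Localization.Away (a * g)) (a * g)
  rw [map_mul] at hu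
  let φ : Localization.Away a →+* Localization.Away (a * g) :=
    IsLocalization.Away.lift a (isUnit_of_mul_isUnit_left hu)
  have hφ (r : R) : φ (algebraMap R _ r) = algebraMap R _ r := IsLocalization.Away.lift_eq a _ r
  have hφs : IsUnit (φ (minors M s)) := by
    have := congrArg φ hg
    rw [map_mul, hφ] at this
    exact isUnit_of_mul_isUnit_left (this ▸ isUnit_of_mul_isUnit_right hu)
  have hdet : IsUnit ((M.map φ).submatrix id s) := by
    rw [Matrix.isUnit_iff_isUnit_det]
    change IsUnit (minors (M.map φ) s)
    rw [minors_map]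
    exact hφs
  obtain ⟨C, hC⟩ := hdet
  refine ⟨a * g, hag, (↑C⁻¹ : Matrix ρ ρ (Localization.Away (a * g))) * M.map φ, s, ?_, ?_⟩
  · change (↑C⁻¹ : Matrix ρ ρ (Localization.Away (a * g))) * (M.map φ).submatrix id s = 1
    rw [← hC, Units.inv_mul]
  · rw [rowSpan_unit_mul C⁻¹.isUnit, ← mapSpan_rowSpan, hM, hJ, mapSpan_mapSpan]
    congr 1
    ext r
    exact (hφ r).symm

lemma isLocallyRowSpan_iff {I : Submodule R (κ → R)} : IsLocallyRowSpan ρ I ↔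
    Module.Projective R ((κ → R) ⧸ I) ∧ ∀ p, Module.rankAtStalk (R := R) I p = Fintype.card ρ :=
  ⟨fun h => ⟨h.projective_quotient, h.rankAtStalk_eq⟩,
    fun h => isLocallyRowSpan_of_rankAtStalk h.1 h.2⟩

end LocalRowSpan

/-! ### Families of submodules packed into one submodule of a direct sum -/

section Families

open Matrix

set_option linter.unusedSectionVars false

variable {ι : Type} [Fintype ι] [DecidableEq ι] {c r : ι → ℕ}
variable {F : Type u} [Field F] {R S : Type u} [CommRing R] [Algebra F R] [CommRing S] [Algebra F S]

/-- The projection onto one block of coordinates. -/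
def blockProj (R : Type u) [CommRing R] (c : ι → ℕ) (i : ι) : ((Σ i, Fin (c i)) → R) →ₗ[R] (Fin (c i) → R) :=
  LinearMap.funLeft R R fun a => ⟨i, a⟩

/-- The inclusion of one block of coordinates. -/
def blockIncl (R : Type u) [CommRing R] (c : ι → ℕ) (i : ι) : (Fin (c i) → R) →ₗ[R] ((Σ i, Fin (c i)) → R) where
  toFun v x := if h : x.1 = i then v (h ▸ x.2) else 0
  map_add' v w := by ext x; by_cases h : x.1 = i <;> simp [h]
  map_smul' a v := by ext x; by_cases h : x.1 = i <;> simp [h]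

lemma blockProj_apply (i : ι) (v : (Σ i, Fin (c i)) → R) (a : Fin (c i)) :
    blockProj R c i v a = v ⟨i, a⟩ := rfl

lemma blockIncl_apply_self (i : ι) (v : Fin (c i) → R) (a : Fin (c i)) :
    blockIncl R c i v ⟨i, a⟩ = v a := by
  simp [blockIncl]

lemma blockIncl_apply_of_ne {i j : ι} (h : j ≠ i) (v : Fin (c i) → R) (a : Fin (c j)) :
    blockIncl R c i v ⟨j, a⟩ = 0 := by
  simp [blockIncl, h]

lemma blockProj_blockIncl (i : ι) (v : Fin (c i) → R) : blockProj R c i (blockIncl R c i v) = v :=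
  funext fun a => blockIncl_apply_self i v a

lemma blockProj_blockIncl_of_ne {i j : ι} (h : j ≠ i) (v : Fin (c i) → R) :
    blockProj R c j (blockIncl R c i v) = 0 :=
  funext fun a => blockIncl_apply_of_ne h v a

lemma sum_blockIncl_blockProj (v : (Σ i, Fin (c i)) → R) :
    ∑ i, blockIncl R c i (blockProj R c i v) = v := by
  ext ⟨j, a⟩
  rw [Finset.sum_apply, Finset.sum_eq_single j (fun i _ h => blockIncl_apply_of_ne h.symm _ _)
    (by simp), blockIncl_apply_self]
  rfl

lemma comp_blockIncl (f : R →+* S) (i : ι) (v : Fin (c i) → R) :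
    f ∘ blockIncl R c i v = blockIncl S c i (f ∘ v) := by
  ext ⟨j, a⟩
  by_cases h : j = i
  · subst h
    simp only [Function.comp_apply, blockIncl_apply_self]
  · simp only [Function.comp_apply, blockIncl_apply_of_ne h, map_zero]

/-- The matrix acting as `T` from block `i` to block `j`, and as zero on the other blocks. -/
def blockMatrix {i j : ι} (T : Matrix (Fin (c i)) (Fin (c j)) R) :
    Matrix (Σ i, Fin (c i)) (Σ i, Fin (c i)) R :=
  LinearMap.toMatrix' (blockIncl R c j ∘ₗ T.vecMulLinear ∘ₗ blockProj R c i) |>.transpose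

lemma vecMul_blockMatrix {i j : ι} (T : Matrix (Fin (c i)) (Fin (c j)) R)
    (v : (Σ i, Fin (c i)) → R) :
    v ᵥ* blockMatrix T = blockIncl R c j (blockProj R c i v ᵥ* T) := by
  rw [blockMatrix, vecMul_transpose, LinearMap.toMatrix'_mulVec]
  rfl

lemma map_blockMatrix (f : R →+* S) {i j : ι} (T : Matrix (Fin (c i)) (Fin (c j)) R) :
    (blockMatrix T).map f = blockMatrix (T.map f) := by
  have h (v : (Σ i, Fin (c i)) → R) :
      (f ∘ v) ᵥ* (blockMatrix T).map f = (f ∘ v) ᵥ* blockMatrix (T.map f) := by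
    rw [← map_vecMul, vecMul_blockMatrix, vecMul_blockMatrix, comp_blockIncl, map_vecMul]
    rfl
  ext x y
  have := congrFun (h (Pi.single x 1)) y
  have e : f ∘ Pi.single x (1 : R) = Pi.single x (1 : S) := by
    ext z
    simp [Pi.single_apply, apply_ite f]
  simpa [e] using this

variable (𝒯 : ∀ i j, Set (Matrix (Fin (c i)) (Fin (c j)) F))

variable (r) in
/-- Families of submodules with projective quotients and of constant ranks, stable under
prescribed matrices. -/
structure IsStableFamily (I : ∀ i, Submodule R (Fin (c i) → R)) : Prop where
  projective : ∀ i, Module.Projective R ((Fin (c i) → R) ⧸ I i)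
  rank_eq : ∀ i p, Module.rankAtStalk (R := R) (I i) p = r i
  stable : ∀ i j, ∀ T ∈ 𝒯 i j, ∀ v ∈ I i, v ᵥ* T.map (algebraMap F R) ∈ I j

/-- The block matrices attached to a family of sets of matrices. -/
def blockMatrices : Set (Matrix (Σ i, Fin (c i)) (Σ i, Fin (c i)) F) :=
  {X | ∃ i j, ∃ T ∈ 𝒯 i j, X = blockMatrix T}

variable (c r) in
/-- The choices of columns which do not contain the right number of columns from each block. -/
def badColumns : Set ((Σ i, Fin (r i)) → Σ i, Fin (c i)) :=
  {s | ∀ σ : Equiv.Perm (Σ i, Fin (r i)), ∃ a, (σ a).1 ≠ (s a).1}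

/-- The submodule of vectors all of whose blocks lie in the given submodules. -/
def totalSubmodule (I : ∀ i, Submodule R (Fin (c i) → R)) :
    Submodule R ((Σ i, Fin (c i)) → R) :=
  ⨅ i, (I i).comap (blockProj R c i)

lemma mem_totalSubmodule {I : ∀ i, Submodule R (Fin (c i) → R)} {v : (Σ i, Fin (c i)) → R} :
    v ∈ totalSubmodule I ↔ ∀ i, blockProj R c i v ∈ I i := by
  simp [totalSubmodule, Submodule.mem_iInf]

lemma blockIncl_mem_totalSubmodule {I : ∀ i, Submodule R (Fin (c i) → R)} {i : ι}
    {v : Fin (c i) → R} (hv : v ∈ I i) : blockIncl R c i v ∈ totalSubmodule I := by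
  rw [mem_totalSubmodule]
  intro j
  by_cases h : j = i
  · subst h
    rwa [blockProj_blockIncl]
  · rw [blockProj_blockIncl_of_ne h]
    exact zero_mem _

lemma map_totalSubmodule (I : ∀ i, Submodule R (Fin (c i) → R)) (i : ι) :
    (totalSubmodule I).map (blockProj R c i) = I i := by
  refine le_antisymm ?_ fun v hv => ?_
  · rintro _ ⟨v, hv, rfl⟩
    exact mem_totalSubmodule.1 hv i
  · exact ⟨_, blockIncl_mem_totalSubmodule hv, blockProj_blockIncl i v⟩

lemma mapSpan_map_blockProj (f : R →+* S) (J : Submodule R ((Σ i, Fin (c i)) → R)) (i : ι) :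
    mapSpan f (J.map (blockProj R c i)) = (mapSpan f J).map (blockProj S c i) := by
  rw [mapSpan, mapSpan, Submodule.map_span]
  congr 1
  ext v
  constructor
  · rintro ⟨_, ⟨w, hw, rfl⟩, rfl⟩
    exact ⟨_, ⟨w, hw, rfl⟩, rfl⟩
  · rintro ⟨_, ⟨w, hw, rfl⟩, rfl⟩
    exact ⟨_, ⟨w, hw, rfl⟩, rfl⟩

lemma mapSpan_stable {κ : Type} [Fintype κ] [DecidableEq κ] (f : R →+* S) {T : Matrix κ κ R}
    {I : Submodule R (κ → R)} (h : ∀ v ∈ I, v ᵥ* T ∈ I) :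
    ∀ v ∈ mapSpan f I, v ᵥ* T.map f ∈ mapSpan f I := by
  have : mapSpan f I ≤ (mapSpan f I).comap (T.map f).vecMulLinear := by
    refine mapSpan_le.2 fun v hv => ?_
    rw [Submodule.mem_comap, vecMulLinear_apply, ← map_vecMul]
    exact mem_mapSpan f (h v hv)
  exact this

lemma vecMul_mem_rowSpan {κ ρ : Type} [Fintype κ] [DecidableEq κ] [Fintype ρ] [DecidableEq ρ]
    {M : Matrix ρ κ R} {T : Matrix κ κ R} {C : Matrix ρ ρ R} (h : M * T = C * M) {v : κ → R}
    (hv : v ∈ rowSpan M) : v ᵥ* T ∈ rowSpan M := by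
  obtain ⟨a, rfl⟩ := hv
  refine ⟨a ᵥ* C, ?_⟩
  rw [vecMulLinear_apply, vecMulLinear_apply, vecMul_vecMul, vecMul_vecMul, h]

lemma exists_mul_eq_of_vecMul_mem {κ ρ : Type} [Fintype κ] [DecidableEq κ] [Fintype ρ]
    [DecidableEq ρ] {M : Matrix ρ κ R} {T : Matrix κ κ R}
    (h : ∀ v ∈ rowSpan M, v ᵥ* T ∈ rowSpan M) : ∃ C : Matrix ρ ρ R, M * T = C * M := by
  refine rowSpan_le_rowSpan.1 (rowSpan_le.2 fun a => ?_)
  exact h _ (row_mem_rowSpan M a)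

variable {𝒯}

lemma IsStableFamily.vecMul_mem {I : ∀ i, Submodule R (Fin (c i) → R)}
    (h : IsStableFamily r 𝒯 I) {X : Matrix (Σ i, Fin (c i)) (Σ i, Fin (c i)) F}
    (hX : X ∈ blockMatrices 𝒯) {v : (Σ i, Fin (c i)) → R} (hv : v ∈ totalSubmodule I) :
    v ᵥ* X.map (algebraMap F R) ∈ totalSubmodule I := by
  obtain ⟨i, j, T, hT, rfl⟩ := hX
  rw [map_blockMatrix, vecMul_blockMatrix]
  exact blockIncl_mem_totalSubmodule (h.stable i j T hT _ (mem_totalSubmodule.1 hv i))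

/-- For a bad choice of columns every term of the Leibniz formula contains an entry outside the
diagonal blocks. -/
lemma minors_blockDiagonal'_eq_zero (M : ∀ i, Matrix (Fin (r i)) (Fin (c i)) R)
    {s : (Σ i, Fin (r i)) → Σ i, Fin (c i)} (hs : s ∈ badColumns c r) :
    minors (blockDiagonal' M) s = 0 := by
  rw [minors, det_apply]
  refine Finset.sum_eq_zero fun σ _ => ?_
  obtain ⟨a, ha⟩ := hs σ
  rw [Finset.prod_eq_zero (Finset.mem_univ a), smul_zero]
  rw [submatrix_apply, id, blockDiagonal'_apply, dif_neg ha]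

lemma blockDiagonal'_row (M : ∀ i, Matrix (Fin (r i)) (Fin (c i)) R) (i : ι) (a : Fin (r i)) :
    blockDiagonal' M ⟨i, a⟩ = blockIncl R c i (M i a) := by
  ext ⟨j, b⟩
  by_cases h : j = i
  · subst h
    rw [blockDiagonal'_apply_eq, blockIncl_apply_self]
  · rw [blockDiagonal'_apply_ne _ _ _ (Ne.symm h), blockIncl_apply_of_ne h]

lemma mapSpan_totalSubmodule (f : R →+* S) (I : ∀ i, Submodule R (Fin (c i) → R))
    {M : ∀ i, Matrix (Fin (r i)) (Fin (c i)) S} (h : ∀ i, mapSpan f (I i) = rowSpan (M i)) :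
    mapSpan f (totalSubmodule I) = rowSpan (blockDiagonal' M) := by
  refine le_antisymm (mapSpan_le.2 fun v hv => ?_) (rowSpan_le.2 ?_)
  · have h1 (i : ι) : rowSpan (M i) ≤ (rowSpan (blockDiagonal' M)).comap (blockIncl S c i) := by
      rw [rowSpan_le]
      intro a
      rw [Submodule.mem_comap, ← blockDiagonal'_row]
      exact row_mem_rowSpan _ _
    rw [← sum_blockIncl_blockProj (f ∘ v)]
    refine Submodule.sum_mem _ fun i _ => h1 i ?_
    rw [← h]
    exact mem_mapSpan f (mem_totalSubmodule.1 hv i)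
  · rintro ⟨i, a⟩
    have h1 : mapSpan f (I i) ≤ (mapSpan f (totalSubmodule I)).comap (blockIncl S c i) := by
      refine mapSpan_le.2 fun v hv => ?_
      rw [Submodule.mem_comap, ← comp_blockIncl]
      exact mem_mapSpan f (blockIncl_mem_totalSubmodule hv)
    rw [blockDiagonal'_row]
    refine h1 ?_
    rw [h]
    exact row_mem_rowSpan _ _

lemma blockDiagonal'_submatrix_eq_one {M : ∀ i, Matrix (Fin (r i)) (Fin (c i)) R}
    {s : ∀ i, Fin (r i) → Fin (c i)} (h : ∀ i, (M i).submatrix id (s i) = 1) :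
    (blockDiagonal' M).submatrix id (fun x : Σ i, Fin (r i) => (⟨x.1, s x.1 x.2⟩ : Σ i, Fin (c i))) = 1 := by
  ext ⟨i, a⟩ ⟨j, b⟩
  rw [submatrix_apply, id]
  by_cases hij : i = j
  · subst hij
    rw [blockDiagonal'_apply_eq]
    refine (congrFun (congrFun (h i) a) b).trans ?_
    simp [Matrix.one_apply]
  · rw [blockDiagonal'_apply_ne _ _ _ hij, Matrix.one_apply_ne]
    intro h
    exact hij (congrArg Sigma.fst h)

lemma IsStableFamily.isLocallyAdmissible {I : ∀ i, Submodule R (Fin (c i) → R)}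
    (h : IsStableFamily r 𝒯 I) :
    IsLocallyAdmissible (blockMatrices 𝒯) (badColumns c r) (totalSubmodule I) := by
  intro p
  have hloc (i : ι) : IsLocallyRowSpan (Fin (r i)) (I i) :=
    isLocallyRowSpan_iff.2 ⟨h.projective i, fun p => by rw [h.rank_eq, Fintype.card_fin]⟩
  choose f hf M s hs hI using fun i => hloc i p
  -- The product of the denominators of the members of the family trivializes them all at once.
  obtain ⟨P, hPp, hP⟩ : ∃ P ∉ p.asIdeal, ∀ i, f i ∣ P := by
    refine ⟨∏ i, f i, ?_, fun i => Finset.dvd_prod_of_mem f (Finset.mem_univ i)⟩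
    rw [p.2.prod_mem_iff]
    rintro ⟨i, _, hi⟩
    exact hf i hi
  have hu (i : ι) : IsUnit (awayHom F P (f i)) :=
    isUnit_of_dvd_unit (map_dvd _ (hP i)) (IsLocalization.Away.algebraMap_isUnit P)
  choose g hg using fun i => exists_away_lift (awayHom F P) (hu i)
  have hg' (i : ι) : (g i : Localization.Away (f i) →+* Localization.Away P).comp
      (algebraMap R (Localization.Away (f i))) = algebraMap R (Localization.Away P) :=
    RingHom.ext fun x => DFunLike.congr_fun (hg i) x
  let M' : ∀ i, Matrix (Fin (r i)) (Fin (c i)) (Localization.Away P) := fun i =>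
    (M i).map (g i : Localization.Away (f i) →+* Localization.Away P)
  have hM : mapSpan (algebraMap R (Localization.Away P)) (totalSubmodule I) =
      rowSpan (blockDiagonal' M') := by
    refine mapSpan_totalSubmodule _ I fun i => ?_
    rw [← mapSpan_rowSpan, ← hI, mapSpan_mapSpan, hg']
  refine ⟨P, hPp, blockDiagonal' M', _,
    blockDiagonal'_submatrix_eq_one fun i => map_submatrix_eq_one _ (hs i), ⟨?_, ?_⟩, hM⟩
  · intro X hX
    refine exists_mul_eq_of_vecMul_mem ?_
    rw [← hM]
    have := mapSpan_stable (algebraMap R (Localization.Away P))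
      (fun v hv => h.vecMul_mem hX hv)
    rw [Matrix.map_map] at this
    exact this
  · intro t ht
    exact minors_blockDiagonal'_eq_zero _ ht

lemma IsLocallyAdmissible.vecMul_mem {κ ρ : Type} [Fintype κ] [DecidableEq κ] [Fintype ρ]
    [DecidableEq ρ] {𝒯 : Set (Matrix κ κ F)} {bad : Set (ρ → κ)} {J : Submodule R (κ → R)}
    (h : IsLocallyAdmissible 𝒯 bad J) {X : Matrix κ κ F} (hX : X ∈ 𝒯) {v : κ → R} (hv : v ∈ J) :
    v ᵥ* X.map (algebraMap F R) ∈ J := by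
  have key : J.map (X.map (algebraMap F R)).vecMulLinear ≤ J := by
    choose f hf M s hs hM hI using h
    refine le_of_local f (span_range_eq_top_of_forall_prime hf) fun p => mapSpan_le.2 ?_
    rintro _ ⟨w, hw, rfl⟩
    obtain ⟨C, hC⟩ := (hM p).stable X hX
    rw [vecMulLinear_apply, map_vecMul, hI, Matrix.map_map]
    refine vecMul_mem_rowSpan hC ?_
    rw [← hI]
    exact mem_mapSpan _ hw
  exact key ⟨v, hv, rfl⟩

section

variable (h1 : ∀ i, (1 : Matrix (Fin (c i)) (Fin (c i)) F) ∈ 𝒯 i i)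
  {J : Submodule R ((Σ i, Fin (c i)) → R)}
  (hJ : IsLocallyAdmissible (blockMatrices 𝒯) (badColumns c r) J)
include h1 hJ

/-- The block matrix of the identity of block `i` is the projector onto that block, so `J` is stable
under it and is the direct sum of its blocks. -/
lemma IsLocallyAdmissible.blockIncl_blockProj_mem (i : ι) {v : (Σ i, Fin (c i)) → R}
    (hv : v ∈ J) : blockIncl R c i (blockProj R c i v) ∈ J := by
  have := hJ.vecMul_mem ⟨i, i, 1, h1 i, rfl⟩ hv
  rwa [map_blockMatrix, vecMul_blockMatrix, Matrix.map_one _ (map_zero _) (map_one _),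
    vecMul_one] at this

lemma IsLocallyAdmissible.mem_map_blockProj {i : ι} {v : Fin (c i) → R} :
    v ∈ J.map (blockProj R c i) ↔ blockIncl R c i v ∈ J := by
  constructor
  · rintro ⟨w, hw, rfl⟩
    exact hJ.blockIncl_blockProj_mem h1 i hw
  · intro h
    exact ⟨_, h, blockProj_blockIncl i v⟩

lemma IsLocallyAdmissible.totalSubmodule_map :
    totalSubmodule (fun i => J.map (blockProj R c i)) = J := by
  ext v
  rw [mem_totalSubmodule]
  constructor
  · intro h
    rw [← sum_blockIncl_blockProj v]
    exact Submodule.sum_mem _ fun i _ => (hJ.mem_map_blockProj h1).1 (h i)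
  · intro h i
    exact ⟨v, h, rfl⟩

/-- The vanishing of the bad coordinates controls the individual ranks: exactly `r i` pivot columns
lie in block `i`. The rows with these pivots span the projection to block `i`, and the other rows
project to zero. -/
lemma IsLocallyAdmissible.isLocallyRowSpan_map (i : ι) :
    IsLocallyRowSpan (Fin (r i)) (J.map (blockProj R c i)) := by
  intro p
  obtain ⟨f, hf, M, s, hs, hM, hI⟩ := hJ p
  obtain ⟨q, hq⟩ := exists_isPrime_comap_away p hf
  have : Nontrivial (Localization.Away f) := PrimeSpectrum.nontrivial q
  have hgood : s ∉ badColumns c r := by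
    intro hb
    have := hM.vanish s hb
    rw [minors_of_submatrix_eq_one hs] at this
    exact one_ne_zero this
  -- Since the minor at `s` is `1 ≠ 0`, the choice `s` is not bad; `σ` relabels the rows so that
  -- each pivot lies in the block of its label.
  simp only [badColumns, Set.mem_ofPred_eq, not_forall, not_exists, not_not] at hgood
  obtain ⟨σ, hσ⟩ := hgood
  have hex (x : Fin (r i)) : ∃ y, s (σ.symm ⟨i, x⟩) = ⟨i, y⟩ := by
    have := hσ (σ.symm ⟨i, x⟩)
    rw [σ.apply_symm_apply] at this
    rcases h : s (σ.symm ⟨i, x⟩) with ⟨j, y⟩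
    rw [h] at this
    dsimp only at this
    subst this
    exact ⟨y, rfl⟩
  choose t ht using hex
  let M' : Matrix (Fin (r i)) (Fin (c i)) (Localization.Away f) :=
    Matrix.of fun x y => M (σ.symm ⟨i, x⟩) ⟨i, y⟩
  have hrow (x) : M' x = blockProj _ c i (M (σ.symm ⟨i, x⟩)) := rfl
  refine ⟨f, hf, M', t, ?_, ?_⟩
  · ext x y
    change M (σ.symm ⟨i, x⟩) ⟨i, t y⟩ = _
    rw [← ht y]
    refine (congrFun (congrFun hs _) _).trans ?_
    simp [Matrix.one_apply]
  · rw [mapSpan_map_blockProj, hI]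
    refine le_antisymm ?_ (rowSpan_le.2 fun x => ⟨_, row_mem_rowSpan _ _, (hrow x).symm⟩)
    rw [Submodule.map_le_iff_le_comap, rowSpan_le]
    intro a
    rw [Submodule.mem_comap]
    by_cases ha : (σ a).1 = i
    · rcases hσa : σ a with ⟨j, x⟩
      rw [hσa] at ha
      dsimp only at ha
      subst ha
      rw [show a = σ.symm ⟨j, x⟩ by rw [← hσa, σ.symm_apply_apply]]
      exact row_mem_rowSpan M' x
    · have h2 : blockIncl _ c i (blockProj _ c i (M a)) ∈ rowSpan M := by
        obtain ⟨C, hC⟩ := hM.stable _ ⟨i, i, 1, h1 i, rfl⟩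
        have := vecMul_mem_rowSpan hC (row_mem_rowSpan M a)
        rwa [map_blockMatrix, vecMul_blockMatrix, Matrix.map_one _ (map_zero _) (map_one _),
          vecMul_one] at this
      rw [mem_rowSpan_of_submatrix_eq_one hs] at h2
      -- The row `a` has its pivot outside block `i`, so its part in block `i` vanishes at every
      -- pivot. As that part lies in the row span, it is zero.
      have h3 : blockIncl _ c i (blockProj _ c i (M a)) ∘ s = 0 := by
        ext b
        rw [Function.comp_apply]
        rcases hb : s b with ⟨j, y⟩
        by_cases hj : j = i
        · subst hj
          rw [blockIncl_apply_self, blockProj_apply, ← hb]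
          refine (congrFun (congrFun hs a) b).trans (Matrix.one_apply_ne ?_)
          rintro rfl
          rw [hσ a, hb] at ha
          exact ha rfl
        · rw [blockIncl_apply_of_ne hj]
          rfl
      rw [h3, zero_vecMul] at h2
      rw [← blockProj_blockIncl i (blockProj _ c i (M a)), ← h2, map_zero]
      exact zero_mem _

lemma IsLocallyAdmissible.isStableFamily :
    IsStableFamily r 𝒯 (fun i => J.map (blockProj R c i)) where
  projective i := (hJ.isLocallyRowSpan_map h1 i).projective_quotient
  rank_eq i p := by rw [(hJ.isLocallyRowSpan_map h1 i).rankAtStalk_eq, Fintype.card_fin]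
  stable i j T hT v hv := by
    rw [hJ.mem_map_blockProj h1] at hv ⊢
    have := hJ.vecMul_mem ⟨i, j, T, hT, rfl⟩ hv
    rwa [map_blockMatrix, vecMul_blockMatrix, blockProj_blockIncl] at this

end

/-- Stable families of submodules are represented by a closed subscheme of a projective space. -/
theorem exists_representation_family (hc : ∀ i, 0 < c i)
    (h1 : ∀ i, (1 : Matrix (Fin (c i)) (Fin (c i)) F) ∈ 𝒯 i i) :
    ∃ (Z : Over (Spec (.of F))) (N : ℕ) (j : Z ⟶ projectiveSpace F N), IsClosedImmersion j.left ∧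
      ∃ E : ∀ (R : Type u) [CommRing R] [Algebra F R],
        Points Z R ≃ {I : ∀ i, Submodule R (Fin (c i) → R) // IsStableFamily r 𝒯 I},
      ∀ (R S : Type u) [CommRing R] [Algebra F R] [CommRing S] [Algebra F S] (f : R →ₐ[F] S)
        (x : Points Z R) (i : ι),
          (E S (specOverMap f ≫ x)).1 i = mapSpan (f : R →+* S) ((E R x).1 i) := by
  have : Nonempty ((Σ i, Fin (r i)) → Σ i, Fin (c i)) := ⟨fun x => ⟨x.1, 0, hc x.1⟩⟩
  obtain ⟨Z, N, j, hj, E, hE⟩ := exists_representation (F := F) (blockMatrices 𝒯) (badColumns c r)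
  let E' (R : Type u) [CommRing R] [Algebra F R] :
      {J : Submodule R ((Σ i, Fin (c i)) → R) //
        IsLocallyAdmissible (blockMatrices 𝒯) (badColumns c r) J} ≃
      {I : ∀ i, Submodule R (Fin (c i) → R) // IsStableFamily r 𝒯 I} :=
    { toFun J := ⟨fun i => J.1.map (blockProj R c i), J.2.isStableFamily h1⟩
      invFun I := ⟨totalSubmodule I.1, I.2.isLocallyAdmissible⟩
      left_inv J := Subtype.ext (J.2.totalSubmodule_map h1)
      right_inv I := Subtype.ext (funext fun i => map_totalSubmodule I.1 i) }
  refine ⟨Z, N, j, hj, fun R _ _ => (E R).trans (E' R), fun R S _ _ _ _ f x i => ?_⟩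
  change ((E S (specOverMap f ≫ x)).1).map (blockProj S c i) = _
  rw [hE, ← mapSpan_map_blockProj]
  rfl

end Families

/-! ### Flags of right ideals as stable families -/

section Flags

open Matrix

set_option linter.unusedSectionVars false

variable {F : Type u} [Field F] {A : Type u} [Ring A] [Algebra F A] {c : ℕ}
  (b : Module.Basis (Fin c) F A)
variable {R S : Type u} [CommRing R] [Algebra F R] [CommRing S] [Algebra F S]

/-- The matrix of right multiplication, acting on row vectors. -/
def rightMulMatrix (x : A) : Matrix (Fin c) (Fin c) F :=
  Matrix.of fun i j => b.repr (b i * x) j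

variable (R) in
/-- Coordinates on the base change of an algebra. -/
def coordEquiv : (R ⊗[F] A) ≃ₗ[R] (Fin c → R) :=
  (b.baseChange R).equivFun

lemma coordEquiv_tmul (r : R) (a : A) (j : Fin c) :
    coordEquiv b R (r ⊗ₜ a) j = b.repr a j • r :=
  Module.Basis.baseChange_repr_tmul R b r a j

lemma coordEquiv_mul (x : A) (z : R ⊗[F] A) : coordEquiv b R (z * (1 ⊗ₜ x)) =
    coordEquiv b R z ᵥ* (rightMulMatrix b x).map (algebraMap F R) := by
  have : (coordEquiv b R).toLinearMap ∘ₗ LinearMap.mulRight R (1 ⊗ₜ[F] x) =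
      ((rightMulMatrix b x).map (algebraMap F R)).vecMulLinear ∘ₗ (coordEquiv b R).toLinearMap := by
    refine (b.baseChange R).ext fun i => ?_
    ext j
    have h : coordEquiv b R (b.baseChange R i) = Pi.single i 1 := by
      ext j
      simp [coordEquiv, Pi.single_apply, Finsupp.single_apply, eq_comm]
    rw [LinearMap.comp_apply, LinearMap.comp_apply, LinearEquiv.coe_coe, h, vecMulLinear_apply,
      single_one_vecMul, LinearMap.mulRight_apply, Module.Basis.baseChange_apply,
      Algebra.TensorProduct.tmul_mul_tmul, coordEquiv_tmul, mul_one, Algebra.smul_def, mul_one]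
    rfl
  exact DFunLike.congr_fun this z

lemma coordEquiv_map (f : R →ₐ[F] S) (z : R ⊗[F] A) :
    coordEquiv b S (Algebra.TensorProduct.map f (AlgHom.id F A) z) = f ∘ coordEquiv b R z := by
  induction z using TensorProduct.induction_on with
  | zero => ext; simp
  | tmul r a =>
    ext j
    rw [Algebra.TensorProduct.map_tmul, Function.comp_apply, coordEquiv_tmul, coordEquiv_tmul,
      map_smul]
    rfl
  | add x y hx hy =>
    rw [map_add, map_add, hx, hy, map_add]
    ext j
    simp

lemma mul_mem_of_forall_tmul {I : Submodule R (R ⊗[F] A)}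
    (h : ∀ x ∈ I, ∀ a : A, x * (1 ⊗ₜ a) ∈ I) {x : R ⊗[F] A} (hx : x ∈ I) (y : R ⊗[F] A) :
    x * y ∈ I := by
  induction y using TensorProduct.induction_on with
  | zero => rw [mul_zero]; exact zero_mem _
  | tmul r a =>
    have : r ⊗ₜ[F] a = r • ((1 : R) ⊗ₜ[F] a) := by rw [TensorProduct.smul_tmul', smul_eq_mul, mul_one]
    rw [this, mul_smul_comm]
    exact I.smul_mem _ (h x hx a)
  | add y z hy hz => rw [mul_add]; exact add_mem hy hz

variable {k : ℕ} (n : Fin k → ℕ)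

variable (k) in
/-- The matrices expressing that a family of submodules is a flag of right ideals. -/
def flagMatrices (i j : Fin k) : Set (Matrix (Fin c) (Fin c) F) :=
  -- Stability under right multiplications makes each member a right ideal. The identity from `i` to
  -- `j` encodes the inclusion for `i < j` and supplies the block projectors for `i = j`.
  {T | (i = j ∧ ∃ x, T = rightMulMatrix b x) ∨ (i ≤ j ∧ T = 1)}

@[ext]
lemma RightIdealFlag.ext' {n : Fin k → ℕ} {I J : RightIdealFlag (F := F) A n R}
    (h : ∀ i, I.ideal i = J.ideal i) : I = J := by
  cases I
  cases J
  congr 1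
  exact funext h

/-- Flags of right ideals in coordinates. -/
def flagEquiv : RightIdealFlag (F := F) A n R ≃
    {I : ∀ _ : Fin k, Submodule R (Fin c → R) //
      IsStableFamily (c := fun _ => c) (fun i => n i * degree F A) (flagMatrices b k) I} where
  toFun J := ⟨fun i => (J.ideal i).map (coordEquiv b R).toLinearMap,
    { projective := fun i => by
        have := J.projective_quotient i
        exact Module.Projective.of_equiv
          (Submodule.Quotient.equiv (J.ideal i) _ (coordEquiv b R) rfl)
      rank_eq := fun i p => by
        rw [← J.rank_eq i p]
        exact (congrFun (Module.rankAtStalk_eq_of_equiv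
          ((coordEquiv b R).submoduleMap (J.ideal i))) p).symm
      stable := by
        rintro i j T (⟨rfl, x, rfl⟩ | ⟨hij, rfl⟩) _ ⟨z, hz, rfl⟩
        · refine ⟨z * (1 ⊗ₜ x), J.mul_mem i z hz _, coordEquiv_mul b x z⟩
        · rw [Matrix.map_one _ (map_zero _) (map_one _), vecMul_one]
          exact ⟨z, J.monotone hij hz, rfl⟩ }⟩
  invFun I :=
    { ideal := fun i => (I.1 i).comap (coordEquiv b R).toLinearMap
      mul_mem := fun i x hx y => by
        refine mul_mem_of_forall_tmul (fun x hx a => ?_) hx y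
        rw [Submodule.mem_comap, LinearEquiv.coe_coe, coordEquiv_mul]
        exact I.2.stable i i _ (Or.inl ⟨rfl, a, rfl⟩) _ hx
      projective_quotient := fun i => by
        have := I.2.projective i
        exact Module.Projective.of_equiv (Submodule.Quotient.equiv _ (I.1 i) (coordEquiv b R)
          (Submodule.map_comap_eq_of_surjective (coordEquiv b R).surjective _)).symm
      rank_eq := fun i p => by
        rw [← I.2.rank_eq i p]
        refine congrFun (Module.rankAtStalk_eq_of_equiv ?_) p
        exact ((coordEquiv b R).submoduleMap _).trans (LinearEquiv.ofEq _ _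
          (Submodule.map_comap_eq_of_surjective (coordEquiv b R).surjective _))
      monotone := fun i j hij x hx => by
        have := I.2.stable i j 1 (Or.inr ⟨hij, rfl⟩) _ hx
        rwa [Matrix.map_one _ (map_zero _) (map_one _), vecMul_one] at this }
  left_inv J := RightIdealFlag.ext' fun i =>
    Submodule.comap_map_eq_of_injective (coordEquiv b R).injective _
  right_inv I := Subtype.ext (funext fun i =>
    Submodule.map_comap_eq_of_surjective (coordEquiv b R).surjective _)

/-- Extension of scalars of a submodule of `R ⊗ A`. -/
def extendScalars (f : R →ₐ[F] S) (I : Submodule R (R ⊗[F] A)) : Submodule S (S ⊗[F] A) :=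
  Submodule.span S (Algebra.TensorProduct.map f (AlgHom.id F A) '' I)

lemma map_extendScalars (f : R →ₐ[F] S) (I : Submodule R (R ⊗[F] A)) :
    (extendScalars f I).map (coordEquiv b S).toLinearMap =
      mapSpan (f : R →+* S) (I.map (coordEquiv b R).toLinearMap) := by
  rw [extendScalars, Submodule.map_span, mapSpan]
  congr 1
  ext v
  constructor
  · rintro ⟨_, ⟨z, hz, rfl⟩, rfl⟩
    exact ⟨_, ⟨z, hz, rfl⟩, (coordEquiv_map b f z).symm⟩
  · rintro ⟨_, ⟨z, hz, rfl⟩, rfl⟩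
    exact ⟨_, ⟨z, hz, rfl⟩, coordEquiv_map b f z⟩

section Sum

variable {ι₁ ι₂ : Type} [Fintype ι₁] [DecidableEq ι₁] [Fintype ι₂] [DecidableEq ι₂]
  {c₁ r₁ : ι₁ → ℕ} {c₂ r₂ : ι₂ → ℕ} (𝒯₁ : ∀ i j, Set (Matrix (Fin (c₁ i)) (Fin (c₁ j)) F))
  (𝒯₂ : ∀ i j, Set (Matrix (Fin (c₂ i)) (Fin (c₂ j)) F))

/-- The matrices for the disjoint union of two families. -/
def sumMatrices : ∀ i j : ι₁ ⊕ ι₂,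
    Set (Matrix (Fin (Sum.elim c₁ c₂ i)) (Fin (Sum.elim c₁ c₂ j)) F)
  | .inl i, .inl j => 𝒯₁ i j
  | .inr i, .inr j => 𝒯₂ i j
  | .inl _, .inr _ => ∅
  | .inr _, .inl _ => ∅

/-- A stable family over a disjoint union is a pair of stable families. -/
def sumEquiv : {I : ∀ i, Submodule R (Fin (Sum.elim c₁ c₂ i) → R) //
    IsStableFamily (Sum.elim r₁ r₂) (sumMatrices 𝒯₁ 𝒯₂) I} ≃
      {I : ∀ i, Submodule R (Fin (c₁ i) → R) // IsStableFamily r₁ 𝒯₁ I} ×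
        {I : ∀ i, Submodule R (Fin (c₂ i) → R) // IsStableFamily r₂ 𝒯₂ I} where
  toFun I := ⟨⟨fun i => I.1 (.inl i), fun i => I.2.projective (.inl i),
    fun i => I.2.rank_eq (.inl i), fun i j => I.2.stable (.inl i) (.inl j)⟩,
    ⟨fun i => I.1 (.inr i), fun i => I.2.projective (.inr i),
    fun i => I.2.rank_eq (.inr i), fun i j => I.2.stable (.inr i) (.inr j)⟩⟩
  invFun I := ⟨fun | .inl i => I.1.1 i | .inr i => I.2.1 i,
    fun | .inl i => I.1.2.projective i | .inr i => I.2.2.projective i,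
    fun | .inl i => I.1.2.rank_eq i | .inr i => I.2.2.rank_eq i,
    fun
      | .inl i, .inl j => I.1.2.stable i j
      | .inr i, .inr j => I.2.2.stable i j
      | .inl _, .inr _ => fun _ h => h.elim
      | .inr _, .inl _ => fun _ h => h.elim⟩
  left_inv _ := Subtype.ext (funext fun | .inl _ => rfl | .inr _ => rfl)
  right_inv _ := rfl

end Sum

/-- Pairs of flags in two algebras are represented by a closed subscheme of a projective space. -/
theorem exists_representation_flags [Module.Finite F A] [Nontrivial A] (D : Type u) [Ring D]
    [Algebra F D] [Module.Finite F D] [Nontrivial D] {l : ℕ} (m : Fin l → ℕ) :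
    ∃ (Z : Over (Spec (.of F))) (N : ℕ) (j : Z ⟶ projectiveSpace F N), IsClosedImmersion j.left ∧
      ∃ E : ∀ (R : Type u) [CommRing R] [Algebra F R],
        Points Z R ≃ RightIdealFlag (F := F) A n R × RightIdealFlag (F := F) D m R,
      ∀ (R S : Type u) [CommRing R] [Algebra F R] [CommRing S] [Algebra F S] (f : R →ₐ[F] S)
        (x : Points Z R),
          (∀ i, (E S (specOverMap f ≫ x)).1.ideal i = extendScalars f ((E R x).1.ideal i)) ∧
          ∀ i, (E S (specOverMap f ≫ x)).2.ideal i = extendScalars f ((E R x).2.ideal i) := by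
  let b := Module.finBasis F A
  let b' := Module.finBasis F D
  obtain ⟨Z, N, j, hj, E, hE⟩ := exists_representation_family (F := F)
    (r := Sum.elim (fun i => n i * degree F A) (fun i => m i * degree F D))
    (𝒯 := sumMatrices (c₁ := fun _ => Module.finrank F A) (c₂ := fun _ => Module.finrank F D)
      (flagMatrices b k) (flagMatrices b' l))
    (by
      rintro (i | i)
      · exact Module.finrank_pos
      · exact Module.finrank_pos)
    (by
      rintro (i | i)
      · exact Or.inr ⟨le_rfl, rfl⟩
      · exact Or.inr ⟨le_rfl, rfl⟩)
  let E' (R : Type u) [CommRing R] [Algebra F R] : Points Z R ≃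
      RightIdealFlag (F := F) A n R × RightIdealFlag (F := F) D m R :=
    ((E R).trans (sumEquiv _ _)).trans
      ((flagEquiv (R := R) b n).symm.prodCongr (flagEquiv (R := R) b' m).symm)
  have h1 (R : Type u) [CommRing R] [Algebra F R] (x : Points Z R) (i : Fin k) :
      ((E' R x).1.ideal i).map (coordEquiv b R).toLinearMap = (E R x).1 (.inl i) :=
    Submodule.map_comap_eq_of_surjective (coordEquiv b R).surjective _
  have h2 (R : Type u) [CommRing R] [Algebra F R] (x : Points Z R) (i : Fin l) :
      ((E' R x).2.ideal i).map (coordEquiv b' R).toLinearMap = (E R x).1 (.inr i) :=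
    Submodule.map_comap_eq_of_surjective (coordEquiv b' R).surjective _
  refine ⟨Z, N, j, hj, fun R _ _ => E' R, fun R S _ _ _ _ f x => ⟨fun i => ?_, fun i => ?_⟩⟩
  · refine Submodule.map_injective_of_injective (f := (coordEquiv b S).toLinearMap)
      (coordEquiv b S).injective ?_
    rw [map_extendScalars]
    erw [h1, h1]
    exact hE R S f x (.inl i)
  · refine Submodule.map_injective_of_injective (f := (coordEquiv b' S).toLinearMap)
      (coordEquiv b' S).injective ?_
    rw [map_extendScalars]
    erw [h2, h2]
    exact hE R S f x (.inr i)

end Flags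

/-! ### Simplicity of central simple algebras under extension of the base field -/

section Simple

variable {F : Type u} [Field F] (A : Type u) [Ring A] [Algebra F A]

attribute [local instance] TensorProduct.Algebra.module in
-- Submodules under left and right multiplication are two-sided ideals.
theorem isSimpleModule_tensor_mulOpposite [IsSimpleRing A] :
    IsSimpleModule (A ⊗[F] Aᵐᵒᵖ) A := by
  have key (N : Submodule (A ⊗[F] Aᵐᵒᵖ) A) (a b x : A) (hx : x ∈ N) : a * x * b ∈ N := by
    have := N.smul_mem (a ⊗ₜ[F] MulOpposite.op b) hx
    rwa [TensorProduct.Algebra.smul_def, op_smul_eq_mul, smul_eq_mul, ← mul_assoc] at this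
  refine { exists_pair_ne := ⟨⊥, ⊤, bot_ne_top⟩, eq_bot_or_eq_top := fun N => ?_ }
  let J : TwoSidedIdeal A := .mk' N N.zero_mem (fun h h' => N.add_mem h h')
    (fun h => N.neg_mem h) (fun {x y} h => by simpa using key N x 1 y h)
    (fun {x y} h => by simpa using key N 1 y x h)
  have hJ (x : A) : x ∈ J ↔ x ∈ N := TwoSidedIdeal.mem_mk' _ _ _ _ _ _ _
  rcases eq_bot_or_eq_top J with h | h
  · left
    refine (Submodule.eq_bot_iff _).2 fun x hx => ?_
    have := (hJ x).2 hx
    rwa [h, TwoSidedIdeal.mem_bot] at this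
  · right
    refine eq_top_iff.2 fun x _ => (hJ x).1 ?_
    rw [h]
    trivial

attribute [local instance] TensorProduct.Algebra.module in
/-- The multiplication algebra of a central simple algebra contains all functionals. -/
theorem exists_mulLeftRight_eq [IsSimpleRing A] [Algebra.IsCentral F A] [Module.Finite F A]
    (φ : A →ₗ[F] F) :
    ∃ r : A ⊗[F] Aᵐᵒᵖ, ∀ x, AlgHom.mulLeftRight F A r x = algebraMap F A (φ x) := by
  have := isSimpleModule_tensor_mulOpposite (F := F) A
  have hc (g : Module.End (A ⊗[F] Aᵐᵒᵖ) A) (a b x : A) : g (a * x * b) = a * g x * b := by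
    have := g.map_smul (a ⊗ₜ[F] MulOpposite.op b) x
    rwa [TensorProduct.Algebra.smul_def, TensorProduct.Algebra.smul_def,
      op_smul_eq_mul, op_smul_eq_mul, smul_eq_mul, smul_eq_mul, ← mul_assoc,
      ← mul_assoc] at this
  -- An endomorphism commuting with all left and right multiplications is multiplication by the
  -- image of `1`, which is central, hence a scalar.
  have hg (g : Module.End (A ⊗[F] Aᵐᵒᵖ) A) : ∃ c : F, ∀ x, g x = c • x := by
    have h1 (x : A) : g x = g 1 * x := by simpa using hc g 1 x 1
    have h2 (x : A) : g x = x * g 1 := by simpa using hc g x 1 1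
    obtain ⟨c, hc⟩ := (Algebra.IsCentral.mem_center_iff F (x := g 1)).1
      (Subalgebra.mem_center_iff.2 fun b => (h2 b).symm.trans (h1 b))
    exact ⟨c, fun x => by rw [h1, hc, Algebra.smul_def]⟩
  let f : Module.End (Module.End (A ⊗[F] Aᵐᵒᵖ) A) A :=
    { toFun := fun x => algebraMap F A (φ x)
      map_add' := by simp
      map_smul' := fun g x => by
        obtain ⟨c, hc⟩ := hg g
        simp only [Module.End.smul_def, hc, RingHom.id_apply, map_smul, smul_eq_mul, map_mul]
        rw [Algebra.smul_def] }
  classical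
  let b := Module.finBasis F A
  -- As those endomorphisms are scalars, `f` commutes with them, so density realizes it on a basis
  -- by a single element `r`.
  obtain ⟨r, hr⟩ := jacobson_density f (Finset.univ.image b)
  refine ⟨r, fun x => ?_⟩
  have : AlgHom.mulLeftRight F A r = (Algebra.linearMap F A).comp φ := by
    refine b.ext fun i => ?_
    exact (hr (b i) (Finset.mem_image_of_mem _ (Finset.mem_univ i))).symm
  rw [this]
  rfl

theorem lTensor_mulLeftRight_mem {L : Type u} [CommRing L] [Algebra F L]
    (J : TwoSidedIdeal (L ⊗[F] A)) (r : A ⊗[F] Aᵐᵒᵖ) {z : L ⊗[F] A} (hz : z ∈ J) :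
    LinearMap.lTensor L (AlgHom.mulLeftRight F A r) z ∈ J := by
  induction r with
  | zero => simp [J.zero_mem]
  | add r s hr hs =>
    rw [map_add, LinearMap.lTensor_add]
    exact J.add_mem hr hs
  | tmul a b =>
    have key (z : L ⊗[F] A) : LinearMap.lTensor L (AlgHom.mulLeftRight F A (a ⊗ₜ b)) z =
        (1 : L) ⊗ₜ[F] a * z * (1 : L) ⊗ₜ[F] b.unop := by
      induction z with
      | zero => simp
      | add x y hx hy => rw [map_add, mul_add, add_mul, hx, hy]
      | tmul l x => simp
    rw [key]
    exact J.mul_mem_right _ _ (J.mul_mem_left _ _ hz)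

/-- A nonzero element of a two-sided ideal has a nonzero coordinate. The multiplication algebra
contains the corresponding coordinate functional, so the ideal contains that coordinate as a scalar,
hence a unit. -/
theorem isSimpleRing_tensor [IsSimpleRing A] [Algebra.IsCentral F A] [Module.Finite F A]
    (L : Type u) [Field L] [Algebra F L] : IsSimpleRing (L ⊗[F] A) := by
  have : Nontrivial (TwoSidedIdeal (L ⊗[F] A)) := ⟨⊥, ⊤, bot_ne_top⟩
  refine ⟨⟨fun J => or_iff_not_imp_left.2 fun hJ => ?_⟩⟩
  obtain ⟨z, hz, hz0⟩ : ∃ z ∈ J, z ≠ 0 := by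
    by_contra! h
    exact hJ (le_bot_iff.1 fun x hx => (TwoSidedIdeal.mem_bot _).2 (h x hx))
  let b := Module.finBasis F A
  obtain ⟨i, hi⟩ : ∃ i, (b.baseChange L).repr z i ≠ 0 := by
    by_contra! h
    exact hz0 ((b.baseChange L).repr.map_eq_zero_iff.1 (Finsupp.ext h))
  obtain ⟨r, hr⟩ := exists_mulLeftRight_eq A (b.coord i)
  have h1 : LinearMap.lTensor L (AlgHom.mulLeftRight F A r) z =
      ((b.baseChange L).repr z i) ⊗ₜ[F] (1 : A) := by
    clear hi hz hz0
    induction z with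
    | zero => simp
    | add x y hx hy => rw [map_add, map_add, Finsupp.add_apply, add_tmul, hx, hy]
    | tmul l x =>
      rw [LinearMap.lTensor_tmul, hr, Algebra.algebraMap_eq_smul_one, tmul_smul, TensorProduct.smul_tmul']
      congr 1
      simp [mul_comm, Algebra.smul_def]
  have h2 := lTensor_mulLeftRight_mem A J r hz
  rw [h1] at h2
  refine (TwoSidedIdeal.one_mem_iff J).1 ?_
  have h3 := J.mul_mem_left (((b.baseChange L).repr z i)⁻¹ ⊗ₜ[F] (1 : A)) _ h2
  rwa [Algebra.TensorProduct.tmul_mul_tmul, one_mul, inv_mul_cancel₀ hi] at h3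

theorem finrank_eq_degree_sq [IsSimpleRing A] [Algebra.IsCentral F A] [Module.Finite F A] :
    Module.finrank F A = degree F A * degree F A := by
  let K := AlgebraicClosure F
  have := isSimpleRing_tensor (F := F) A K
  obtain ⟨n, _, ⟨e⟩⟩ := IsSimpleRing.exists_algEquiv_matrix_of_isAlgClosed K (K ⊗[F] A)
  have h : Module.finrank F A = n * n := by
    rw [← Module.finrank_baseChange (R := K), e.toLinearEquiv.finrank_eq, Module.finrank_matrix]
    simp
  rw [degree, h, Nat.sqrt_eq]

end Simple

/-! ### Conjugacy of chains of complemented submodules, for an abstract rank function -/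

section Chains

variable {S M : Type*} [Ring S] [AddCommGroup M] [Module S M]

/-- The linear automorphism glued from isomorphisms between the terms of two decompositions. -/
theorem exists_linearEquiv_of_isCompl {U V U' V' : Submodule S M} (h : IsCompl U V)
    (h' : IsCompl U' V') (a : U ≃ₗ[S] U') (b : V ≃ₗ[S] V') :
    ∃ e : M ≃ₗ[S] M, (∀ u : U, e u = a u) ∧ ∀ v : V, e v = b v := by
  refine ⟨(Submodule.prodEquivOfIsCompl U V h).symm.trans
    ((a.prodCongr b).trans (Submodule.prodEquivOfIsCompl U' V' h')), fun u => ?_, fun v => ?_⟩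
  · simp
  · simp

theorem map_eq_of_linearEquiv {U U' : Submodule S M} (e : M ≃ₗ[S] M) (a : U ≃ₗ[S] U')
    (h : ∀ u : U, e u = a u) : U.map e.toLinearMap = U' := by
  ext x
  constructor
  · rintro ⟨u, hu, rfl⟩
    have := h ⟨u, hu⟩
    exact this ▸ (a ⟨u, hu⟩).2
  · intro hx
    refine ⟨a.symm ⟨x, hx⟩, (a.symm ⟨x, hx⟩).2, ?_⟩
    exact (h _).trans (by rw [LinearEquiv.apply_symm_apply])

/-- By the modular law, a complement of `U` meets `T` in a complement of `U` inside `T`. -/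
theorem exists_isCompl_of_le {U T : Submodule S M} (hUT : U ≤ T) (hU : IsComplemented U)
    (hT : IsComplemented T) :
    ∃ X, Disjoint U X ∧ U ⊔ X = T ∧ IsComplemented X := by
  obtain ⟨P, hP⟩ := hU
  obtain ⟨C, hC⟩ := hT
  have h1 : U ⊔ P ⊓ T = T := by
    rw [← sup_inf_assoc_of_le P hUT, hP.sup_eq_top, top_inf_eq]
  have h2 : Disjoint U (P ⊓ T) := hP.disjoint.mono_right inf_le_left
  refine ⟨P ⊓ T, h2, h1, U ⊔ C, ?_, ?_⟩
  · have h3 : Disjoint (P ⊓ T ⊔ U) C := by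
      rw [sup_comm, h1]
      exact hC.disjoint
    exact h2.symm.disjoint_sup_right_of_disjoint_sup_left h3
  · rw [codisjoint_iff, ← sup_assoc, sup_comm _ U, h1, hC.sup_eq_top]

/-- One step of the comparison of two chains: move the lower term, fix what contains the upper. -/
theorem exists_linearEquiv_step (r : Submodule S M → ℕ)
    (hiso : ∀ X X', IsComplemented X → IsComplemented X' → r X = r X' → Nonempty (X ≃ₗ[S] X'))
    (hadd : ∀ X Y, Disjoint X Y → IsComplemented X → IsComplemented Y → r (X ⊔ Y) = r X + r Y)
    {U U' T : Submodule S M} (hU : IsComplemented U) (hU' : IsComplemented U')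
    (hT : IsComplemented T) (hUT : U ≤ T) (hUT' : U' ≤ T) (hr : r U = r U') :
    ∃ e : M ≃ₗ[S] M, U.map e.toLinearMap = U' ∧
      ∀ W, T ≤ W → W.map e.toLinearMap = W := by
  obtain ⟨X, hX, hXT, hXc⟩ := exists_isCompl_of_le hUT hU hT
  obtain ⟨X', hX', hXT', hXc'⟩ := exists_isCompl_of_le hUT' hU' hT
  have hrX : r X = r X' := by
    have h1 := hadd U X hX hU hXc
    have h2 := hadd U' X' hX' hU' hXc'
    rw [hXT] at h1
    rw [hXT'] at h2
    omega
  obtain ⟨a⟩ := hiso U U' hU hU' hr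
  obtain ⟨b⟩ := hiso X X' hXc hXc' hrX
  have hle : X ≤ T := hXT ▸ le_sup_right
  have hle' : X' ≤ T := hXT' ▸ le_sup_right
  have compl {U X : Submodule S M} (h : Disjoint U X) (hT : U ⊔ X = T) :
      IsCompl (U.comap T.subtype) (X.comap T.subtype) := by
    constructor
    · rw [Submodule.disjoint_def] at h ⊢
      exact fun x hx hx' => Subtype.ext (h x hx hx')
    · rw [codisjoint_iff, eq_top_iff]
      rintro ⟨x, hx⟩ -
      rw [← hT] at hx
      obtain ⟨u, hu, v, hv, rfl⟩ := Submodule.mem_sup.1 hx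
      exact Submodule.mem_sup.2 ⟨⟨u, hT ▸ Submodule.mem_sup_left hu⟩, hu,
        ⟨v, hT ▸ Submodule.mem_sup_right hv⟩, hv, rfl⟩
  obtain ⟨f, hf, -⟩ := exists_linearEquiv_of_isCompl (compl hX hXT) (compl hX' hXT')
    ((Submodule.comapSubtypeEquivOfLe hUT).trans
      (a.trans (Submodule.comapSubtypeEquivOfLe hUT').symm))
    ((Submodule.comapSubtypeEquivOfLe hle).trans
      (b.trans (Submodule.comapSubtypeEquivOfLe hle').symm))
  obtain ⟨C, hC⟩ := hT
  obtain ⟨e, he, he'⟩ := exists_linearEquiv_of_isCompl hC hC f (LinearEquiv.refl S C)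
  -- Every vector moves by an element of `T` only, so `e` preserves each submodule containing `T`.
  have hsub (x : M) : e x - x ∈ T := by
    obtain ⟨t, ht, c, hc, rfl⟩ := Submodule.mem_sup.1 (hC.sup_eq_top ▸ Submodule.mem_top (x := x))
    have h1 : e t = f ⟨t, ht⟩ := he ⟨t, ht⟩
    have h2 : e c = c := he' ⟨c, hc⟩
    rw [map_add, h1, h2, add_sub_add_right_eq_sub]
    exact T.sub_mem (f ⟨t, ht⟩).2 ht
  refine ⟨e, map_eq_of_linearEquiv e a fun u => ?_, fun W hW => le_antisymm ?_ ?_⟩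
  · refine (he ⟨u, hUT u.2⟩).trans ?_
    have := hf ⟨⟨u, hUT u.2⟩, u.2⟩
    exact congrArg Subtype.val this
  · rintro _ ⟨x, hx, rfl⟩
    simpa using W.add_mem (hW (hsub x)) hx
  · intro x hx
    refine ⟨e.symm x, ?_, e.apply_symm_apply x⟩
    have := W.sub_mem hx (hW (hsub (e.symm x)))
    simpa using this

theorem isComplemented_map (e : M ≃ₗ[S] M) {X : Submodule S M} (h : IsComplemented X) :
    IsComplemented (X.map e.toLinearMap) := by
  obtain ⟨Y, hY⟩ := h
  exact ⟨Y.map e.toLinearMap, (Submodule.orderIsoMapComap e).isCompl hY⟩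

/-- Chains of complemented submodules of the same ranks are related by an automorphism. -/
theorem exists_linearEquiv_of_chains (r : Submodule S M → ℕ)
    (hiso : ∀ X X', IsComplemented X → IsComplemented X' → r X = r X' → Nonempty (X ≃ₗ[S] X'))
    (hadd : ∀ X Y, Disjoint X Y → IsComplemented X → IsComplemented Y → r (X ⊔ Y) = r X + r Y)
    (hr : ∀ (e : M ≃ₗ[S] M) X, r (X.map e.toLinearMap) = r X)
    {k : ℕ} {U U' : ℕ → Submodule S M} (hU : ∀ i, IsComplemented (U i))
    (hU' : ∀ i, IsComplemented (U' i)) (hm : Monotone U) (hm' : Monotone U')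
    (hrank : ∀ i, r (U i) = r (U' i)) (hk : ∀ i, k ≤ i → U i = U' i) :
    ∃ e : M ≃ₗ[S] M, ∀ i, (U i).map e.toLinearMap = U' i := by
  -- Here `k` is an index from which the chains agree. One step corrects the term `U k` inside `U (k
  -- + 1)` without disturbing the terms above.
  induction k generalizing U with
  | zero => exact ⟨LinearEquiv.refl S M, fun i => (Submodule.map_id _).trans (hk i i.zero_le)⟩
  | succ k ih =>
    obtain ⟨e, he, hW⟩ := exists_linearEquiv_step r hiso hadd (hU k) (hU' k) (hU (k + 1))
      (hm k.le_succ) (hk (k + 1) le_rfl ▸ hm' k.le_succ) (hrank k)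
    obtain ⟨e', he'⟩ := ih (U := fun i => (U i).map e.toLinearMap)
      (fun i => isComplemented_map e (hU i)) (fun i j h => Submodule.map_mono (hm h))
      (fun i => (hr e _).trans (hrank i)) (fun i hi => by
        rcases hi.eq_or_lt with rfl | hi
        · exact he
        · exact (hW _ (hm hi)).trans (hk i hi))
    exact ⟨e.trans e', fun i => (Submodule.map_comp _ _ _).trans (he' i)⟩

/-- The same for chains indexed by `Fin k`. -/
theorem exists_linearEquiv_of_fin_chains (r : Submodule S M → ℕ)
    (hiso : ∀ X X', IsComplemented X → IsComplemented X' → r X = r X' → Nonempty (X ≃ₗ[S] X'))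
    (hadd : ∀ X Y, Disjoint X Y → IsComplemented X → IsComplemented Y → r (X ⊔ Y) = r X + r Y)
    (hr : ∀ (e : M ≃ₗ[S] M) X, r (X.map e.toLinearMap) = r X)
    {k : ℕ} {U U' : Fin k → Submodule S M} (hU : ∀ i, IsComplemented (U i))
    (hU' : ∀ i, IsComplemented (U' i)) (hm : Monotone U) (hm' : Monotone U')
    (hrank : ∀ i, r (U i) = r (U' i)) :
    ∃ e : M ≃ₗ[S] M, ∀ i, (U i).map e.toLinearMap = U' i := by
  -- The chain is continued by `⊤`, so that two chains agree from index `k` on.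
  let V (U : Fin k → Submodule S M) (i : ℕ) : Submodule S M := if h : i < k then U ⟨i, h⟩ else ⊤
  have hV {U : Fin k → Submodule S M} (hm : Monotone U) : Monotone (V U) := fun i j h => by
    dsimp only [V]
    split_ifs with h1 h2
    · exact hm h
    · exact le_top
    · omega
    · exact le_rfl
  have hV' {U : Fin k → Submodule S M} (hU : ∀ i, IsComplemented (U i)) (i : ℕ) :
      IsComplemented (V U i) := by
    dsimp only [V]
    split_ifs
    · exact hU _
    · exact isComplemented_top
  obtain ⟨e, he⟩ := exists_linearEquiv_of_chains r hiso hadd hr (k := k) (hV' hU) (hV' hU')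
    (hV hm) (hV hm') (fun i => by
      dsimp only [V]
      split_ifs
      · exact hrank _
      · rfl) (fun i hi => by simp [V, hi.not_gt])
  refine ⟨e, fun i => ?_⟩
  simpa [V] using he i

end Chains

/-! ### Finite modules over a simple algebra and their dimensions -/

section SimpleDim

variable (L S : Type u) [Field L] [Ring S] [Algebra L S]

/-- The dimension of a simple left module over a simple algebra, realized as a left ideal. -/
def simpleDim : ℕ :=
  sInf {s | ∃ I : Submodule S S, IsSimpleModule S I ∧ Module.finrank L I = s}

variable [IsSimpleRing S] [Module.Finite L S]

theorem exists_simple_submodule :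
    ∃ I : Submodule S S, IsSimpleModule S I ∧ Module.finrank L I = simpleDim L S := by
  have := IsArtinianRing.of_finite L S
  refine Nat.sInf_mem (s := {s | ∃ I : Submodule S S, IsSimpleModule S I ∧
    Module.finrank L I = s}) ?_
  obtain ⟨I, hI⟩ := IsAtomic.exists_atom (Submodule S S)
  exact ⟨_, I, isSimpleModule_iff_isAtom.2 hI, rfl⟩

/-- A simple Artinian ring is semisimple and has only one simple module up to isomorphism, so every
finite module is a power of it. -/
theorem exists_simple_forall_linearEquiv :
    ∃ I : Submodule S S, IsSimpleModule S I ∧ Module.finrank L I = simpleDim L S ∧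
      ∀ (M : Type u) [AddCommGroup M] [Module S M] [Module.Finite S M],
        ∃ n : ℕ, Nonempty (M ≃ₗ[S] Fin n → I) := by
  have := IsArtinianRing.of_finite L S
  obtain ⟨I, hI, hd⟩ := exists_simple_submodule L S
  refine ⟨I, hI, hd, fun M _ _ _ => ?_⟩
  refine IsIsotypicOfType.linearEquiv_fun (R := S) (M := M) (S := I) fun m _ => ?_
  obtain ⟨J, ⟨e⟩⟩ := IsSemisimpleRing.exists_linearEquiv_ideal_of_isSimpleModule S m
  have := IsSimpleModule.congr e.symm
  exact ⟨e.trans (IsSimpleRing.isIsotypic S S I J).some⟩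

theorem simpleDim_pos : 0 < simpleDim L S := by
  obtain ⟨I, hI, hd⟩ := exists_simple_submodule L S
  have := IsSimpleModule.nontrivial S I
  rw [← hd]
  have : Module.Finite L I := Module.Finite.of_injective (I.subtype.restrictScalars L)
    I.subtype_injective
  exact Module.finrank_pos

variable {L S}

theorem simpleDim_dvd_finrank (M : Type u) [AddCommGroup M] [Module S M] [Module L M]
    [IsScalarTower L S M] [Module.Finite S M] : simpleDim L S ∣ Module.finrank L M := by
  obtain ⟨I, -, hd, h⟩ := exists_simple_forall_linearEquiv L S
  obtain ⟨n, ⟨e⟩⟩ := h M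
  have : Module.Finite L I := Module.Finite.of_injective (I.subtype.restrictScalars L)
    I.subtype_injective
  rw [(e.restrictScalars L).finrank_eq, Module.finrank_pi_fintype, hd]
  simp

theorem nonempty_linearEquiv_of_finrank_eq {M N : Type u} [AddCommGroup M] [Module S M] [Module L M]
    [IsScalarTower L S M] [Module.Finite S M] [AddCommGroup N] [Module S N] [Module L N]
    [IsScalarTower L S N] [Module.Finite S N] (hMN : Module.finrank L M = Module.finrank L N) :
    Nonempty (M ≃ₗ[S] N) := by
  obtain ⟨I, -, hd, h⟩ := exists_simple_forall_linearEquiv L S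
  obtain ⟨n, ⟨e⟩⟩ := h M
  obtain ⟨m, ⟨f⟩⟩ := h N
  have : Module.Finite L I := Module.Finite.of_injective (I.subtype.restrictScalars L)
    I.subtype_injective
  rw [(e.restrictScalars L).finrank_eq, (f.restrictScalars L).finrank_eq,
    Module.finrank_pi_fintype, Module.finrank_pi_fintype, hd] at hMN
  have : n = m := by simpa [(simpleDim_pos L S).ne'] using hMN
  subst this
  exact ⟨e.trans f.symm⟩

theorem finrank_eq_simpleDim (M : Type u) [AddCommGroup M] [Module S M] [Module L M]
    [IsScalarTower L S M] [IsSimpleModule S M] : Module.finrank L M = simpleDim L S := by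
  have := IsArtinianRing.of_finite L S
  obtain ⟨I, hI, hd⟩ := exists_simple_submodule L S
  obtain ⟨J, ⟨e⟩⟩ := IsSemisimpleRing.exists_linearEquiv_ideal_of_isSimpleModule S M
  have := IsSimpleModule.congr e.symm
  rw [← hd]
  exact ((e.trans (IsSimpleRing.isIsotypic S S I J).some).restrictScalars L).finrank_eq

/-- A module over a simple algebra has increasing chains of submodules of all possible
dimensions. -/
theorem exists_chain (M : Type u) [AddCommGroup M] [Module S M] [Module L M]
    [IsScalarTower L S M] [Module.Finite S M] :
    ∃ C : ℕ → Submodule S M, Monotone C ∧ ∀ j, j * simpleDim L S ≤ Module.finrank L M →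
      Module.finrank L (C j) = j * simpleDim L S := by
  obtain ⟨I, -, hd, h⟩ := exists_simple_forall_linearEquiv L S
  obtain ⟨n, ⟨e⟩⟩ := h M
  have hI : Module.Finite L I := Module.Finite.of_injective (I.subtype.restrictScalars L)
    I.subtype_injective
  have hM : Module.finrank L M = n * simpleDim L S := by
    rw [(e.restrictScalars L).finrank_eq, Module.finrank_pi_fintype, hd]
    simp
  -- Restriction to the coordinates of index at least `j`; its kernel consists of the first `j`
  -- copies of `I`.
  let ρ (j : ℕ) : (Fin n → I) →ₗ[S] ({i : Fin n // j ≤ i} → I) :=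
    LinearMap.funLeft S I Subtype.val
  refine ⟨fun j => (LinearMap.ker (ρ j)).comap e.toLinearMap, fun j j' hj x hx => ?_,
    fun j hj => ?_⟩
  · rw [Submodule.mem_comap, LinearMap.mem_ker] at hx ⊢
    ext ⟨i, hi⟩ : 1
    exact congrFun hx ⟨i, hj.trans hi⟩
  · rw [hM] at hj
    have hj' : j ≤ n := Nat.le_of_mul_le_mul_right hj (simpleDim_pos L S)
    have e' : (LinearMap.ker (ρ j)).comap e.toLinearMap ≃ₗ[S] LinearMap.ker (ρ j) :=
      (e.submoduleMap _).trans (LinearEquiv.ofEq _ _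
        (Submodule.map_comap_eq_of_surjective e.surjective _))
    rw [(e'.restrictScalars L).finrank_eq]
    have h1 := LinearMap.finrank_range_add_finrank_ker ((ρ j).restrictScalars L)
    have hs : Function.Surjective ((ρ j).restrictScalars L) :=
      LinearMap.funLeft_surjective_of_injective S I _ Subtype.val_injective
    rw [LinearMap.range_eq_top.2 hs, finrank_top, Module.finrank_pi_fintype,
      Module.finrank_pi_fintype, hd] at h1
    simp only [Finset.sum_const, Finset.card_univ, smul_eq_mul, Fintype.card_fin] at h1
    have h2 : Fintype.card {i : Fin n // j ≤ i} = n - j := by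
      rw [← Fintype.card_fin (n - j)]
      exact Fintype.card_congr
        ⟨fun i => ⟨i.1 - j, by omega⟩, fun a => ⟨⟨a + j, by omega⟩, Nat.le_add_left _ _⟩,
          fun i => Subtype.ext (Fin.ext (Nat.sub_add_cancel i.2)),
          fun a => Fin.ext (Nat.add_sub_cancel _ _)⟩
    rw [h2] at h1
    have h3 : Module.finrank L (LinearMap.ker (ρ j)) + (n - j) * simpleDim L S =
      n * simpleDim L S := (add_comm _ _).trans h1
    obtain ⟨c, rfl⟩ := Nat.exists_eq_add_of_le hj'
    rw [Nat.add_sub_cancel_left, add_mul] at h3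
    exact Nat.add_right_cancel h3

end SimpleDim

/-! ### The dimension of the simple right module -/

section RightDim

variable (L : Type u) [Field L] (B : Type u) [Ring B] [Algebra L B]

/-- The dimension of a simple right module over a simple algebra. -/
def rightDim : ℕ := simpleDim L Bᵐᵒᵖ

variable {L B}

/-- A simple module over one algebra stays simple, of the same dimension, when viewed over the
other. -/
theorem rightDim_congr [IsSimpleRing B] [Module.Finite L B] {B' : Type u} [Ring B'] [Algebra L B']
    [IsSimpleRing B'] [Module.Finite L B'] (e : B ≃ₐ[L] B') : rightDim L B = rightDim L B' := by
  obtain ⟨I, hI, hd⟩ := exists_simple_submodule L B'ᵐᵒᵖ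
  let f : Bᵐᵒᵖ ≃ₐ[L] B'ᵐᵒᵖ := AlgEquiv.op e
  let : Module Bᵐᵒᵖ I := Module.compHom I f.toRingHom
  have : IsScalarTower L Bᵐᵒᵖ I := ⟨fun a b x => by
    change f (a • b) • x = a • (f b • x)
    rw [map_smul, smul_assoc]⟩
  have : RingHomSurjective f.toRingHom := ⟨f.surjective⟩
  let l : I →ₛₗ[f.toRingHom] I :=
    { toFun := id, map_add' := fun _ _ => rfl, map_smul' := fun _ _ => rfl }
  have : IsSimpleModule Bᵐᵒᵖ I :=
    (LinearMap.isSimpleModule_iff_of_bijective l Function.bijective_id).2 hI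
  exact ((finrank_eq_simpleDim (L := L) (S := Bᵐᵒᵖ) I).symm.trans hd)

section Row

variable (L) (m : ℕ) [NeZero m] (C : Type u) [Ring C] [Algebra L C]

/-- The right ideal of matrices concentrated in the first row. -/
def rowIdeal : Submodule (Matrix (Fin m) (Fin m) C)ᵐᵒᵖ (Matrix (Fin m) (Fin m) C) where
  carrier := {N | ∀ i, i ≠ 0 → N i = 0}
  add_mem' h h' i hi := by
    ext j
    simp [h i hi, h' i hi]
  zero_mem' _ _ := rfl
  smul_mem' x N h i hi := by
    ext j
    rw [← MulOpposite.op_unop x, op_smul_eq_mul, Matrix.mul_apply]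
    simp [h i hi]

theorem finrank_rowIdeal [Module.Finite L C] :
    Module.finrank L (rowIdeal m C) = m * Module.finrank L C := by
  let e : rowIdeal m C ≃ₗ[L] (Fin m → C) :=
    { toFun := fun N => N.1 0
      map_add' := fun _ _ => rfl
      map_smul' := fun _ _ => rfl
      invFun := fun v => ⟨fun i => if i = 0 then v else 0, fun i hi => if_neg hi⟩
      left_inv := fun N => Subtype.ext (funext fun i => by
        by_cases hi : i = 0
        · simp [hi]
        · exact (if_neg hi).trans (N.2 i hi).symm)
      right_inv := fun v => by simp }
  rw [e.finrank_eq, Module.finrank_pi_fintype]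
  simp

theorem isSimpleModule_rowIdeal (E : Type u) [DivisionRing E] :
    IsSimpleModule (Matrix (Fin m) (Fin m) E)ᵐᵒᵖ (rowIdeal m E) := by
  have : Nontrivial (rowIdeal m E) := by
    refine ⟨⟨0, ⟨Matrix.single 0 0 1, fun i hi => ?_⟩, fun h => ?_⟩⟩
    · ext j
      exact Matrix.single_apply_of_row_ne (Ne.symm hi) _ _ _
    · have := congrArg (fun N : rowIdeal m E => N.1 0 0) h
      simp at this
  refine { exists_pair_ne := ⟨⊥, ⊤, bot_ne_top⟩, eq_bot_or_eq_top := fun J => ?_ }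
  refine or_iff_not_imp_left.2 fun hJ => ?_
  obtain ⟨N, hN, hN0⟩ := (Submodule.ne_bot_iff _).1 hJ
  obtain ⟨j, hj⟩ : ∃ j, N.1 0 j ≠ 0 := by
    by_contra! h
    refine hN0 (Subtype.ext ?_)
    ext i j
    by_cases hi : i = 0
    · rw [hi]
      exact h j
    · exact congrFun (N.2 i hi) j
  refine eq_top_iff.2 fun P _ => ?_
  -- The pivot `N 0 j` is invertible, so placing the suitably scaled first row of `P` in row `j`
  -- gives `N * X = P`.
  let X : Matrix (Fin m) (Fin m) E := fun i l => if i = j then (N.1 0 j)⁻¹ * P.1 0 l else 0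
  have hX : MulOpposite.op X • N = P := by
    refine Subtype.ext ?_
    change N.1 * X = P.1
    ext i l
    rw [Matrix.mul_apply]
    by_cases hi : i = 0
    · subst hi
      simp [X, mul_inv_cancel_left₀ hj]
    · simp [N.2 i hi, P.2 i hi]
  exact hX ▸ J.smul_mem (MulOpposite.op X) hN

theorem rightDim_matrix_divisionRing (E : Type u) [DivisionRing E] [Algebra L E]
    [Module.Finite L E] : rightDim L (Matrix (Fin m) (Fin m) E) = m * Module.finrank L E := by
  have := isSimpleModule_rowIdeal m E
  rw [← finrank_rowIdeal]
  exact (finrank_eq_simpleDim (L := L) (S := (Matrix (Fin m) (Fin m) E)ᵐᵒᵖ) (rowIdeal m E)).symm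

variable {m C} in
theorem rightDim_dvd_of_algEquiv_matrix [IsSimpleRing B] [Module.Finite L B] [Module.Finite L C]
    (e : B ≃ₐ[L] Matrix (Fin m) (Fin m) C) : rightDim L B ∣ m * Module.finrank L C := by
  have : IsSimpleRing (Matrix (Fin m) (Fin m) C) :=
    IsSimpleRing.of_ringEquiv e.toRingEquiv inferInstance
  rw [rightDim_congr e, ← finrank_rowIdeal]
  have : Module.Finite (Matrix (Fin m) (Fin m) C)ᵐᵒᵖ (rowIdeal m C) := by
    have : Module.Finite L (rowIdeal m C) :=
      Module.Finite.of_injective ((rowIdeal m C).subtype.restrictScalars L)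
        (rowIdeal m C).subtype_injective
    exact Module.Finite.of_restrictScalars_finite L _ _
  exact simpleDim_dvd_finrank (L := L) (S := (Matrix (Fin m) (Fin m) C)ᵐᵒᵖ) (rowIdeal m C)

end Row

/-- Writing `B` as matrices over a division algebra reduces this to the explicit dimension of the
first-row ideal. -/
theorem rightDim_matrix [IsSimpleRing B] [Module.Finite L B] (a : ℕ) [NeZero a] :
    rightDim L (Matrix (Fin a) (Fin a) B) = a * rightDim L B := by
  have := IsArtinianRing.of_finite L B
  obtain ⟨p, _, E, _, _, _, ⟨e⟩⟩ := IsSimpleRing.exists_algEquiv_matrix_divisionRing_finite L B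
  have : NeZero (a * p) := ⟨mul_ne_zero (NeZero.ne a) (NeZero.ne p)⟩
  rw [rightDim_congr e, rightDim_matrix_divisionRing, ← mul_assoc, ← rightDim_matrix_divisionRing]
  exact rightDim_congr (e.mapMatrix.trans ((Matrix.compAlgEquiv _ _ _ _).trans
    (Matrix.reindexAlgEquiv _ _ finProdFinEquiv)))

end RightDim

/-- Scalar extension commutes with matrix algebras. -/
def tensorMatrixEquiv (L F : Type u) [CommRing L] [CommRing F] [Algebra F L] (m : ℕ) (C : Type u)
    [Ring C] [Algebra F C] :
    L ⊗[F] Matrix (Fin m) (Fin m) C ≃ₐ[L] Matrix (Fin m) (Fin m) (L ⊗[F] C) :=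
  (Algebra.TensorProduct.congr (Matrix.uniqueAlgEquiv (m := Unit)).symm AlgEquiv.refl).trans
    ((Matrix.kroneckerTMulAlgEquiv Unit (Fin m) F L L C).trans
      (Matrix.reindexAlgEquiv L _ (Equiv.uniqueProd (Fin m) Unit)))

/-! ### Index and degree -/

section Index
set_option linter.unusedSectionVars false

variable {F : Type u} [Field F] (A : Type u) [Ring A] [Algebra F A] [IsSimpleRing A]
  [Algebra.IsCentral F A] [Module.Finite F A]

variable (F) in
theorem degree_pos : 0 < degree F A := by
  have h1 := finrank_eq_degree_sq (F := F) A
  have h2 : 0 < Module.finrank F A := Module.finrank_pos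
  rw [h1] at h2
  exact Nat.pos_of_mul_pos_left h2

variable {A} in
/-- The division algebra in a Wedderburn decomposition has square dimension. -/
theorem degree_of_algEquiv_matrix {E : Type u} [Ring E] [Algebra F E] {m : ℕ}
    (e : A ≃ₐ[F] Matrix (Fin m) (Fin m) E) :
    NeZero m ∧ Module.Finite F E ∧ Module.finrank F E = degree F E * degree F E ∧
      degree F A = m * degree F E := by
  have hm : NeZero m := by
    refine ⟨fun h => ?_⟩
    subst h
    exact not_subsingleton A e.injective.subsingleton
  have hfin : Module.Finite F (Matrix (Fin m) (Fin m) E) := Module.Finite.equiv e.toLinearEquiv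
  have hE : Module.Finite F E := .of_surjective
    (Matrix.entryLinearMap F _ (0 : Fin m) (0 : Fin m)) fun f ↦ ⟨fun _ _ ↦ f, rfl⟩
  have h1 : degree F A * degree F A = m * m * Module.finrank F E := by
    rw [← finrank_eq_degree_sq, e.toLinearEquiv.finrank_eq, Module.finrank_matrix]
    simp
  have hdvd : m ∣ degree F A := by
    rw [← Nat.pow_dvd_pow_iff two_ne_zero, pow_two, pow_two, h1]
    exact dvd_mul_right _ _
  obtain ⟨t, ht⟩ := hdvd
  have h2 : Module.finrank F E = t * t := by
    rw [ht] at h1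
    have hm2 : 0 < m * m := Nat.mul_pos (NeZero.pos m) (NeZero.pos m)
    refine (Nat.eq_of_mul_eq_mul_left hm2 ?_).symm
    rw [← h1]
    ring
  have h3 : degree F E = t := by rw [degree, h2, Nat.sqrt_eq]
  exact ⟨hm, hE, h3 ▸ h2, h3 ▸ ht⟩

theorem exists_index_eq :
    ∃ (E : Type u) (_ : DivisionRing E) (_ : Algebra F E) (m : ℕ),
      Nonempty (A ≃ₐ[F] Matrix (Fin m) (Fin m) E) ∧ index F A = degree F E := by
  have := IsArtinianRing.of_finite F A
  obtain ⟨p, _, E, _, _, _, e⟩ := IsSimpleRing.exists_algEquiv_matrix_divisionRing_finite F A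
  exact Nat.sInf_mem (s := {i | ∃ (E : Type u) (_ : DivisionRing E) (_ : Algebra F E) (m : ℕ),
    Nonempty (A ≃ₐ[F] Matrix (Fin m) (Fin m) E) ∧ i = degree F E}) ⟨_, E, _, _, p, e, rfl⟩

/-- The simple right module has dimension `ind A · deg A`. -/
theorem rightDim_eq_index_mul_degree : rightDim F A = index F A * degree F A := by
  obtain ⟨E, _, _, m, ⟨e⟩, h⟩ := exists_index_eq (F := F) A
  obtain ⟨_, _, h1, h2⟩ := degree_of_algEquiv_matrix e
  rw [rightDim_congr e, rightDim_matrix_divisionRing, h1, h, h2]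
  ring

/-- If `A` is `m × m` matrices over `E`, the first-row ideal of the matrices over `L ⊗ E` has
dimension `m · dim E = ind A · deg A`, whether or not `L ⊗ E` is still a division algebra. In terms
of indices, `ind(A_L)` divides `ind A`. -/
theorem rightDim_baseChange_dvd (L : Type u) [Field L] [Algebra F L] :
    rightDim L (L ⊗[F] A) ∣ index F A * degree F A := by
  obtain ⟨E, _, _, m, ⟨e⟩, h⟩ := exists_index_eq (F := F) A
  obtain ⟨_, _, h1, h2⟩ := degree_of_algEquiv_matrix e
  have := isSimpleRing_tensor (F := F) A L
  have h3 := rightDim_dvd_of_algEquiv_matrix L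
    ((Algebra.TensorProduct.congr (AlgEquiv.refl (R := L) (A₁ := L)) e).trans
      (tensorMatrixEquiv L F m E))
  rw [Module.finrank_baseChange, h1] at h3
  rw [h, h2]
  convert h3 using 1
  ring

end Index

/-! ### Invariance under Brauer equivalence -/

section Brauer

variable {F : Type u} [Field F] {A D : Type u} [Ring A] [Algebra F A] [IsSimpleRing A]
  [Algebra.IsCentral F A] [Module.Finite F A] [Ring D] [Algebra F D] [IsSimpleRing D]
  [Algebra.IsCentral F D] [Module.Finite F D]

theorem mul_degree_eq_of_matrix_algEquiv {a b : ℕ}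
    (e : Matrix (Fin a) (Fin a) A ≃ₐ[F] Matrix (Fin b) (Fin b) D) :
    a * degree F A = b * degree F D := by
  have h := e.toLinearEquiv.finrank_eq
  rw [Module.finrank_matrix, Module.finrank_matrix, finrank_eq_degree_sq (F := F) A,
    finrank_eq_degree_sq (F := F) D] at h
  simp only [Fintype.card_fin] at h
  refine Nat.mul_self_inj.1 ?_
  linarith

/-- Passing to matrices multiplies both `rightDim` and the degree by the matrix size, so their
quotient, the index over `L`, is a Brauer invariant. The identity is cross-multiplied to stay within
natural numbers. -/
theorem rightDim_mul_degree_of_matrix_algEquiv {a b : ℕ} (ha : a ≠ 0) (hb : b ≠ 0)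
    (e : Matrix (Fin a) (Fin a) A ≃ₐ[F] Matrix (Fin b) (Fin b) D) (L : Type u) [Field L]
    [Algebra F L] :
    rightDim L (L ⊗[F] A) * degree F D = rightDim L (L ⊗[F] D) * degree F A := by
  have := isSimpleRing_tensor (F := F) A L
  have := isSimpleRing_tensor (F := F) D L
  have : NeZero a := ⟨ha⟩
  have : NeZero b := ⟨hb⟩
  have h1 := mul_degree_eq_of_matrix_algEquiv e
  have h2 : a * rightDim L (L ⊗[F] A) = b * rightDim L (L ⊗[F] D) := by
    rw [← rightDim_matrix, ← rightDim_matrix]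
    exact rightDim_congr ((tensorMatrixEquiv L F a A).symm.trans
      ((Algebra.TensorProduct.congr (AlgEquiv.refl (R := L) (A₁ := L)) e).trans
        (tensorMatrixEquiv L F b D)))
  refine Nat.eq_of_mul_eq_mul_left (Nat.pos_of_ne_zero (mul_ne_zero ha hb)) ?_
  calc a * b * (rightDim L (L ⊗[F] A) * degree F D)
      = (a * rightDim L (L ⊗[F] A)) * (b * degree F D) := by ring
    _ = (b * rightDim L (L ⊗[F] D)) * (a * degree F A) := by rw [h1, h2]
    _ = _ := by ring

/-- The index is the same for `A` and `D`, and the index of `D` divides its degree. This is what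
makes `d` an admissible rank for `D`. -/
theorem index_le_degree_of_matrix_algEquiv {a b : ℕ} (ha : a ≠ 0) (hb : b ≠ 0)
    (e : Matrix (Fin a) (Fin a) A ≃ₐ[F] Matrix (Fin b) (Fin b) D) :
    index F A ≤ degree F D := by
  have : NeZero a := ⟨ha⟩
  have : NeZero b := ⟨hb⟩
  have h1 := mul_degree_eq_of_matrix_algEquiv e
  have h2 : a * rightDim F A = b * rightDim F D := by
    rw [← rightDim_matrix, ← rightDim_matrix]
    exact rightDim_congr e
  rw [rightDim_eq_index_mul_degree, rightDim_eq_index_mul_degree] at h2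
  have h3 : index F A = index F D := by
    refine Nat.eq_of_mul_eq_mul_left
      (Nat.mul_pos (Nat.pos_of_ne_zero ha) (degree_pos F A)) ?_
    calc a * degree F A * index F A = a * (index F A * degree F A) := by ring
      _ = b * (index F D * degree F D) := h2
      _ = (b * degree F D) * index F D := by ring
      _ = _ := by rw [h1]
  obtain ⟨E, _, _, m, ⟨f⟩, h⟩ := exists_index_eq (F := F) D
  obtain ⟨_, _, -, h4⟩ := degree_of_algEquiv_matrix f
  rw [h3, h, h4]
  exact Nat.le_mul_of_pos_left _ (NeZero.pos m)

end Brauer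

/-! ### Existence of flags over a field -/

section Flags

variable {F : Type u} [Field F] {A : Type u} [Ring A] [Algebra F A] {k : ℕ} {n : Fin k → ℕ}

/-- A right ideal as a module over the opposite algebra. -/
def RightIdealFlag.rightIdeal {R : Type u} [CommRing R] [Algebra F R] (J : RightIdealFlag (F := F) A n R)
    (i : Fin k) : Submodule (R ⊗[F] A)ᵐᵒᵖ (R ⊗[F] A) where
  toAddSubmonoid := (J.ideal i).toAddSubmonoid
  smul_mem' c x hx := J.mul_mem i x hx c.unop

theorem RightIdealFlag.finrank_ideal {R : Type u} [Field R] [Algebra F R]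
    (J : RightIdealFlag (F := F) A n R) (i : Fin k) :
    Module.finrank R (J.ideal i) = n i * degree F A := by
  rw [← J.rank_eq i ⊥, Module.rankAtStalk_eq_finrank_of_free]
  rfl

variable [IsSimpleRing A] [Algebra.IsCentral F A] [Module.Finite F A] (L : Type u) [Field L]
  [Algebra F L]

variable {L} in
theorem RightIdealFlag.rightDim_dvd (J : RightIdealFlag (F := F) A n L) (i : Fin k) :
    rightDim L (L ⊗[F] A) ∣ n i * degree F A := by
  have := isSimpleRing_tensor (F := F) A L
  have : Module.Finite L (J.rightIdeal i) := inferInstanceAs (Module.Finite L (J.ideal i))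
  have : Module.Finite (L ⊗[F] A)ᵐᵒᵖ (J.rightIdeal i) :=
    Module.Finite.of_restrictScalars_finite L _ _
  rw [← J.finrank_ideal i]
  exact simpleDim_dvd_finrank (L := L) (S := (L ⊗[F] A)ᵐᵒᵖ) (J.rightIdeal i)

/-- The required ideals are taken from one increasing chain of right ideals that realizes every
multiple of `rightDim` up to the dimension of the algebra. -/
theorem nonempty_rightIdealFlag (hn : Monotone n) (hle : ∀ i, n i ≤ degree F A)
    (hdvd : ∀ i, rightDim L (L ⊗[F] A) ∣ n i * degree F A) :
    Nonempty (RightIdealFlag (F := F) A n L) := by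
  have := isSimpleRing_tensor (F := F) A L
  have : Module.Finite (L ⊗[F] A)ᵐᵒᵖ (L ⊗[F] A) := Module.Finite.of_restrictScalars_finite L _ _
  obtain ⟨C, hC, hrank⟩ := exists_chain (L := L) (S := (L ⊗[F] A)ᵐᵒᵖ) (L ⊗[F] A)
  choose q hq using hdvd
  have hpos : 0 < rightDim L (L ⊗[F] A) := simpleDim_pos _ _
  have hr (i : Fin k) : Module.finrank L (C (q i)) = n i * degree F A := by
    rw [hq, mul_comm, hrank]
    · rfl
    · rw [mul_comm, Module.finrank_baseChange, finrank_eq_degree_sq (F := F) A]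
      exact (hq i).symm.le.trans (Nat.mul_le_mul_right _ (hle i))
  refine ⟨⟨fun i => (C (q i)).restrictScalars L, fun i x hx y => ?_, fun i => inferInstance,
    fun i p => ?_, fun i j hij => ?_⟩⟩
  · exact (C (q i)).smul_mem (MulOpposite.op y) hx
  · rw [Module.rankAtStalk_eq_finrank_of_free]
    exact hr i
  · refine hC (?_ : q i ≤ q j)
    refine Nat.le_of_mul_le_mul_left ?_ hpos
    rw [← hq, ← hq]
    exact Nat.mul_le_mul_right _ (hn hij)

end Flags

/-! ### Translation of flags by units -/

section Translate

variable {F : Type u} [Field F] {A : Type u} [Ring A] [Algebra F A] {k : ℕ} {n : Fin k → ℕ}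

/-- Left multiplication by a unit as a linear automorphism. -/
def mulLeftEquiv {R : Type u} [CommRing R] [Algebra F R] (g : (R ⊗[F] A)ˣ) :
    (R ⊗[F] A) ≃ₗ[R] R ⊗[F] A :=
  LinearEquiv.ofLinearMap (LinearMap.mulLeft R (g : R ⊗[F] A))
    (LinearMap.mulLeft R ((g⁻¹ : (R ⊗[F] A)ˣ) : R ⊗[F] A))
    (LinearMap.ext fun x => by simp) (LinearMap.ext fun x => by simp)

@[simp]
theorem mulLeftEquiv_apply {R : Type u} [CommRing R] [Algebra F R] (g : (R ⊗[F] A)ˣ)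
    (x : R ⊗[F] A) : mulLeftEquiv g x = g * x := rfl

/-- The translate of a flag by a unit of the algebra. -/
def RightIdealFlag.translate {R : Type u} [CommRing R] [Algebra F R]
    (J : RightIdealFlag (F := F) A n R) (g : (R ⊗[F] A)ˣ) : RightIdealFlag (F := F) A n R where
  ideal i := (J.ideal i).map (mulLeftEquiv g).toLinearMap
  mul_mem i := by
    rintro _ ⟨x, hx, rfl⟩ y
    exact ⟨x * y, J.mul_mem i x hx y, (mul_assoc _ _ _).symm⟩
  projective_quotient i := by
    have := J.projective_quotient i
    exact Module.Projective.of_equiv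
      (Submodule.Quotient.equiv _ _ (mulLeftEquiv g) rfl)
  rank_eq i p := by
    rw [← J.rank_eq i p]
    exact (Module.rankAtStalk_eq_of_equiv ((mulLeftEquiv g).submoduleMap (J.ideal i))).symm ▸ rfl
  monotone _ _ h := Submodule.map_mono (J.monotone h)

theorem RightIdealFlag.translate_ideal {R : Type u} [CommRing R] [Algebra F R]
    (J : RightIdealFlag (F := F) A n R) (g : (R ⊗[F] A)ˣ) (i : Fin k) :
    (J.translate g).ideal i = (J.ideal i).map (mulLeftEquiv g).toLinearMap := rfl

theorem extendScalars_map_mulLeftEquiv {R S : Type u} [CommRing R] [Algebra F R] [CommRing S]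
    [Algebra F S] (f : R →ₐ[F] S) (g : (R ⊗[F] A)ˣ) (I : Submodule R (R ⊗[F] A)) :
    extendScalars f (I.map (mulLeftEquiv g).toLinearMap) =
      (extendScalars f I).map (mulLeftEquiv (Units.map
        (Algebra.TensorProduct.map f (AlgHom.id F A)).toMonoidHom g)).toLinearMap := by
  rw [extendScalars, extendScalars, Submodule.map_span]
  congr 1
  ext x
  simp only [Set.mem_image, SetLike.mem_coe, Submodule.mem_map]
  constructor
  · rintro ⟨_, ⟨y, hy, rfl⟩, rfl⟩
    exact ⟨_, ⟨y, hy, rfl⟩, (map_mul (Algebra.TensorProduct.map f (AlgHom.id F A)) _ _).symm⟩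
  · rintro ⟨_, ⟨y, hy, rfl⟩, rfl⟩
    exact ⟨_, ⟨y, hy, rfl⟩, map_mul (Algebra.TensorProduct.map f (AlgHom.id F A)) _ _⟩

variable [IsSimpleRing A] [Algebra.IsCentral F A] [Module.Finite F A]

/-- Over a field, two flags of the same type are translates of each other. -/
theorem exists_translate_eq_of_field {L : Type u} [Field L] [Algebra F L]
    (J J' : RightIdealFlag (F := F) A n L) : ∃ g : (L ⊗[F] A)ˣ, J.translate g = J' := by
  have := isSimpleRing_tensor (F := F) A L
  have : IsArtinianRing (L ⊗[F] A)ᵐᵒᵖ := IsArtinianRing.of_finite L _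
  have hfin (X : Submodule (L ⊗[F] A)ᵐᵒᵖ (L ⊗[F] A)) : Module.Finite (L ⊗[F] A)ᵐᵒᵖ X := by
    have : Module.Finite L X := inferInstanceAs (Module.Finite L (X.restrictScalars L))
    exact Module.Finite.of_restrictScalars_finite L _ _
  have hc (X : Submodule (L ⊗[F] A)ᵐᵒᵖ (L ⊗[F] A)) : IsComplemented X := exists_isCompl X
  obtain ⟨e, he⟩ := exists_linearEquiv_of_fin_chains (S := (L ⊗[F] A)ᵐᵒᵖ) (M := L ⊗[F] A)
    (fun X => Module.finrank L X)
    (fun X X' _ _ h => nonempty_linearEquiv_of_finrank_eq (L := L) h)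
    (fun X Y h _ _ => by
      have h1 := Submodule.finrank_sup_add_finrank_inf_eq (X.restrictScalars L)
        (Y.restrictScalars L)
      rw [← Submodule.restrictScalars_inf, h.eq_bot, Submodule.restrictScalars_bot, finrank_bot,
        add_zero, ← Submodule.restrictScalars_sup] at h1
      exact h1)
    (fun e X => ((e.submoduleMap X).restrictScalars L).finrank_eq.symm)
    (U := J.rightIdeal) (U' := J'.rightIdeal) (fun _ => hc _) (fun _ => hc _)
    (fun i j h => J.monotone h) (fun i j h => J'.monotone h)
    (fun i => (J.finrank_ideal i).trans (J'.finrank_ideal i).symm)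
  -- An automorphism of the algebra as a right module over itself is left multiplication by the
  -- image of `1`.
  have h1 (e : (L ⊗[F] A) ≃ₗ[(L ⊗[F] A)ᵐᵒᵖ] L ⊗[F] A) (x : L ⊗[F] A) : e x = e 1 * x := by
    have := e.map_smul (MulOpposite.op x) 1
    simpa using this
  refine ⟨⟨e 1, e.symm 1, ?_, ?_⟩, RightIdealFlag.ext' fun i => ?_⟩
  · rw [← h1, e.apply_symm_apply]
  · rw [← h1, e.symm_apply_apply]
  · ext x
    have h2 : x ∈ (J.rightIdeal i).map e.toLinearMap ↔ x ∈ J'.ideal i := by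
      rw [he i]
      rfl
    rw [← h2]
    constructor
    · rintro ⟨y, hy, rfl⟩
      exact ⟨y, hy, h1 e y⟩
    · rintro ⟨y, hy, rfl⟩
      exact ⟨y, hy, (h1 e y).symm⟩

end Translate

/-! ### Right ideals of matrix algebras and their modules of columns -/

section Columns

variable {R : Type u} [CommRing R] {N : ℕ} [NeZero N]

variable (R N) in
/-- A vector as the first column of a matrix whose other columns vanish. -/
def firstColumn : (Fin N → R) →ₗ[R] Matrix (Fin N) (Fin N) R where
  toFun v := Matrix.of fun i j => if j = 0 then v i else 0
  map_add' v w := by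
    ext i j
    by_cases hj : j = 0 <;> simp [hj]
  map_smul' r v := by
    ext i j
    by_cases hj : j = 0 <;> simp [hj]

theorem firstColumn_apply (v : Fin N → R) (i j : Fin N) :
    firstColumn R N v i j = if j = 0 then v i else 0 := rfl

theorem mul_single_eq_firstColumn (X : Matrix (Fin N) (Fin N) R) (j : Fin N) :
    X * Matrix.single j 0 1 = firstColumn R N (fun i => X i j) := by
  ext i l
  rw [firstColumn_apply, Matrix.mul_apply]
  by_cases hl : l = 0
  · subst hl
    simp [Matrix.single_apply]
  · simp [hl, Ne.symm hl]

theorem sum_firstColumn_mul_single (X : Matrix (Fin N) (Fin N) R) :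
    ∑ j, firstColumn R N (fun i => X i j) * Matrix.single 0 j 1 = X := by
  ext i l
  rw [Matrix.sum_apply]
  simp only [Matrix.mul_apply, firstColumn_apply, Matrix.single_apply]
  rw [Finset.sum_eq_single l (fun j _ hj => Finset.sum_eq_zero fun c _ => by simp [hj])
    (fun h => (h (Finset.mem_univ l)).elim),
    Finset.sum_eq_single 0 (fun c _ hc => by simp [hc]) (fun h => (h (Finset.mem_univ 0)).elim)]
  simp

/-- A right ideal of a matrix algebra consists of the matrices with columns in a submodule. -/
theorem mem_iff_forall_column {I : Submodule R (Matrix (Fin N) (Fin N) R)}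
    (hI : ∀ x ∈ I, ∀ y, x * y ∈ I) (X : Matrix (Fin N) (Fin N) R) :
    X ∈ I ↔ ∀ j, (fun i => X i j) ∈ I.comap (firstColumn R N) := by
  constructor
  · intro hX j
    rw [Submodule.mem_comap, ← mul_single_eq_firstColumn]
    exact hI X hX _
  · intro h
    rw [← sum_firstColumn_mul_single X]
    exact I.sum_mem fun j _ => hI _ (h j) _

/-- A right ideal as a power of its module of columns. -/
def columnsEquiv {I : Submodule R (Matrix (Fin N) (Fin N) R)}
    (hI : ∀ x ∈ I, ∀ y, x * y ∈ I) : I ≃ₗ[R] (Fin N → I.comap (firstColumn R N)) where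
  toFun X j := ⟨fun i => X.1 i j, (mem_iff_forall_column hI X.1).1 X.2 j⟩
  map_add' _ _ := rfl
  map_smul' _ _ := rfl
  invFun v := ⟨Matrix.of fun i j => (v j).1 i, (mem_iff_forall_column hI _).2 fun j => (v j).2⟩
  left_inv _ := rfl
  right_inv _ := rfl

/-- Place a vector in the first column, retract onto `I` and read off the first column again: this
is a projection onto the module of columns. -/
theorem isComplemented_comap_firstColumn {I : Submodule R (Matrix (Fin N) (Fin N) R)}
    (hI : ∀ x ∈ I, ∀ y, x * y ∈ I)
    (hq : Module.Projective R (Matrix (Fin N) (Fin N) R ⧸ I)) :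
    IsComplemented (I.comap (firstColumn R N)) := by
  obtain ⟨π, hπ⟩ := exists_isCompl_of_projective_quotient I
  let p : (Fin N → R) →ₗ[R] I.comap (firstColumn R N) :=
    ((LinearMap.proj 0).comp (columnsEquiv hI).toLinearMap).comp (π.comp (firstColumn R N))
  refine ⟨LinearMap.ker p, LinearMap.isCompl_of_proj fun w => ?_⟩
  have : π (firstColumn R N w.1) = ⟨firstColumn R N w.1, w.2⟩ := hπ ⟨_, w.2⟩
  refine Subtype.ext ?_
  change (fun i => (π (firstColumn R N w.1)).1 i 0) = w.1
  rw [this]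
  ext i
  simp [firstColumn_apply]

end Columns

/-! ### Conjugacy of flags over local rings -/

section Local

variable {R : Type u} [CommRing R] [IsLocalRing R]

theorem finite_free_of_isComplemented {M : Type u} [AddCommGroup M] [Module R M] [Module.Finite R M]
    [Module.Free R M] {W : Submodule R M} (hW : IsComplemented W) :
    Module.Finite R W ∧ Module.Free R W := by
  obtain ⟨V, hV⟩ := hW
  have h1 : Module.Finite R W := Module.Finite.of_surjective (W.projectionOnto V hV)
    (Submodule.projectionOnto_surjective hV)
  have h2 : Module.Projective R W := Module.Projective.of_split W.subtype (W.projectionOnto V hV)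
    (LinearMap.ext fun x => Submodule.projectionOnto_apply_left hV x)
  exact ⟨h1, Module.free_of_flat_of_isLocalRing⟩

/-- Chains of direct summands of a finite free module over a local ring are conjugate. -/
theorem exists_linearEquiv_of_chains_of_isLocalRing {M : Type u} [AddCommGroup M] [Module R M]
    [Module.Finite R M] [Module.Free R M] {k : ℕ} {U U' : Fin k → Submodule R M}
    (hU : ∀ i, IsComplemented (U i)) (hU' : ∀ i, IsComplemented (U' i)) (hm : Monotone U)
    (hm' : Monotone U') (hrank : ∀ i, Module.finrank R (U i) = Module.finrank R (U' i)) :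
    ∃ e : M ≃ₗ[R] M, ∀ i, (U i).map e.toLinearMap = U' i := by
  refine exists_linearEquiv_of_fin_chains (fun X => Module.finrank R X) (fun X X' hX hX' h => ?_)
    (fun X Y h hX hY => ?_) (fun e X => (e.submoduleMap X).finrank_eq.symm) hU hU' hm hm' hrank
  · obtain ⟨_, _⟩ := finite_free_of_isComplemented hX
    obtain ⟨_, _⟩ := finite_free_of_isComplemented hX'
    exact ⟨LinearEquiv.ofFinrankEq _ _ h⟩
  · obtain ⟨_, _⟩ := finite_free_of_isComplemented hX
    obtain ⟨_, _⟩ := finite_free_of_isComplemented hY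
    have hinj : Function.Injective (X.subtype.coprod Y.subtype) := by
      rw [← LinearMap.ker_eq_bot]
      refine LinearMap.ker_eq_bot'.2 fun ⟨x, y⟩ hxy => ?_
      have h1 : (x : M) + y = 0 := hxy
      have h2 : (x : M) = -y := eq_neg_of_add_eq_zero_left h1
      have h3 : (x : M) = 0 := (Submodule.disjoint_def.1 h) _ x.2 (h2 ▸ Y.neg_mem y.2)
      have h4 : (y : M) = 0 := by rwa [h3, zero_add] at h1
      exact Prod.ext (Subtype.ext h3) (Subtype.ext h4)
    have e := LinearEquiv.ofInjective _ hinj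
    rw [LinearMap.range_coprod, Submodule.range_subtype, Submodule.range_subtype] at e
    rw [← e.finrank_eq, Module.finrank_prod]

variable {N : ℕ} [NeZero N]

/-- Chains of right ideals of a matrix algebra over a local ring are conjugate. -/
theorem exists_mul_of_chains_of_isLocalRing {k : ℕ}
    {I I' : Fin k → Submodule R (Matrix (Fin N) (Fin N) R)}
    (hI : ∀ i, ∀ x ∈ I i, ∀ y, x * y ∈ I i) (hI' : ∀ i, ∀ x ∈ I' i, ∀ y, x * y ∈ I' i)
    (hq : ∀ i, Module.Projective R (Matrix (Fin N) (Fin N) R ⧸ I i))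
    (hq' : ∀ i, Module.Projective R (Matrix (Fin N) (Fin N) R ⧸ I' i))
    (hm : Monotone I) (hm' : Monotone I')
    (hrank : ∀ i, Module.finrank R (I i) = Module.finrank R (I' i)) :
    ∃ G : (Matrix (Fin N) (Fin N) R)ˣ, ∀ i X, X ∈ I i ↔ G * X ∈ I' i := by
  have hW (i) := isComplemented_comap_firstColumn (hI i) (hq i)
  have hW' (i) := isComplemented_comap_firstColumn (hI' i) (hq' i)
  obtain ⟨e, he⟩ := exists_linearEquiv_of_chains_of_isLocalRing (M := Fin N → R) hW hW'
    (fun i j h => Submodule.comap_mono (hm h)) (fun i j h => Submodule.comap_mono (hm' h))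
    (fun i => by
      have h := hrank i
      obtain ⟨_, _⟩ := finite_free_of_isComplemented (hW i)
      obtain ⟨_, _⟩ := finite_free_of_isComplemented (hW' i)
      rw [(columnsEquiv (hI i)).finrank_eq, (columnsEquiv (hI' i)).finrank_eq,
        Module.finrank_pi_fintype, Module.finrank_pi_fintype] at h
      simpa [NeZero.ne N] using h)
  -- An automorphism of `R ^ N` matching the column modules acts on matrices column by column, so
  -- its matrix matches the right ideals.
  let G : (Matrix (Fin N) (Fin N) R)ˣ :=
    ⟨LinearMap.toMatrix' e.toLinearMap, LinearMap.toMatrix' e.symm.toLinearMap,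
      by rw [← LinearMap.toMatrix'_mul]; simp [Module.End.mul_eq_comp],
      by rw [← LinearMap.toMatrix'_mul]; simp [Module.End.mul_eq_comp]⟩
  refine ⟨G, fun i X => ?_⟩
  rw [mem_iff_forall_column (hI i), mem_iff_forall_column (hI' i)]
  refine forall_congr' fun j => ?_
  have h1 : (fun l => ((G : Matrix (Fin N) (Fin N) R) * X) l j) = e (fun l => X l j) := by
    have := LinearMap.toMatrix'_mulVec e.toLinearMap (fun l => X l j)
    exact this
  rw [h1, ← he i]
  constructor
  · intro h
    exact ⟨_, h, rfl⟩
  · rintro ⟨w, hw, hwe⟩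
    exact e.injective hwe ▸ hw

variable {F : Type u} [Field F] [Algebra F R] {A : Type u} [Ring A] [Algebra F A]
  [Module.Finite F A] {k : ℕ} {n : Fin k → ℕ}

theorem RightIdealFlag.finrank_ideal_of_isLocalRing (J : RightIdealFlag (F := F) A n R)
    (i : Fin k) : Module.finrank R (J.ideal i) = n i * degree F A := by
  have := J.projective_quotient i
  have := projective_of_projective_quotient (J.ideal i)
  have := finite_of_projective_quotient (J.ideal i)
  have : Module.Free R (J.ideal i) := Module.free_of_flat_of_isLocalRing
  rw [← J.rank_eq i (IsLocalRing.closedPoint R), Module.rankAtStalk_eq_finrank_of_free]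
  rfl

/-- Over a local ring over which the algebra splits, two flags of the same type are translates of
each other. -/
theorem exists_translate_eq_of_isLocalRing (θ : (R ⊗[F] A) ≃ₐ[R] Matrix (Fin N) (Fin N) R)
    (J J' : RightIdealFlag (F := F) A n R) : ∃ g : (R ⊗[F] A)ˣ, J.translate g = J' := by
  have hmul (J : RightIdealFlag (F := F) A n R) (i : Fin k) :
      ∀ x ∈ (J.ideal i).map θ.toLinearMap, ∀ y, x * y ∈ (J.ideal i).map θ.toLinearMap := by
    rintro _ ⟨x, hx, rfl⟩ y
    refine ⟨x * θ.symm y, J.mul_mem i x hx _, ?_⟩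
    change θ (x * θ.symm y) = θ x * y
    rw [map_mul, θ.apply_symm_apply]
  have hq (J : RightIdealFlag (F := F) A n R) (i : Fin k) :
      Module.Projective R (Matrix (Fin N) (Fin N) R ⧸ (J.ideal i).map θ.toLinearMap) := by
    have := J.projective_quotient i
    exact Module.Projective.of_equiv (Submodule.Quotient.equiv _ _ θ.toLinearEquiv rfl)
  have hr (J : RightIdealFlag (F := F) A n R) (i : Fin k) :
      Module.finrank R ((J.ideal i).map θ.toLinearMap) = n i * degree F A := by
    rw [← J.finrank_ideal_of_isLocalRing i]
    exact (θ.toLinearEquiv.submoduleMap (J.ideal i)).finrank_eq.symm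
  obtain ⟨G, hG⟩ := exists_mul_of_chains_of_isLocalRing (hmul J) (hmul J') (hq J) (hq J')
    (fun i j h => Submodule.map_mono (J.monotone h))
    (fun i j h => Submodule.map_mono (J'.monotone h)) (fun i => (hr J i).trans (hr J' i).symm)
  let g : (R ⊗[F] A)ˣ := Units.map θ.symm.toRingEquiv.toRingHom.toMonoidHom G
  have hg (x : R ⊗[F] A) : θ (g * x) = G * θ x := by
    rw [map_mul]
    congr 1
    exact θ.apply_symm_apply _
  have hmem (J : RightIdealFlag (F := F) A n R) (i : Fin k) (x : R ⊗[F] A) :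
      θ x ∈ (J.ideal i).map θ.toLinearMap ↔ x ∈ J.ideal i :=
    ⟨fun ⟨_, hy, h⟩ => θ.injective h ▸ hy, fun h => ⟨x, h, rfl⟩⟩
  refine ⟨g, RightIdealFlag.ext' fun i => ?_⟩
  ext x
  have key (y : R ⊗[F] A) : y ∈ J.ideal i ↔ g * y ∈ J'.ideal i := by
    rw [← hmem J, ← hmem J', hG i, hg]
  constructor
  · rintro ⟨y, hy, rfl⟩
    exact (key y).1 hy
  · intro hx
    refine ⟨(g⁻¹ : (R ⊗[F] A)ˣ) * x, (key _).2 ?_, ?_⟩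
    · rwa [Units.mul_inv_cancel_left]
    · exact Units.mul_inv_cancel_left _ _

end Local

/-! ### Norms and generic units -/

section Norm
set_option linter.unusedSectionVars false

variable {F : Type u} [Field F] (A : Type u) [Ring A] [Algebra F A] [Module.Finite F A]

/-- If the determinant of left multiplication by `x` is a unit, that map is bijective. Surjectivity
gives a right inverse of `x`, and injectivity makes it two-sided. -/
theorem isUnit_iff_isUnit_norm {R B : Type u} [CommRing R] [Ring B] [Algebra R B]
    [Module.Finite R B] [Module.Free R B] (x : B) : IsUnit x ↔ IsUnit (Algebra.norm R x) := by
  refine ⟨fun h => h.map _, fun h => ?_⟩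
  have h1 : IsUnit (LinearMap.mulLeft R x) := (LinearMap.isUnit_iff_isUnit_det _).2 h
  have h2 := (Module.End.isUnit_iff _).1 h1
  obtain ⟨y, hy⟩ := h2.2 1
  refine ⟨⟨x, y, hy, h2.1 ?_⟩, rfl⟩
  have hy' : x * y = 1 := hy
  change x * (y * x) = x * 1
  rw [← mul_assoc, hy', one_mul, mul_one]

variable {A} in
theorem map_id_map_id {R S T : Type u} [CommRing R] [Algebra F R] [CommRing S] [Algebra F S]
    [CommRing T] [Algebra F T] (f : R →ₐ[F] S) (g : S →ₐ[F] T) (x : R ⊗[F] A) :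
    Algebra.TensorProduct.map g (AlgHom.id F A) (Algebra.TensorProduct.map f (AlgHom.id F A) x) =
      Algebra.TensorProduct.map (g.comp f) (AlgHom.id F A) x := by
  induction x with
  | zero => simp
  | add x y hx hy => rw [map_add, map_add, map_add, hx, hy]
  | tmul r a => simp

variable {A} in
-- In a basis coming from `A`, the matrix of left multiplication is obtained by applying `f` to its
-- entries.
theorem norm_map {R S : Type u} [CommRing R] [Algebra F R] [CommRing S] [Algebra F S]
    (f : R →ₐ[F] S) (x : R ⊗[F] A) :
    Algebra.norm S (Algebra.TensorProduct.map f (AlgHom.id F A) x) = f (Algebra.norm R x) := by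
  let b := Module.finBasis F A
  have key : Algebra.leftMulMatrix (b.baseChange S)
      (Algebra.TensorProduct.map f (AlgHom.id F A) x) =
      (Algebra.leftMulMatrix (b.baseChange R) x).map f := by
    have htmul {T : Type u} [CommRing T] [Algebra F T] (t : T) (a : A) (i j) :
        Algebra.leftMulMatrix (b.baseChange T) (t ⊗ₜ[F] a) i j =
          t * algebraMap F T (Algebra.leftMulMatrix b a i j) := by
      rw [Algebra.leftMulMatrix_eq_repr_mul, Algebra.leftMulMatrix_eq_repr_mul,
        Module.Basis.baseChange_apply, Algebra.TensorProduct.tmul_mul_tmul, mul_one,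
        Module.Basis.baseChange_repr_tmul, Algebra.smul_def, mul_comm]
    induction x with
    | zero =>
      ext i j
      simp
    | add x y hx hy =>
      ext i j
      simp only [map_add, hx, hy, Matrix.add_apply, Matrix.map_apply]
    | tmul r a =>
      ext i j
      rw [Algebra.TensorProduct.map_tmul, htmul, Matrix.map_apply, htmul]
      simp
  rw [Algebra.norm_eq_matrix_det (b.baseChange S), Algebra.norm_eq_matrix_det (b.baseChange R),
    key]
  exact (RingHom.map_det (f : R →+* S) _).symm

variable (F) in
/-- The element of `R ⊗ A` with prescribed coordinates. -/
def ofCoords (R : Type u) [CommRing R] [Algebra F R] (v : Fin (Module.finrank F A) → R) : R ⊗[F] A :=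
  ∑ i, v i ⊗ₜ[F] Module.finBasis F A i

theorem map_ofCoords {R S : Type u} [CommRing R] [Algebra F R] [CommRing S] [Algebra F S]
    (f : R →ₐ[F] S) (v : Fin (Module.finrank F A) → R) :
    Algebra.TensorProduct.map f (AlgHom.id F A) (ofCoords F A R v) =
      ofCoords F A S (fun i => f (v i)) := by
  simp [ofCoords]

theorem exists_ofCoords_eq {R : Type u} [CommRing R] [Algebra F R] (x : R ⊗[F] A) :
    ∃ v, ofCoords F A R v = x := by
  refine ⟨((Module.finBasis F A).baseChange R).repr x, ?_⟩
  conv_rhs => rw [← ((Module.finBasis F A).baseChange R).sum_repr x]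
  refine Finset.sum_congr rfl fun i _ => ?_
  rw [Module.Basis.baseChange_apply, smul_tmul', smul_eq_mul, mul_one]

variable (D : Type u) [Ring D] [Algebra F D] [Module.Finite F D]

/-- Pairs of units in `A` and `D` are specializations of a generic pair, defined over a domain. -/
theorem exists_generic_units (K : Type u) [Field K] [Algebra F K] :
    ∃ (Γ : Type u) (_ : CommRing Γ) (_ : IsDomain Γ) (_ : Algebra K Γ) (_ : Algebra F Γ)
      (_ : IsScalarTower F K Γ) (g : (Γ ⊗[F] A)ˣ) (h : (Γ ⊗[F] D)ˣ),
      ∀ (R : Type u) [CommRing R] [Algebra K R] [Algebra F R] [IsScalarTower F K R]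
        (u : (R ⊗[F] A)ˣ) (v : (R ⊗[F] D)ˣ), ∃ φ : Γ →ₐ[K] R,
          Units.map (Algebra.TensorProduct.map (φ.restrictScalars F)
            (AlgHom.id F A)).toMonoidHom g = u ∧
          Units.map (Algebra.TensorProduct.map (φ.restrictScalars F)
            (AlgHom.id F D)).toMonoidHom h = v := by
  let P := MvPolynomial (Fin (Module.finrank F A) ⊕ Fin (Module.finrank F D)) K
  let x : P ⊗[F] A := ofCoords F A P fun i => MvPolynomial.X (.inl i)
  let y : P ⊗[F] D := ofCoords F D P fun i => MvPolynomial.X (.inr i)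
  -- The elements `x` and `y` have independent variables as coordinates; inverting `q`, the product
  -- of their norms, makes both of them units.
  let q : P := Algebra.norm P x * Algebra.norm P y
  have key (R : Type u) [CommRing R] [Algebra K R] [Algebra F R] [IsScalarTower F K R]
      (u : R ⊗[F] A) (v : R ⊗[F] D) : ∃ ψ : P →ₐ[K] R,
        Algebra.TensorProduct.map (ψ.restrictScalars F) (AlgHom.id F A) x = u ∧
        Algebra.TensorProduct.map (ψ.restrictScalars F) (AlgHom.id F D) y = v := by
    obtain ⟨a, ha⟩ := exists_ofCoords_eq A u
    obtain ⟨b, hb⟩ := exists_ofCoords_eq D v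
    refine ⟨MvPolynomial.aeval (Sum.elim a b), ?_, ?_⟩
    · rw [map_ofCoords, ← ha]
      exact congrArg _ (funext fun i => MvPolynomial.aeval_X _ _)
    · rw [map_ofCoords, ← hb]
      exact congrArg _ (funext fun i => MvPolynomial.aeval_X _ _)
  have hq (R : Type u) [CommRing R] [Algebra K R] [Algebra F R] [IsScalarTower F K R]
      (u : (R ⊗[F] A)ˣ) (v : (R ⊗[F] D)ˣ) (ψ : P →ₐ[K] R)
      (hu : Algebra.TensorProduct.map (ψ.restrictScalars F) (AlgHom.id F A) x = u)
      (hv : Algebra.TensorProduct.map (ψ.restrictScalars F) (AlgHom.id F D) y = v) :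
      IsUnit (ψ q) := by
    have h1 := norm_map (ψ.restrictScalars F) x
    have h2 := norm_map (ψ.restrictScalars F) y
    rw [hu] at h1
    rw [hv] at h2
    have h3 : ψ q = Algebra.norm R (u : R ⊗[F] A) * Algebra.norm R (v : R ⊗[F] D) := by
      rw [h1, h2]
      exact map_mul ψ _ _
    rw [h3]
    exact (u.isUnit.map _).mul (v.isUnit.map _)
  -- Specializing both generic elements to `1` makes `q` a unit; thus inverting `q` leaves a domain.
  have hq0 : q ≠ 0 := fun h0 => by
    obtain ⟨ψ, h1, h2⟩ := key K 1 1
    have := hq K 1 1 ψ h1 h2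
    rw [h0, map_zero] at this
    exact not_isUnit_zero this
  have hdom : IsDomain (Localization.Away q) :=
    IsLocalization.isDomain_localization (powers_le_nonZeroDivisors_of_noZeroDivisors hq0)
  have hunit : IsUnit (awayHom F q q) := IsLocalization.Away.algebraMap_isUnit q
  have h1 : IsUnit (Algebra.TensorProduct.map (awayHom F q) (AlgHom.id F A) x) := by
    rw [isUnit_iff_isUnit_norm (R := Localization.Away q), norm_map]
    exact isUnit_of_dvd_unit (map_dvd (awayHom F q) (dvd_mul_right _ _)) hunit
  have h2 : IsUnit (Algebra.TensorProduct.map (awayHom F q) (AlgHom.id F D) y) := by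
    rw [isUnit_iff_isUnit_norm (R := Localization.Away q), norm_map]
    exact isUnit_of_dvd_unit (map_dvd (awayHom F q) (dvd_mul_left _ _)) hunit
  refine ⟨Localization.Away q, inferInstance, hdom, inferInstance, inferInstance, inferInstance,
    h1.unit, h2.unit, fun R _ _ _ _ u v => ?_⟩
  obtain ⟨ψ, hu, hv⟩ := key R u v
  obtain ⟨φ, hφ⟩ := exists_away_lift (f := q) ψ (hq R u v ψ hu hv)
  have hφ' : (φ.restrictScalars F).comp (awayHom F q) = ψ.restrictScalars F :=
    AlgHom.ext fun z => DFunLike.congr_fun hφ z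
  refine ⟨φ, Units.ext ?_, Units.ext ?_⟩
  · rw [← hu, ← hφ']
    exact map_id_map_id _ _ x
  · rw [← hv, ← hφ']
    exact map_id_map_id _ _ y

end Norm

/-! ### The scheme of pairs of flags and a generic point of it -/

section PairRepresentation

variable {F : Type u} [Field F] (A : Type u) [Ring A] [Algebra F A] {k : ℕ} (n : Fin k → ℕ)
  (D : Type u) [Ring D] [Algebra F D] {l : ℕ} (m : Fin l → ℕ)

/-- A representation of the functor of pairs of flags by a scheme. -/
structure PairRepresentation (Z : Over (Spec (.of F))) where
  /-- The universal bijection. -/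
  equiv : ∀ (R : Type u) [CommRing R] [Algebra F R],
    Points Z R ≃ RightIdealFlag (F := F) A n R × RightIdealFlag (F := F) D m R
  fst_ideal : ∀ (R S : Type u) [CommRing R] [Algebra F R] [CommRing S] [Algebra F S] (f : R →ₐ[F] S)
    (x : Points Z R) (i : Fin k),
    (equiv S (specOverMap f ≫ x)).1.ideal i = extendScalars f ((equiv R x).1.ideal i)
  snd_ideal : ∀ (R S : Type u) [CommRing R] [Algebra F R] [CommRing S] [Algebra F S] (f : R →ₐ[F] S)
    (x : Points Z R) (i : Fin l),
    (equiv S (specOverMap f ≫ x)).2.ideal i = extendScalars f ((equiv R x).2.ideal i)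

variable {A n D m} {Z : Over (Spec (.of F))} (ρ : PairRepresentation (F := F) A n D m Z)

namespace PairRepresentation

/-- The translate of a point by a pair of units. -/
def translate {R : Type u} [CommRing R] [Algebra F R] (x : Points Z R) (g : (R ⊗[F] A)ˣ)
    (h : (R ⊗[F] D)ˣ) : Points Z R :=
  (ρ.equiv R).symm ((ρ.equiv R x).1.translate g, (ρ.equiv R x).2.translate h)

theorem equiv_translate {R : Type u} [CommRing R] [Algebra F R] (x : Points Z R)
    (g : (R ⊗[F] A)ˣ) (h : (R ⊗[F] D)ˣ) : ρ.equiv R (ρ.translate x g h) =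
      ((ρ.equiv R x).1.translate g, (ρ.equiv R x).2.translate h) :=
  (ρ.equiv R).apply_symm_apply _

theorem specOverMap_translate {R S : Type u} [CommRing R] [Algebra F R] [CommRing S] [Algebra F S]
    (f : R →ₐ[F] S) (x : Points Z R) (g : (R ⊗[F] A)ˣ) (h : (R ⊗[F] D)ˣ) :
    specOverMap f ≫ ρ.translate x g h = ρ.translate (specOverMap f ≫ x)
      (Units.map (Algebra.TensorProduct.map f (AlgHom.id F A)).toMonoidHom g)
      (Units.map (Algebra.TensorProduct.map f (AlgHom.id F D)).toMonoidHom h) := by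
  apply (ρ.equiv S).injective
  rw [equiv_translate]
  refine Prod.ext (RightIdealFlag.ext' fun i => ?_) (RightIdealFlag.ext' fun i => ?_)
  · rw [fst_ideal, equiv_translate, RightIdealFlag.translate_ideal, RightIdealFlag.translate_ideal,
      extendScalars_map_mulLeftEquiv, fst_ideal]
  · rw [snd_ideal, equiv_translate, RightIdealFlag.translate_ideal, RightIdealFlag.translate_ideal,
      extendScalars_map_mulLeftEquiv, snd_ideal]

end PairRepresentation

section Split

variable [IsSimpleRing A] [Algebra.IsCentral F A] [Module.Finite F A]

variable (A) in
/-- A central simple algebra splits over every algebra over an algebraic closure. -/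
theorem exists_splitting (K : Type u) [Field K] [Algebra F K] [IsAlgClosed K] :
    ∃ N : ℕ, NeZero N ∧ N = degree F A ∧ ∀ (R : Type u) [CommRing R] [Algebra K R] [Algebra F R]
      [IsScalarTower F K R], Nonempty ((R ⊗[F] A) ≃ₐ[R] Matrix (Fin N) (Fin N) R) := by
  have := isSimpleRing_tensor (F := F) A K
  obtain ⟨N, hN, ⟨e⟩⟩ := IsSimpleRing.exists_algEquiv_matrix_of_isAlgClosed K (K ⊗[F] A)
  refine ⟨N, hN, ?_, fun R _ _ _ _ => ⟨?_⟩⟩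
  · have h : Module.finrank F A = N * N := by
      rw [← Module.finrank_baseChange (R := K), e.toLinearEquiv.finrank_eq, Module.finrank_matrix]
      simp
    rw [degree, h, Nat.sqrt_eq]
  · let c : R ⊗[F] A ≃ₐ[R] R ⊗[K] (K ⊗[F] A) := AlgEquiv.ofLinearEquiv
      (TensorProduct.AlgebraTensorModule.cancelBaseChange F K R R A).symm
      (by simp [Algebra.TensorProduct.one_def])
      (LinearMap.map_mul_of_map_mul_tmul (fun _ _ _ _ => by simp))
    exact c.trans
      ((Algebra.TensorProduct.congr (AlgEquiv.refl (R := R) (A₁ := R)) e).trans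
        ((tensorMatrixEquiv R K N K).trans (Algebra.TensorProduct.rid K R R).mapMatrix))

theorem nonempty_rightIdealFlag_of_isAlgClosed (K : Type u) [Field K] [Algebra F K] [IsAlgClosed K]
    (hn : Monotone n) (hle : ∀ i, n i ≤ degree F A) :
    Nonempty (RightIdealFlag (F := F) A n K) := by
  have := isSimpleRing_tensor (F := F) A K
  obtain ⟨N, _, hN, h⟩ := exists_splitting (F := F) A K
  obtain ⟨e⟩ := h K
  refine nonempty_rightIdealFlag K hn hle fun i => Dvd.dvd.mul_left ?_ _
  have := rightDim_dvd_of_algEquiv_matrix K e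
  rwa [Module.finrank_self, mul_one, hN] at this

end Split

variable [IsSimpleRing A] [Algebra.IsCentral F A] [Module.Finite F A]
  [IsSimpleRing D] [Algebra.IsCentral F D] [Module.Finite F D]

namespace PairRepresentation

include ρ in
/-- Over local algebras over an algebraic closure, all points factor through one morphism from the
spectrum of a domain. -/
theorem exists_dominating_point (hn : Monotone n) (hle : ∀ i, n i ≤ degree F A) (hm : Monotone m)
    (hle' : ∀ i, m i ≤ degree F D) (K : Type u) [Field K] [Algebra F K] [IsAlgClosed K] :
    ∃ (Γ : Type u) (_ : CommRing Γ) (_ : IsDomain Γ) (_ : Algebra F Γ) (γ : Points Z Γ),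
      ∀ (R : Type u) [CommRing R] [IsLocalRing R] [Algebra K R] [Algebra F R] [IsScalarTower F K R]
        (x : Points Z R), ∃ φ : Γ →ₐ[F] R, specOverMap φ ≫ γ = x := by
  obtain ⟨J⟩ := nonempty_rightIdealFlag_of_isAlgClosed (F := F) (A := A) K hn hle
  obtain ⟨J'⟩ := nonempty_rightIdealFlag_of_isAlgClosed (F := F) (A := D) K hm hle'
  obtain ⟨N, _, -, hN⟩ := exists_splitting (F := F) A K
  obtain ⟨N', _, -, hN'⟩ := exists_splitting (F := F) D K
  obtain ⟨Γ, _, _, _, _, _, g, h, hgh⟩ := exists_generic_units (F := F) A D K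
  let z₀ : Points Z K := (ρ.equiv K).symm (J, J')
  -- The dominating point is the fixed pair `z₀` translated by the generic units. Over a local `R`
  -- any pair is a translate of `z₀`, and the units involved are specializations of the generic
  -- ones.
  refine ⟨Γ, inferInstance, inferInstance, inferInstance,
    ρ.translate (specOverMap (IsScalarTower.toAlgHom F K Γ) ≫ z₀) g h, fun R _ _ _ _ _ x => ?_⟩
  obtain ⟨θ⟩ := hN R
  obtain ⟨θ'⟩ := hN' R
  let y : Points Z R := specOverMap (IsScalarTower.toAlgHom F K R) ≫ z₀
  obtain ⟨u, hu⟩ := exists_translate_eq_of_isLocalRing θ (ρ.equiv R y).1 (ρ.equiv R x).1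
  obtain ⟨v, hv⟩ := exists_translate_eq_of_isLocalRing θ' (ρ.equiv R y).2 (ρ.equiv R x).2
  obtain ⟨φ, hφ, hφ'⟩ := hgh R u v
  refine ⟨φ.restrictScalars F, ?_⟩
  have hy : specOverMap (φ.restrictScalars F) ≫ specOverMap (IsScalarTower.toAlgHom F K Γ) ≫ z₀ =
      y := by
    rw [← Category.assoc, ← specOverMap_comp]
    congr 2
    exact AlgHom.ext fun a => φ.commutes a
  rw [specOverMap_translate, hφ, hφ', hy]
  apply (ρ.equiv R).injective
  rw [equiv_translate, hu, hv]

end PairRepresentation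

end PairRepresentation

/-! ### Integrality of the scheme of pairs -/

section Integral

theorem top_le_fromSpecStalk_preimage {X : Scheme.{u}} (x : X) (U : X.Opens) (hx : x ∈ U) :
    ⊤ ≤ X.fromSpecStalk x ⁻¹ᵁ U := by
  refine ((IsLocalRing.closed_point_mem_iff (U := X.fromSpecStalk x ⁻¹ᵁ U)).1 ?_).ge
  change X.fromSpecStalk x (IsLocalRing.closedPoint (X.presheaf.stalk x)) ∈ U
  rwa [Scheme.fromSpecStalk_closedPoint]

theorem fromSpecStalk_appLE {X : Scheme.{u}} (x : X) (U : X.Opens) (hx : x ∈ U) :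
    (X.fromSpecStalk x).appLE U ⊤ (top_le_fromSpecStalk_preimage x U hx) =
      X.presheaf.germ U x hx ≫ (Scheme.ΓSpecIso (X.presheaf.stalk x)).inv := by
  rw [Scheme.Hom.appLE, Scheme.fromSpecStalk_app hx, Category.assoc, Category.assoc,
    ← Functor.map_comp]
  congr 1

/-- A section of `X` vanishes at `x` if its pullback along a morphism through which some injective
local extension of the local ring factors vanishes. -/
theorem germ_eq_zero_of_app_eq_zero {X Y : Scheme.{u}} (γ : Y ⟶ X) {U : X.Opens} {x : X}
    (hx : x ∈ U) {R : CommRingCat.{u}} (ψ : X.presheaf.stalk x ⟶ R)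
    (hψ : Function.Injective ψ.hom) (f : Spec R ⟶ Y)
    (h : f ≫ γ = Spec.map ψ ≫ X.fromSpecStalk x) (s : Γ(X, U)) (hs : (γ.app U).hom s = 0) :
    (X.presheaf.germ U x hx).hom s = 0 := by
  have hle : ⊤ ≤ (Spec.map ψ ≫ X.fromSpecStalk x) ⁻¹ᵁ U := by
    rw [Scheme.Hom.comp_preimage]
    exact Scheme.Hom.preimage_mono _ (top_le_fromSpecStalk_preimage x U hx)
  have h1 : (Spec.map ψ ≫ X.fromSpecStalk x).appLE U ⊤ hle =
      X.presheaf.germ U x hx ≫ ψ ≫ (Scheme.ΓSpecIso R).inv := by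
    rw [← Scheme.Hom.appLE_comp_appLE _ _ U ⊤ ⊤ (top_le_fromSpecStalk_preimage x U hx) le_rfl,
      fromSpecStalk_appLE, Category.assoc, Scheme.ΓSpecIso_inv_naturality]
    exact congrArg _ (congrArg _ (Scheme.Hom.appLE_eq_app _))
  have h2 : ((Spec.map ψ ≫ X.fromSpecStalk x).appLE U ⊤ hle).hom s = 0 := by
    have : (f ≫ γ).appLE U ⊤ (h ▸ hle) = (Spec.map ψ ≫ X.fromSpecStalk x).appLE U ⊤ hle := by
      congr 1
    rw [← this, Scheme.Hom.comp_appLE]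
    exact (congrArg (f.appLE (γ ⁻¹ᵁ U) ⊤ _).hom hs).trans (map_zero (f.appLE (γ ⁻¹ᵁ U) ⊤ _).hom)
  rw [h1] at h2
  have h3 : Function.Injective (ψ ≫ (Scheme.ΓSpecIso R).inv).hom :=
    ((ConcreteCategory.bijective_of_isIso (Scheme.ΓSpecIso R).inv).1).comp hψ
  exact h3 (h2.trans (map_zero _).symm)

/-- A scheme is integral if its local rings have injective local extensions factoring through a
fixed morphism from an integral scheme. -/
theorem isIntegral_of_factorization {X Y : Scheme.{u}} [IsIntegral Y] (γ : Y ⟶ X)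
    (h : ∀ x : X, ∃ (R : Type u) (_ : CommRing R) (_ : IsLocalRing R)
      (ψ : X.presheaf.stalk x →+* R), IsLocalHom ψ ∧ Function.Injective ψ ∧
        ∃ f : Spec (.of R) ⟶ Y, f ≫ γ =
          Spec.map (CommRingCat.ofHom ψ) ≫ X.fromSpecStalk x) : IsIntegral X := by
  -- Because `ψ` is local, the closed point of `Spec R` is sent to `x`.
  have hsurj (x : X) : ∃ y : Y, γ y = x := by
    obtain ⟨R, _, _, ψ, hl, -, f, hf⟩ := h x
    let c : Spec (.of R) := IsLocalRing.closedPoint R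
    have hc : Spec.map (CommRingCat.ofHom ψ) c = IsLocalRing.closedPoint (X.presheaf.stalk x) :=
      IsLocalRing.comap_closedPoint ψ
    refine ⟨f c, (Scheme.Hom.comp_apply f γ c).symm.trans ?_⟩
    rw [hf]
    refine (Scheme.Hom.comp_apply _ _ c).trans ?_
    exact (congrArg _ hc).trans Scheme.fromSpecStalk_closedPoint
  have y₀ : Y := IsIntegral.nonempty.some
  refine ⟨⟨γ y₀⟩, fun U hU => ?_⟩
  obtain ⟨⟨x, hx⟩⟩ := hU
  obtain ⟨y, rfl⟩ := hsurj x
  have : Nonempty (γ ⁻¹ᵁ U : Y.Opens) := ⟨⟨y, hx⟩⟩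
  -- A section killed by `γ` has zero germ at every point of `U`. Hence the sections over `U` embed
  -- in a domain.
  have hinj : Function.Injective (γ.app U).hom := by
    rw [injective_iff_map_eq_zero]
    intro s hs
    refine TopCat.Presheaf.section_ext X.sheaf U s 0 fun x hx => ?_
    obtain ⟨R, _, _, ψ, hl, hψ, f, hf⟩ := h x
    exact (germ_eq_zero_of_app_eq_zero γ hx (CommRingCat.ofHom ψ) hψ f hf s hs).trans
      (map_zero _).symm
  exact hinj.isDomain (γ.app U).hom

variable {F : Type u} [Field F]

/-- Over a local ring and a field extension there is a local ring extending both. -/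
theorem exists_local_extension (O : Type u) [CommRing O] [IsLocalRing O] [Algebra F O] (K : Type u)
    [Field K] [Algebra F K] :
    ∃ (R : Type u) (_ : CommRing R) (_ : IsLocalRing R) (_ : Algebra K R) (_ : Algebra F R)
      (_ : IsScalarTower F K R) (ψ : O →ₐ[F] R),
      IsLocalHom (ψ : O →+* R) ∧ Function.Injective ψ := by
  let T := O ⊗[F] K
  -- Choose a prime of `O ⊗ K` above the maximal ideal of `O` and localize there: the result is flat
  -- and local over `O`, hence faithfully flat, and so contains `O`.
  obtain ⟨q, hq⟩ := PrimeSpectrum.comap_surjective_of_faithfullyFlat (A := O) (B := T)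
    (IsLocalRing.closedPoint O)
  let R := Localization.AtPrime q.asIdeal
  let : Algebra K T := Algebra.TensorProduct.rightAlgebra
  have hs : IsScalarTower F K T := inferInstance
  have hloc : IsLocalHom (algebraMap O R) := by
    rw [IsLocalRing.isLocalHom_iff_comap_closedPoint]
    rw [← hq, IsScalarTower.algebraMap_eq O T R, PrimeSpectrum.comap_comp]
    exact congrArg (PrimeSpectrum.comap (algebraMap O T))
      (PrimeSpectrum.ext (Localization.AtPrime.under_maximalIdeal (I := q.asIdeal)))
  have : Module.Flat O R := Module.Flat.trans O T R
  have : Module.FaithfullyFlat O R := Module.FaithfullyFlat.of_flat_of_isLocalHom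
  exact ⟨R, inferInstance, inferInstance, inferInstance, inferInstance, inferInstance,
    IsScalarTower.toAlgHom F O R, hloc, FaithfulSMul.algebraMap_injective O R⟩

variable {A : Type u} [Ring A] [Algebra F A] {k : ℕ} {n : Fin k → ℕ}
  {D : Type u} [Ring D] [Algebra F D] {l : ℕ} {m : Fin l → ℕ} {Z : Over (Spec (.of F))}
  [IsSimpleRing A] [Algebra.IsCentral F A] [Module.Finite F A]
  [IsSimpleRing D] [Algebra.IsCentral F D] [Module.Finite F D]

/-- A scheme representing pairs of flags is integral. -/
theorem PairRepresentation.isIntegral (ρ : PairRepresentation (F := F) A n D m Z) (hn : Monotone n)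
    (hle : ∀ i, n i ≤ degree F A) (hm : Monotone m) (hle' : ∀ i, m i ≤ degree F D) :
    IsIntegral Z.left := by
  let K := AlgebraicClosure F
  obtain ⟨Γ, _, _, _, γ, hγ⟩ := ρ.exists_dominating_point hn hle hm hle' K
  have : IsIntegral (specOver F Γ).left := inferInstanceAs (IsIntegral (Spec (.of Γ)))
  refine isIntegral_of_factorization γ.left fun x => ?_
  let α : CommRingCat.of F ⟶ Z.left.presheaf.stalk x :=
    Spec.preimage (Z.left.fromSpecStalk x ≫ Z.hom)
  let : Algebra F (Z.left.presheaf.stalk x) := α.hom.toAlgebra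
  let p : Points Z (Z.left.presheaf.stalk x) :=
    Over.homMk (Z.left.fromSpecStalk x) (Spec.map_preimage _).symm
  obtain ⟨R, _, _, _, _, _, ψ, hl, hψ⟩ :=
    exists_local_extension (F := F) (Z.left.presheaf.stalk x) K
  -- The local ring at `x` need not contain `K`, but its extension `R` does, so the canonical point
  -- over `R` factors through the dominating one.
  obtain ⟨φ, hφ⟩ := hγ R (specOverMap ψ ≫ p)
  exact ⟨R, inferInstance, inferInstance, ψ, hl, hψ, (specOverMap φ).left,
    congrArg Over.Hom.left hφ⟩

end Integral

/-! ### Morphisms from natural maps on points with values in algebras -/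

section Yoneda

variable {F : Type u} [Field F]

theorem exists_specOverMap_eq {R S : Type u} [CommRing R] [Algebra F R] [CommRing S] [Algebra F S]
    (h : specOver F S ⟶ specOver F R) : ∃ g : R →ₐ[F] S, specOverMap g = h := by
  let g : CommRingCat.of R ⟶ CommRingCat.of S := Spec.preimage h.left
  have hg : Spec.map g = h.left := Spec.map_preimage h.left
  have hw : CommRingCat.ofHom (algebraMap F R) ≫ g = CommRingCat.ofHom (algebraMap F S) := by
    apply Spec.map_injective
    rw [Spec.map_comp, hg]
    exact Over.w h
  refine ⟨{ g.hom with commutes' := fun a => ?_ }, ?_⟩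
  · exact congrArg (fun φ => φ.hom a) hw
  · ext1
    exact hg

theorem exists_iso_specOver (W : Over (Spec (.of F))) [IsAffine W.left] :
    ∃ (R : Type u) (_ : CommRing R) (_ : Algebra F R), Nonempty (W ≅ specOver F R) := by
  let α : CommRingCat.of F ⟶ Γ(W.left, ⊤) := Spec.preimage (W.left.isoSpec.inv ≫ W.hom)
  let : Algebra F Γ(W.left, ⊤) := α.hom.toAlgebra
  refine ⟨Γ(W.left, ⊤), inferInstance, inferInstance, ⟨Over.isoMk W.left.isoSpec ?_⟩⟩
  have : (specOver F Γ(W.left, ⊤)).hom = W.left.isoSpec.inv ≫ W.hom := Spec.map_preimage _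
  rw [this]
  exact Iso.hom_inv_id_assoc W.left.isoSpec W.hom

variable {Z X : Over (Spec (.of F))}
  (T : ∀ (R : Type u) [CommRing R] [Algebra F R], Points Z R → Points X R)
  (hT : ∀ (R S : Type u) [CommRing R] [Algebra F R] [CommRing S] [Algebra F S] (f : R →ₐ[F] S)
    (x : Points Z R), T S (specOverMap f ≫ x) = specOverMap f ≫ T R x)

include hT

/-- A natural map on points valued in algebras extends to points valued in affine schemes. -/
theorem exists_affine_extension :
    ∃ T' : ∀ (W : Over (Spec (.of F))) [IsAffine W.left], (W ⟶ Z) → (W ⟶ X),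
      (∀ (W W' : Over (Spec (.of F))) [IsAffine W.left] [IsAffine W'.left] (h : W' ⟶ W)
        (x : W ⟶ Z), T' W' (h ≫ x) = h ≫ T' W x) ∧
      ∀ (R : Type u) [CommRing R] [Algebra F R] [IsAffine (specOver F R).left] (x : Points Z R),
        T' (specOver F R) x = T R x := by
  choose R _ _ i using fun (W : Over (Spec (.of F))) (h : IsAffine W.left) => exists_iso_specOver W
  let e (W : Over (Spec (.of F))) (h : IsAffine W.left) : W ≅ specOver F (R W h) := (i W h).some
  refine ⟨fun W h x => (e W h).hom ≫ T (R W h) ((e W h).inv ≫ x), fun W W' hW hW' h x => ?_,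
    fun S _ _ hS x => ?_⟩
  · obtain ⟨g, hg⟩ := exists_specOverMap_eq ((e W' hW').inv ≫ h ≫ (e W hW).hom)
    have h1 : (e W' hW').inv ≫ h ≫ x = specOverMap g ≫ (e W hW).inv ≫ x := by
      rw [hg, Category.assoc, Category.assoc, Iso.hom_inv_id_assoc]
    dsimp only
    rw [h1, hT, hg, Category.assoc, Category.assoc, Iso.hom_inv_id_assoc]
  · obtain ⟨g, hg⟩ := exists_specOverMap_eq (e (specOver F S) hS).inv
    dsimp only
    rw [← hg, hT, hg, Iso.hom_inv_id_assoc]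

/-- A natural map on points is induced by a morphism. -/
theorem exists_hom_of_points : ∃ p : Z ⟶ X, ∀ (R : Type u) [CommRing R] [Algebra F R]
    (x : Points Z R), x ≫ p = T R x := by
  obtain ⟨T', hT', hTT'⟩ := exists_affine_extension T hT
  -- With the cover directed by inclusions of affine opens, gluing only needs compatibility along
  -- inclusions, which is naturality of `T'`; overlaps need not be affine.
  let 𝒰 := Scheme.directedAffineCover Z.left
  let W (U : 𝒰.I₀) : Over (Spec (.of F)) := Over.mk (𝒰.f U ≫ Z.hom)
  have hW (U : 𝒰.I₀) : IsAffine (W U).left := U.2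
  let x (U : 𝒰.I₀) : W U ⟶ Z := Over.homMk (𝒰.f U) rfl
  have htrans {U V : 𝒰.I₀} (hij : U ⟶ V) :
      𝒰.trans hij ≫ (T' (W V) (x V)).left = (T' (W U) (x U)).left := by
    let h : W U ⟶ W V := Over.homMk (𝒰.trans hij) (by
      refine (Category.assoc _ _ _).symm.trans ?_
      exact congrArg (· ≫ Z.hom) (Scheme.Cover.trans_map 𝒰 hij))
    have h1 : h ≫ x V = x U := by
      ext1
      exact Scheme.Cover.trans_map 𝒰 hij
    exact congrArg Over.Hom.left ((hT' (W V) (W U) h (x V)).symm.trans (congrArg (T' (W U)) h1))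
  let p : Z ⟶ X := Scheme.OpenCover.glueMorphismsOverOfLocallyDirected 𝒰
    (fun U => (T' (W U) (x U)).left) htrans (fun U => Over.w (T' (W U) (x U)))
  have hp (U : 𝒰.I₀) : x U ≫ p = T' (W U) (x U) := by
    ext1
    exact Scheme.OpenCover.map_glueMorphismsOverOfLocallyDirected_left _ _ _ _ U
  refine ⟨p, fun R _ _ y => ?_⟩
  have hR : IsAffine (specOver F R).left := inferInstanceAs (IsAffine (Spec (.of R)))
  rw [← hTT']
  ext1
  -- The given point need not land in one chart of `Z`, so its source is covered by affine opens
  -- that do.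
  have hcov (w : (specOver F R).left) : ∃ (V : (specOver F R).left.Opens) (U : 𝒰.I₀),
      w ∈ V ∧ IsAffineOpen V ∧ V ≤ y.left ⁻¹ᵁ (𝒰.f U).opensRange := by
    obtain ⟨_, ⟨V, hV, rfl⟩, hwV, hVU⟩ :=
      (specOver F R).left.isBasis_affineOpens.exists_subset_of_mem_open
        (u := (y.left ⁻¹ᵁ (𝒰.f (𝒰.idx (y.left w))).opensRange : (specOver F R).left.Opens))
        (a := w) (𝒰.covers (y.left w)) (TopologicalSpace.Opens.isOpen _)
    exact ⟨V, _, hwV, hV, hVU⟩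
  choose V U hwV hV hVU using hcov
  refine Scheme.Cover.hom_ext ((specOver F R).left.openCoverOfIsOpenCover V
    (TopologicalSpace.IsOpenCover.mk (eq_top_iff.2 fun w _ =>
      TopologicalSpace.Opens.mem_iSup.2 ⟨w, hwV w⟩))) _ _ fun w => ?_
  let Y : Over (Spec (.of F)) := Over.mk ((V w).ι ≫ (specOver F R).hom)
  have hY : IsAffine Y.left := hV w
  let ι : Y ⟶ specOver F R := Over.homMk (V w).ι rfl
  have hrange : Set.range ((V w).ι ≫ y.left) ⊆ Set.range (𝒰.f (U w)) := by
    rintro _ ⟨v, rfl⟩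
    exact hVU w v.2
  let g : Y ⟶ W (U w) := Over.homMk (IsOpenImmersion.lift (𝒰.f (U w)) ((V w).ι ≫ y.left) hrange) (by
    change _ ≫ 𝒰.f (U w) ≫ Z.hom = _
    rw [IsOpenImmersion.lift_fac_assoc, Category.assoc, Over.w y]
    rfl)
  have hg : g ≫ x (U w) = ι ≫ y := by
    ext1
    exact IsOpenImmersion.lift_fac _ _ _
  have key : ι ≫ y ≫ p = ι ≫ T' (specOver F R) y := by
    rw [← Category.assoc, ← hg, Category.assoc, hp, ← hT', ← hT', hg]
  exact congrArg Over.Hom.left key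

end Yoneda

/-! ### The affine line and elementary linkage -/

section Line

open MvPolynomial HomogeneousLocalization

attribute [local instance] MvPolynomial.gradedAlgebra

variable (K : Type u) [Field K]

/-- The affine line as an open subscheme of the projective line. -/
theorem exists_affineLine :
    ∃ (R : Type u) (_ : CommRing R) (_ : Algebra K R) (c : specOver K R ⟶ projectiveSpace K 1)
      (t : R) (e : K → (R →ₐ[K] K)), IsOpenImmersion c.left ∧ ∀ a, e a t = a := by
  let 𝒜 := homogeneousSubmodule (Fin (1 + 1)) K
  let R := Away 𝒜 (X 0)
  let : Algebra K R := ((fromZeroRingHom 𝒜 (Submonoid.powers (X 0))).comp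
    (algebraMap K (𝒜 0))).toAlgebra
  have halg (a : K) : algebraMap K R a = Away.mk 𝒜 (X_mem_homogeneousSubmodule 0) 0 (C a)
      (C_mem_homogeneousSubmodule a) := fromZeroRingHom_algebraMap 0 a
  let c : specOver K R ⟶ projectiveSpace K 1 :=
    Over.homMk (Proj.awayι 𝒜 (X 0) (X_mem_homogeneousSubmodule 0) one_pos) (by
      change Proj.awayι 𝒜 (X 0) _ _ ≫ Proj.toSpecZero 𝒜 ≫ Spec.map _ = Spec.map _
      rw [Proj.awayι_toSpecZero_assoc, ← Spec.map_comp]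
      rfl)
  -- The evaluation `e a` is the point `[1 : a]`, and the coordinate `t` is `X 1 / X 0`.
  have hu (a : K) : IsUnit (evalHom K ![1, a] (X 0)) := isUnit_evalHom_X (by simp)
  let e (a : K) : R →ₐ[K] K :=
    { awayEval 𝒜 (evalHom K ![1, a]) (X 0) (hu a) with
      commutes' := fun b => by
        have := awayEval_mk (evalHom K ![1, a]) (hu a) (X_mem_homogeneousSubmodule 0) 0 (C b)
          (C_mem_homogeneousSubmodule b)
        rw [pow_zero, mul_one] at this
        change awayEval 𝒜 (evalHom K ![1, a]) (X 0) (hu a) (algebraMap K R b) = b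
        rw [halg, this]
        simp }
  refine ⟨R, inferInstance, inferInstance, c, Away.mk 𝒜 (X_mem_homogeneousSubmodule 0) 1 (X 1)
    (X_mem_homogeneousSubmodule' 1), e, ?_, fun a => ?_⟩
  · exact inferInstanceAs (IsOpenImmersion (Proj.awayι 𝒜 (X 0) _ _))
  · have := awayEval_mk (evalHom K ![1, a]) (hu a) (X_mem_homogeneousSubmodule 0) 1 (X 1)
      (X_mem_homogeneousSubmodule' 1)
    have h1 : evalHom K ![1, a] (X 0) = 1 := by simp
    have h2 : evalHom K ![1, a] (X 1) = a := by simp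
    rwa [h1, h2, one_pow, mul_one] at this

variable {K} in
/-- Nonempty open subsets of a projective space are dense. -/
theorem dense_of_nonempty {N : ℕ} (U : (projectiveSpace K N).left.Opens)
    (hU : (U : Set (projectiveSpace K N).left).Nonempty) :
    Dense (U : Set (projectiveSpace K N).left) := by
  let 𝒜 := homogeneousSubmodule (Fin (N + 1)) K
  -- The generic point, given by the zero ideal; every nonempty open set contains it.
  let η : ProjectiveSpectrum 𝒜 :=
    { asHomogeneousIdeal := ⊥
      isPrime := by
        rw [HomogeneousIdeal.toIdeal_bot]
        exact Ideal.isPrime_bot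
      not_irrelevant_le := fun h => by
        have h1 : (X 0 : MvPolynomial (Fin (N + 1)) K) ∈ HomogeneousIdeal.irrelevant 𝒜 := by
          rw [HomogeneousIdeal.mem_irrelevant_iff]
          exact DirectSum.decompose_of_mem_ne 𝒜 (X_mem_homogeneousSubmodule 0) one_ne_zero
        have h2 : (X 0 : MvPolynomial (Fin (N + 1)) K) = 0 := h h1
        exact X_ne_zero 0 h2 }
  have hη (x : ProjectiveSpectrum 𝒜) : x ∈ closure {η} :=
    (ProjectiveSpectrum.le_iff_mem_closure 𝒜 η x).1
      (show η.asHomogeneousIdeal ≤ x.asHomogeneousIdeal from bot_le)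
  have hmem : η ∈ (U : Set (projectiveSpace K N).left) := by
    obtain ⟨x, hx⟩ := hU
    obtain ⟨y, hy, rfl⟩ := mem_closure_iff.1 (hη x) (U : Set (projectiveSpace K N).left) U.isOpen hx
    exact hy
  exact fun x => closure_mono (Set.singleton_subset_iff.2 hmem) (hη x)

variable {K} in
/-- Two points on a curve parametrized by an open subscheme of the projective line are linked. -/
theorem elementarilyLinked_of_curve {X : Over (Spec (.of K))} {B : Type u} [CommRing B]
    [Algebra K B] (c : specOver K B ⟶ projectiveSpace K 1) [IsOpenImmersion c.left]
    (f : Points X B) (e₁ e₂ : B →ₐ[K] K) :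
    ElementarilyLinked X (specOverMap e₁ ≫ f) (specOverMap e₂ ≫ f) := by
  let i := c.left.isoOpensRange
  have hne : (c.left.opensRange : Set (projectiveSpace K 1).left).Nonempty :=
    ⟨c.left ((specOverMap e₁).left (⊥ : PrimeSpectrum K)), _, rfl⟩
  refine ⟨⟨c.left.opensRange, dense_of_nonempty _ hne, i.inv ≫ f.left⟩, ?_,
    ⟨(specOverMap e₁).left ≫ i.hom, ?_⟩, ⟨(specOverMap e₂).left ≫ i.hom, ?_⟩⟩
  · have h1 : i.inv ≫ c.left = c.left.opensRange.ι := Scheme.Hom.isoOpensRange_inv_comp c.left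
    change (i.inv ≫ f.left) ≫ X.hom = c.left.opensRange.ι ≫ (projectiveSpace K 1).hom
    rw [Category.assoc, Over.w f, ← h1, Category.assoc, Over.w c]
  · change ((specOverMap e₁).left ≫ i.hom) ≫ i.inv ≫ f.left = _
    rw [Category.assoc, Iso.hom_inv_id_assoc]
    rfl
  · change ((specOverMap e₂).left ≫ i.hom) ≫ i.inv ≫ f.left = _
    rw [Category.assoc, Iso.hom_inv_id_assoc]
    rfl

end Line

/-! ### Points of fibers -/

section Pullback

variable {C : Type*} [Category* C] [HasPullbacks C] {W V Z X S : C}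

theorem comp_pullback_lift {p : Z ⟶ X} {y : S ⟶ X} (e : V ⟶ W) {a : W ⟶ Z} {b : W ⟶ S}
    {a' : V ⟶ Z} {b' : V ⟶ S} (h : a ≫ p = b ≫ y) (h' : a' ≫ p = b' ≫ y) (ha : e ≫ a = a')
    (hb : e ≫ b = b') : e ≫ pullback.lift a b h = pullback.lift a' b' h' := by
  subst ha hb
  apply pullback.hom_ext
  · rw [Category.assoc, pullback.lift_fst, pullback.lift_fst]
  · rw [Category.assoc, pullback.lift_snd, pullback.lift_snd]

theorem fst_comp_of_snd_eq_id {p : Z ⟶ X} {y : S ⟶ X} (x : S ⟶ pullback p y)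
    (hx : x ≫ pullback.snd p y = 𝟙 S) : (x ≫ pullback.fst p y) ≫ p = y := by
  rw [Category.assoc, pullback.condition, ← Category.assoc, hx, Category.id_comp]

end Pullback

section Fiber

variable {F : Type u} [Field F] {Z X : Over (Spec (.of F))} (p : Z ⟶ X) {L : Type u} [Field L]
  [Algebra F L] (y : Points X L)

/-- The scheme-theoretic fiber over a point with values in a field. -/
abbrev fiber : Over (Spec (.of L)) :=
  Over.mk (pullback.snd p.left (y.left : Spec (.of L) ⟶ X.left))

variable {p y}

/-- A point of the fiber with values in an algebra. -/
def fiberPoint {B : Type u} [CommRing B] [Algebra F B] [Algebra L B] [IsScalarTower F L B]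
    (z : Points Z B) (hz : z ≫ p = specOverMap (IsScalarTower.toAlgHom F L B) ≫ y) :
    Points (fiber p y) B :=
  Over.homMk (pullback.lift z.left (Spec.map (CommRingCat.ofHom (algebraMap L B)))
    (congrArg Over.Hom.left hz)) (pullback.lift_snd _ _ _)

theorem specOverMap_fiberPoint {B C : Type u} [CommRing B] [Algebra F B] [Algebra L B]
    [IsScalarTower F L B] [CommRing C] [Algebra F C] [Algebra L C] [IsScalarTower F L C]
    (e : B →ₐ[L] C) (z : Points Z B)
    (hz : z ≫ p = specOverMap (IsScalarTower.toAlgHom F L B) ≫ y)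
    (w : Points Z C) (hw : w ≫ p = specOverMap (IsScalarTower.toAlgHom F L C) ≫ y)
    (hzw : specOverMap (e.restrictScalars F) ≫ z = w) :
    specOverMap e ≫ fiberPoint z hz = fiberPoint w hw := by
  ext1
  exact comp_pullback_lift _ _ _ (congrArg Over.Hom.left hzw) (Over.w (specOverMap e))

/-- An `L`-point of the fiber is a section of its structure map, so it is determined by its
component in `Z`, an `L`-point above `y`. -/
theorem exists_fiberPoint_eq (x : Points (fiber p y) L) :
    ∃ (z : Points Z L) (hz : z ≫ p = specOverMap (IsScalarTower.toAlgHom F L L) ≫ y),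
      fiberPoint z hz = x := by
  let y' : Spec (.of L) ⟶ X.left := y.left
  let x' : Spec (.of L) ⟶ pullback p.left y' := x.left
  have hx : x' ≫ pullback.snd p.left y' = 𝟙 (Spec (.of L)) := (Over.w x).trans (Spec.map_id _)
  have hx' := fst_comp_of_snd_eq_id x' hx
  have hw : (x' ≫ pullback.fst p.left y') ≫ Z.hom = (specOver F L).hom := by
    rw [← Over.w p]
    exact ((Category.assoc _ _ _).symm.trans (congrArg (· ≫ X.hom) hx')).trans (Over.w y)
  let z : Points Z L := Over.homMk (x' ≫ pullback.fst p.left y') hw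
  have hid : specOverMap (IsScalarTower.toAlgHom F L L) ≫ y = y :=
    (congrArg (· ≫ y) specOverMap_id).trans (Category.id_comp y)
  have hz : z ≫ p = specOverMap (IsScalarTower.toAlgHom F L L) ≫ y := by
    rw [hid]
    ext1
    exact hx'
  refine ⟨z, hz, ?_⟩
  ext1
  apply pullback.hom_ext
  · exact pullback.lift_fst _ _ _
  · exact (pullback.lift_snd _ _ _).trans (Over.w x).symm

end Fiber

/-! ### R-triviality of the fibers -/

section Fibers

variable {F : Type u} [Field F] {A : Type u} [Ring A] [Algebra F A] {k : ℕ} {n : Fin k → ℕ}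
  {D : Type u} [Ring D] [Algebra F D] {l : ℕ} {m : Fin l → ℕ} {Z X : Over (Spec (.of F))}

theorem RightIdealFlag.translate_one {R : Type u} [CommRing R] [Algebra F R]
    (J : RightIdealFlag (F := F) A n R) : J.translate 1 = J := by
  refine RightIdealFlag.ext' fun i => ?_
  ext x
  constructor
  · rintro ⟨x, hx, rfl⟩
    simpa using hx
  · intro hx
    exact ⟨x, hx, by simp⟩

/-- Interchange of the two flags. -/
def PairRepresentation.swap (ρ : PairRepresentation (F := F) A n D m Z) :
    PairRepresentation (F := F) D m A n Z where
  equiv R _ _ := (ρ.equiv R).trans (Equiv.prodComm _ _)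
  fst_ideal := ρ.snd_ideal
  snd_ideal := ρ.fst_ideal

/-- Two units are joined by a path of units over an open part of the affine line. -/
theorem exists_unit_path [Module.Finite F D] {L : Type u} [Field L] [Algebra F L]
    (g : (L ⊗[F] D)ˣ) :
    ∃ (B : Type u) (_ : CommRing B) (_ : Algebra L B) (_ : Algebra F B) (_ : IsScalarTower F L B)
      (c : specOver L B ⟶ projectiveSpace L 1) (G : (B ⊗[F] D)ˣ) (e₀ e₁ : B →ₐ[L] L),
      IsOpenImmersion c.left ∧
      Units.map (Algebra.TensorProduct.map (e₀.restrictScalars F)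
        (AlgHom.id F D)).toMonoidHom G = 1 ∧
      Units.map (Algebra.TensorProduct.map (e₁.restrictScalars F)
        (AlgHom.id F D)).toMonoidHom G = g := by
  obtain ⟨R, _, _, c, t, e, hc, he⟩ := exists_affineLine L
  let : Algebra F R := ((algebraMap L R).comp (algebraMap F L)).toAlgebra
  have : IsScalarTower F L R := IsScalarTower.of_algebraMap_eq fun _ => rfl
  -- The line `1 + t(g - 1)` through `1` at `t = 0` and `g` at `t = 1`. Inverting its norm `h`
  -- removes the parameters where it is not a unit, and neither endpoint is lost.
  let G : R ⊗[F] D := 1 + t ⊗ₜ[F] 1 *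
    (Algebra.TensorProduct.map (IsScalarTower.toAlgHom F L R) (AlgHom.id F D) g - 1)
  have hG (a : L) : Algebra.TensorProduct.map ((e a).restrictScalars F) (AlgHom.id F D) G =
      1 + a ⊗ₜ[F] 1 * ((g : L ⊗[F] D) - 1) := by
    have hcomp : ((e a).restrictScalars F).comp (IsScalarTower.toAlgHom F L R) = AlgHom.id F L :=
      AlgHom.ext fun x => (e a).commutes x
    simp only [G, map_add, map_one, map_mul, map_sub, map_id_map_id, hcomp,
      Algebra.TensorProduct.map_id, Algebra.TensorProduct.map_tmul, AlgHom.coe_id, id_eq,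
      AlgHom.coe_restrictScalars', he]
  have hG0 : Algebra.TensorProduct.map ((e 0).restrictScalars F) (AlgHom.id F D) G = 1 := by
    rw [hG, zero_tmul, zero_mul, add_zero]
  have hG1 : Algebra.TensorProduct.map ((e 1).restrictScalars F) (AlgHom.id F D) G = g := by
    rw [hG, ← Algebra.TensorProduct.one_def, one_mul, add_sub_cancel]
  let h : R := Algebra.norm R G
  have hh (a : L) : e a h = Algebra.norm L
      (Algebra.TensorProduct.map ((e a).restrictScalars F) (AlgHom.id F D) G) :=
    (norm_map ((e a).restrictScalars F) G).symm
  have hu0 : IsUnit (e 0 h) := by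
    rw [hh, hG0, map_one]
    exact isUnit_one
  have hu1 : IsUnit (e 1 h) := by
    rw [hh, hG1]
    exact g.isUnit.map _
  obtain ⟨e₀, he₀⟩ := exists_away_lift (e 0) hu0
  obtain ⟨e₁, he₁⟩ := exists_away_lift (e 1) hu1
  have hGu : IsUnit (Algebra.TensorProduct.map (awayHom F h) (AlgHom.id F D) G) := by
    rw [isUnit_iff_isUnit_norm (R := Localization.Away h), norm_map]
    exact IsLocalization.Away.algebraMap_isUnit h
  refine ⟨Localization.Away h, inferInstance, inferInstance, inferInstance, inferInstance,
    specOverMap (awayHom L h) ≫ c, hGu.unit, e₀, e₁, ?_, Units.ext ?_, Units.ext ?_⟩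
  · have : IsOpenImmersion (specOverMap (awayHom L h)).left :=
      inferInstanceAs (IsOpenImmersion (Spec.map (CommRingCat.ofHom
        (algebraMap R (Localization.Away h)))))
    exact inferInstanceAs (IsOpenImmersion ((specOverMap (awayHom L h)).left ≫ c.left))
  · have h1 : (e₀.restrictScalars F).comp (awayHom F h) = (e 0).restrictScalars F :=
      AlgHom.ext fun x => DFunLike.congr_fun he₀ x
    refine (map_id_map_id (awayHom F h) (e₀.restrictScalars F) G).trans ?_
    rw [h1, hG0]
    rfl
  · have h1 : (e₁.restrictScalars F).comp (awayHom F h) = (e 1).restrictScalars F :=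
      AlgHom.ext fun x => DFunLike.congr_fun he₁ x
    refine (map_id_map_id (awayHom F h) (e₁.restrictScalars F) G).trans ?_
    rw [h1, hG1]

variable [IsSimpleRing D] [Algebra.IsCentral F D] [Module.Finite F D]

/-- The projection from pairs of flags to the first flag has R-trivial fibers if a flag of the
second kind exists over every field over which there is one of the first kind. -/
theorem PairRepresentation.exists_hasRTrivialFibers (ρ : PairRepresentation (F := F) A n D m Z)
    (hX : IsSeveriBrauerFlagVariety (F := F) A n X)
    (hne : ∀ (L : Type u) [Field L] [Algebra F L], RightIdealFlag (F := F) A n L →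
      Nonempty (RightIdealFlag (F := F) D m L)) :
    ∃ p : Z ⟶ X, HasRTrivialFibers p := by
  obtain ⟨ε, hε⟩ := hX
  obtain ⟨p, hp⟩ := exists_hom_of_points (Z := Z) (X := X)
    (fun R _ _ z => (ε R).symm (ρ.equiv R z).1) (fun R S _ _ _ _ f z => by
      apply (ε S).injective
      rw [Equiv.apply_symm_apply]
      refine RightIdealFlag.ext' fun i => ?_
      rw [hε, Equiv.apply_symm_apply]
      exact ρ.fst_ideal R S f z i)
  have hp' (R : Type u) [CommRing R] [Algebra F R] (z : Points Z R) :
      ε R (z ≫ p) = (ρ.equiv R z).1 := by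
    rw [hp, Equiv.apply_symm_apply]
  refine ⟨p, fun L _ _ y => ?_⟩
  have hid : specOverMap (IsScalarTower.toAlgHom F L L) ≫ y = y :=
    (congrArg (· ≫ y) specOverMap_id).trans (Category.id_comp y)
  refine Nat.card_eq_one_iff_unique.2 ⟨⟨fun a b => ?_⟩, ?_⟩
  · induction a using Quotient.inductionOn with | _ a
    induction b using Quotient.inductionOn with | _ b
    refine Quotient.sound (Relation.EqvGen.rel _ _ ?_)
    obtain ⟨z, hz, rfl⟩ := exists_fiberPoint_eq a
    obtain ⟨w, hw, rfl⟩ := exists_fiberPoint_eq b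
    -- Two points of the fiber share the first flag. The path of units moves only the second flag,
    -- so it stays in the fiber and links the points directly.
    obtain ⟨g, hg⟩ := exists_translate_eq_of_field (ρ.equiv L z).2 (ρ.equiv L w).2
    obtain ⟨B, _, _, _, _, c, G, e₀, e₁, hc, h₀, h₁⟩ := exists_unit_path g
    let f : Points Z B :=
      ρ.translate (specOverMap (IsScalarTower.toAlgHom F L B) ≫ z) 1 G
    have hf : f ≫ p = specOverMap (IsScalarTower.toAlgHom F L B) ≫ y := by
      rw [← hid, ← hz, ← Category.assoc]
      apply (ε B).injective
      rw [hp', hp', ρ.equiv_translate, RightIdealFlag.translate_one]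
    have hcomp (e : B →ₐ[L] L) : specOverMap (e.restrictScalars F) ≫
        specOverMap (IsScalarTower.toAlgHom F L B) ≫ z = z := by
      rw [← Category.assoc, ← specOverMap_comp]
      have : (e.restrictScalars F).comp (IsScalarTower.toAlgHom F L B) = AlgHom.id F L :=
        AlgHom.ext fun x => e.commutes x
      rw [this, specOverMap_id, Category.id_comp]
    have hz' : specOverMap (e₀.restrictScalars F) ≫ f = z := by
      rw [ρ.specOverMap_translate, hcomp, h₀, map_one]
      apply (ρ.equiv L).injective
      rw [ρ.equiv_translate, RightIdealFlag.translate_one, RightIdealFlag.translate_one]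
    have hw' : specOverMap (e₁.restrictScalars F) ≫ f = w := by
      rw [ρ.specOverMap_translate, hcomp, h₁, map_one]
      apply (ρ.equiv L).injective
      rw [ρ.equiv_translate, RightIdealFlag.translate_one, hg]
      refine Prod.ext ?_ rfl
      change (ρ.equiv L z).1 = (ρ.equiv L w).1
      rw [← hp', ← hp', hz, hw]
    have := elementarilyLinked_of_curve c (fiberPoint f hf) e₀ e₁
    rwa [specOverMap_fiberPoint e₀ f hf z hz hz', specOverMap_fiberPoint e₁ f hf w hw hw'] at this
  -- The fiber is nonempty: pair the flag given by `y` with any flag of the second kind over `L`.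
  · obtain ⟨J⟩ := hne L (ε L y)
    refine ⟨Quotient.mk _ (fiberPoint ((ρ.equiv L).symm (ε L y, J)) ?_)⟩
    rw [hid]
    apply (ε L).injective
    rw [hp', Equiv.apply_symm_apply]

end Fibers

/-! ### Projective varieties of flags and their comparison -/

section Varieties

variable {F : Type u} [Field F] (A : Type u) [Ring A] [Algebra F A] [IsSimpleRing A]
  [Algebra.IsCentral F A] [Module.Finite F A] {k : ℕ} {n : Fin k → ℕ}
  (D : Type u) [Ring D] [Algebra F D] [IsSimpleRing D]
  [Algebra.IsCentral F D] [Module.Finite F D] {l : ℕ} {m : Fin l → ℕ}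

/-- Pairs of flags are represented by a projective variety. -/
theorem exists_pairRepresentation (hn : Monotone n) (hle : ∀ i, n i ≤ degree F A) (hm : Monotone m)
    (hle' : ∀ i, m i ≤ degree F D) :
    ∃ Z : ProjectiveVariety F, Nonempty (PairRepresentation (F := F) A n D m Z.scheme) := by
  obtain ⟨Z, N, j, hj, E, hE⟩ := exists_representation_flags (F := F) (A := A) n D m
  let ρ : PairRepresentation (F := F) A n D m Z :=
    ⟨E, fun R S _ _ _ _ f x i => (hE R S f x).1 i, fun R S _ _ _ _ f x i => (hE R S f x).2 i⟩
  exact ⟨⟨Z, ρ.isIntegral hn hle hm hle', N, j, hj⟩, ⟨ρ⟩⟩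

/-- Severi–Brauer flag varieties exist as projective varieties. -/
theorem exists_isSeveriBrauerFlagVariety (hn : Monotone n) (hle : ∀ i, n i ≤ degree F A) :
    ∃ X : ProjectiveVariety F, IsSeveriBrauerFlagVariety (F := F) A n X.scheme := by
  -- With an empty second flag, pairs of flags are single flags.
  obtain ⟨Z, ⟨ρ⟩⟩ := exists_pairRepresentation A A (m := (Fin.elim0 : Fin 0 → ℕ)) hn hle
    (fun i => i.elim0) (fun i => i.elim0)
  let uniq (R : Type u) [CommRing R] [Algebra F R] :
      Unique (RightIdealFlag (F := F) A (Fin.elim0 : Fin 0 → ℕ) R) :=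
    { default := ⟨fun i => i.elim0, fun i => i.elim0, fun i => i.elim0, fun i => i.elim0,
        fun i => i.elim0⟩
      uniq := fun _ => RightIdealFlag.ext' fun i => i.elim0 }
  exact ⟨Z, fun R _ _ => (ρ.equiv R).trans (Equiv.prodUnique _ _),
    fun R S _ _ _ _ f x i => ρ.fst_ideal R S f x i⟩

variable {A D}

/-- The arithmetic behind the comparison of flags in Brauer equivalent algebras. -/
theorem rightDim_dvd_iff {a b : ℕ} (ha : a ≠ 0) (hb : b ≠ 0)
    (e : Matrix (Fin a) (Fin a) A ≃ₐ[F] Matrix (Fin b) (Fin b) D) (L : Type u) [Field L]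
    [Algebra F L] :
    (∀ i, rightDim L (L ⊗[F] A) ∣ n i * degree F A) ↔
      rightDim L (L ⊗[F] D) ∣ Nat.gcd (Finset.univ.gcd n) (index F A) * degree F D := by
  have h := rightDim_mul_degree_of_matrix_algEquiv ha hb e L
  -- Since `rightDim` always divides `ind A · deg A`, the index may be included in the gcd without
  -- changing the condition.
  have h1 : (∀ i, rightDim L (L ⊗[F] A) ∣ n i * degree F A) ↔
      rightDim L (L ⊗[F] A) ∣ Nat.gcd (Finset.univ.gcd n) (index F A) * degree F A := by
    constructor
    · intro hi
      rw [← Nat.gcd_mul_right]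
      refine Nat.dvd_gcd ?_ (rightDim_baseChange_dvd A L)
      have : (Finset.univ.gcd fun i => n i * degree F A) = Finset.univ.gcd n * degree F A := by
        rw [Finset.gcd_mul_right, normalize_eq]
      rw [← this]
      exact Finset.dvd_gcd fun i _ => hi i
    · intro hd i
      refine hd.trans (Nat.mul_dvd_mul_right ((Nat.gcd_dvd_left _ _).trans ?_) _)
      exact Finset.gcd_dvd (Finset.mem_univ i)
  rw [h1, ← Nat.mul_dvd_mul_iff_right (degree_pos F D), h, mul_right_comm,
    Nat.mul_dvd_mul_iff_right (degree_pos F A)]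

/-- The variety of pairs maps to both flag varieties. By `rightDim_dvd_iff` a flag of either kind
over `L` forces one of the other kind, so both projections have R-trivial fibers. -/
theorem stablyRIsomorphic_of_matrix_algEquiv {a b : ℕ} (ha : a ≠ 0) (hb : b ≠ 0)
    (e : Matrix (Fin a) (Fin a) A ≃ₐ[F] Matrix (Fin b) (Fin b) D) (hn : Monotone n)
    (hle : ∀ i, n i ≤ degree F A) {d : ℕ} (hd : d = Nat.gcd (Finset.univ.gcd n) (index F A))
    (hd' : d ≤ degree F D) (X Y : ProjectiveVariety F)
    (hX : IsSeveriBrauerFlagVariety (F := F) A n X.scheme)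
    (hY : IsSeveriBrauerFlagVariety (F := F) D ![d] Y.scheme) : StablyRIsomorphic X Y := by
  have hm : Monotone ![d] := fun i j _ => by rw [Subsingleton.elim i j]
  have hle' : ∀ i, ![d] i ≤ degree F D := fun i => by simpa using hd'
  obtain ⟨Z, ⟨ρ⟩⟩ := exists_pairRepresentation A D hn hle hm hle'
  have key (L : Type u) [Field L] [Algebra F L] := rightDim_dvd_iff (n := n) ha hb e L
  rw [← hd] at key
  obtain hp := ρ.exists_hasRTrivialFibers hX fun L _ _ J =>
    nonempty_rightIdealFlag L hm hle' fun i => by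
      simpa using (key L).1 fun i => J.rightDim_dvd i
  obtain hq := ρ.swap.exists_hasRTrivialFibers hY fun L _ _ J =>
    nonempty_rightIdealFlag L hn hle ((key L).2 (by simpa using J.rightDim_dvd 0))
  exact ((Relation.EqvGen.rel Z X hp).symm).trans _ _ _ (Relation.EqvGen.rel Z Y hq)

end Varieties

end

end SBFlag

theorem mainTheorem11 {F : Type u} [Field F] (A D : CSA.{u, u} F)
    (hAD : IsBrauerEquivalent A D) {k : ℕ} (hk : 1 ≤ k) (n : Fin k → ℕ)
    (hn_pos : ∀ i, 0 < n i) (hn_mono : StrictMono n)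
    (hn_le : ∀ i, n i ≤ SBFlag.degree F A)
    (d : ℕ) (hd : d = Nat.gcd (Finset.univ.gcd n) (SBFlag.index F A)) :
    (∃ X : SBFlag.ProjectiveVariety F,
      SBFlag.IsSeveriBrauerFlagVariety (F := F) A n X.scheme) ∧
    (∃ Y : SBFlag.ProjectiveVariety F,
      SBFlag.IsSeveriBrauerFlagVariety (F := F) D ![d] Y.scheme) ∧
    ∀ X Y : SBFlag.ProjectiveVariety F,
      SBFlag.IsSeveriBrauerFlagVariety (F := F) A n X.scheme →
      SBFlag.IsSeveriBrauerFlagVariety (F := F) D ![d] Y.scheme →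
      SBFlag.StablyRIsomorphic X Y := by
  obtain ⟨a, b, ha, hb, ⟨e⟩⟩ := hAD
  -- Here `d` divides the index of `A`, which is at most the degree of `D`. The index is positive
  -- because a simple module has positive dimension.
  have hd' : d ≤ SBFlag.degree F D := by
    refine le_trans (Nat.le_of_dvd ?_ (hd ▸ Nat.gcd_dvd_right _ _))
      (SBFlag.index_le_degree_of_matrix_algEquiv ha hb e)
    refine Nat.pos_of_ne_zero fun h => ?_
    have h1 := SBFlag.rightDim_eq_index_mul_degree (F := F) A
    rw [h, zero_mul] at h1
    exact (SBFlag.simpleDim_pos F (A : Type _)ᵐᵒᵖ).ne' h1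
  exact ⟨SBFlag.exists_isSeveriBrauerFlagVariety A hn_mono.monotone hn_le,
    SBFlag.exists_isSeveriBrauerFlagVariety D (fun i j _ => by rw [Subsingleton.elim i j])
      (fun i => by simpa using hd'),
    SBFlag.stablyRIsomorphic_of_matrix_algEquiv ha hb e hn_mono.monotone hn_le hd hd'⟩
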